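/- **Theorem.** Let $Q^n$ be the graph of the $n$-cube: its vertices are the $2^n$ sequences in $\{0,1\}^n$, two of them being adjacent when they differ in exactly one coordinate. Let $p(n)\in[0,1]$ satisfy $p(n)\le n^{-1+o(1)}$, and let $G=G(Q^n,p(n))$ be the random subgraph of $Q^n$ on all $2^n$ vertices in which each edge is kept independently with probability $p(n)$. Let $\lambda_{\max}(G)$ be the largest eigenvalue of the adjacency matrix of $G$ and $\Delta(G)$ its maximum degree. For non-negative sequences, $a_n\ll b_n$ (and $a_n=o(b_n)$) means $a_n/b_n\to0$; two sequences are *proportional* if $a_n=\Theta(b_n)$, i.e. $C^{-1}b_n\le a_n\le C\,b_n$ for some $C>0$ and all large $n$. "With probability going to one" refers to $n\to\infty$, "almost surely" refers to the product of the probability spaces of $G(Q^n,p(n))$, $n\geq 0$, and $[x]$ is the integer part of $x$. Write $p=p(n)$. (i) Suppose $\gamma^{-n}\ll p(n)$ for every $\gamma>1$. Then, almost surely, $$\lambda_{\max}(G)=\Delta(G)^{1/2}(1+o(1))=\Bigl(\frac{n\log 2}{\log(p^{-1})}\Bigr)^{1/2}(1+o(1)).$$ Moreover, for every $\alpha\in(0,1)$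 and all sufficiently large $n$ (depending on $\alpha$ and on the sequence $p$), with probability at least $$1-2^{\alpha n}\exp\bigl(-(2p\log(p^{-1}))^{-2}\bigr)$$ the adjacency matrix of $G$ has at least $2^{[\alpha n]}/(2n^2)$ eigenvalues, counted with multiplicity, that are greater than or equal to $$\sqrt{\frac{(1-\alpha)\,n\log 2\,\bigl(1-1/\log\log(p^{-1})\bigr)}{\log(p^{-1})}-2}.$$ (ii) Suppose $2^{-n}n^{-1}\ll p(n)$, that there is $\gamma\in(1,2]$ with $p(n)\le\gamma^{-n}$ for all large $n$, and that for no $k=2,3,\dots$ is $p(n)$ proportional to $2^{-n/k}n^{-1}$ along a subsequence, i.e. for every $k\ge2$ and every $C>0$, $p(n)\notin[C^{-1}2^{-n/k}n^{-1},\,C\,2^{-n/k}n^{-1}]$ for all large $n$. Then, with probability going to one, $$\lambda_{\max}(G)=\Delta(G)^{1/2}=\Bigl(\Bigl[\frac{n\log 2}{\log(p^{-1})-\log n}\Bigr]\Bigr)^{1/2}.$$ (iii) Suppose $p(n)$ is proportional to $2^{-n/k}n^{-1}$ for some $k\in\{2,3,\dots\}$. Then, with probability going to one, $$\Delta(G)^{1/2}\le\lambda_{\max}(G)<(\Delta(G)+1)^{1/2}\quad\text{and}\quad\Bigl|\Delta(G)-\Bigl[\frac{n\log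 2}{\log(p^{-1})-\log n}\Bigr]\Bigr|\le1.$$ (iv) If $p(n)\,2^n\,n\to\nu$ with $0\le\nu<\infty$, then $\lambda_{\max}(G)$ converges in distribution to the Bernoulli law that gives mass $1-e^{-\nu/2}$ to $1$ and mass $e^{-\nu/2}$ to $0$. (v) If $p(n)\ll2^{-n}n^{-1}$, then with probability going to one $G$ has no edges and $\lambda_{\max}(G)=0$. -/

import Mathlib

open MeasureTheory ProbabilityTheory Filter Topology Asymptotics
open scoped NNReal ENNReal unitInterval

/-- The `n`-cube `Q^n`: vertices are the `0`-`1` sequences of length `n`, and two of them are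
adjacent when they differ in exactly one coordinate. -/
def hypercube (n : ℕ) : SimpleGraph (Fin n → Bool) where
  Adj x y := hammingDist x y = 1
  symm := ⟨fun x y h => by rw [hammingDist_comm]; exact h⟩
  loopless := ⟨fun x h => by simp at h⟩

/-- The law of the random subgraph `G(Q^n, p)`: all `2^n` vertices are kept, each edge of `Q^n` is
kept independently with probability `p`, and no other edge is present. -/
noncomputable def randomCubeSubgraph (n : ℕ) (p : I) : Measure (SimpleGraph (Fin n → Bool)) :=
  (setBernoulli (hypercube n).edgeSet p).map SimpleGraph.fromEdgeSet

instance instIsProbabilityMeasureRandomCubeSubgraph (n : ℕ) (p : I) :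
    IsProbabilityMeasure (randomCubeSubgraph n p) :=
  Measure.isProbabilityMeasure_map SimpleGraph.measurable_fromEdgeSet.aemeasurable

/-- The product of the probability spaces of `G(Q^n, p n)`, `n = 0, 1, 2, …`. -/
noncomputable def randomCubeSubgraphs (p : ℕ → I) :
    Measure ((n : ℕ) → SimpleGraph (Fin n → Bool)) :=
  Measure.infinitePi fun n => randomCubeSubgraph n (p n)

/-- The eigenvalues of the adjacency matrix of `G`, repeated according to multiplicity. -/
noncomputable def adjEigenvalues {V : Type*} [Fintype V] (G : SimpleGraph V) : V → ℝ := by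
  classical exact (G.isHermitian_adjMatrix ℝ).eigenvalues

/-- The largest eigenvalue of the adjacency matrix of `G`. -/
noncomputable def lambdaMax {V : Type*} [Fintype V] (G : SimpleGraph V) : ℝ :=
  ⨆ v, adjEigenvalues G v

/-- The maximum degree of `G`. -/
noncomputable def maxDeg {V : Type*} [Fintype V] (G : SimpleGraph V) : ℕ := by
  classical exact G.maxDegree

/-- `E n` holds with probability tending to one for `G(Q^n, p n)`. -/
def WithHighProb (p : ℕ → I) (E : (n : ℕ) → SimpleGraph (Fin n → Bool) → Prop) : Prop :=
  Tendsto (fun n => randomCubeSubgraph n (p n) {G | E n G}) atTop (𝓝 1)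

/-- The threshold sequence `2^{-n/k} n^{-1}`. -/
noncomputable def threshold (k n : ℕ) : ℝ := (2 : ℝ) ^ (-((n : ℝ) / (k : ℝ))) * (n : ℝ)⁻¹

/-- No subsequence of `a` is proportional to the corresponding subsequence of `b`, i.e. every
interval `[C⁻¹ b n, C b n]` is eventually left by `a n`. -/
def NowhereProportional (a b : ℕ → ℝ) : Prop :=
  ∀ C : ℝ, 0 < C → ∀ᶠ n in atTop, ¬ (C⁻¹ * b n ≤ a n ∧ a n ≤ C * b n)

/-- The probability `1 - e^{-ν/2}`. -/
noncomputable def nonemptyProb (ν : ℝ≥0) : I :=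
  ⟨1 - Real.exp (-(ν : ℝ) / 2), by
    have h : Real.exp (-(ν : ℝ) / 2) ≤ 1 := Real.exp_le_one_iff.2 (by
      have := ν.2
      have h2 : (0 : ℝ) ≤ (ν : ℝ) := this
      linarith)
    constructor
    · linarith
    · linarith [Real.exp_pos (-(ν : ℝ) / 2)]⟩

/-!
The largest eigenvalue of a graph is at least `√Δ`, because a star with `Δ` leaves has this
eigenvalue (`sqrt_maxDeg_le_lambdaMax`). The content of the theorem is that a sparse random subgraph
of the cube has hardly anything else that matters for its spectrum.

*Subexponentially small `p`.* Write `d = n log 2 / log (1 / p)`. A union bound gives `Δ ≤ (1 + ε) d`.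
Even vertices have disjoint sets of edges, hence independent neighbourhoods, which gives
`Δ ≥ (1 - ε) d`. For the largest eigenvalue, let `H` be the set of vertices of degree at least
`d ^ (1 / 3)`. Outside `H` the adjacency matrix has norm `O(d ^ (1 / 3))`. The squared norm of a block
with columns in `H` is at most the number of walks `h → u → h'` that end in `H`, and in the cube such
a walk returns to `h` or ends at distance two, where every vertex is reached by at most two walks.
With overwhelming probability every vertex has only `O(d ^ (2 / 3))` vertices of `H` at distance two,
so `λ ≤ √(Δ + o(d)) + o(√d)` (`lambdaMax_le_of_sphereTwo`). This is where `p ≤ n ^ (-1 + o(1))` enters: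
`n ^ (2 / 3) p` has to be small. All exceptional probabilities are summable, and Borel–Cantelli gives
the almost sure statement.

*Many large eigenvalues.* The last `⌊α n⌋` coordinates label disjoint subcubes, and no edge of the
cube joins two subcubes with even labels. Stars in different such subcubes therefore give
eigenvalues that count separately (`card_good_le_card_adjEigenvalues`), and a union bound over the
possible sets of labels whose subcubes contain no large star shows that few labels are bad.

*Exponentially small `p`.* The number `2 ^ n (n p) ^ (k + 1)` bounds, up to a constant, the expected
number of connected subgraphs with `k + 1` edges; these are counted by `explorations`. When it is
small, all components have at most `k` edges. For an eigenvector on a bipartite graph with `k` edges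
Cauchy–Schwarz gives `λ ^ 2 ≤ k`, with equality only if the support is complete bipartite
(`sq_eigenvalue_lt_or_complete`). When `2 ^ n (n p) ^ k` is large, some vertex has degree `k`. Between
two thresholds both hold, so `λ = √Δ = √k`. At the threshold `k` the maximum degree is `k - 1` or `k`;
the only complete bipartite subgraphs of the cube are stars and cycles of length four, and the latter
are too rare to occur if `k ≤ 4`, so `λ ^ 2 < Δ + 1` (`sq_lambdaMax_lt_or_le_maxDeg`).

*Few edges.* If `2 ^ n n p` stays bounded, adjacent edges are unlikely, and then `λ` is the indicator
of the existence of an edge. The cube has `n 2 ^ (n - 1)` edges, so the probability of the empty graph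
is `(1 - p) ^ (n 2 ^ (n - 1))`.
-/

/-! ### Independence in a Bernoulli random set -/

section RandomSet

variable {E : Type*}

/-- A family of sets depends only on the elements of `D` when membership of a set in the family is
decided by its trace on `D`. -/
def DependsOnTrace (A : Set (Set E)) (D : Finset E) : Prop :=
  ∀ S T : Set E, (∀ e ∈ D, e ∈ S ↔ e ∈ T) → S ∈ A → T ∈ A

lemma DependsOnTrace.compl {A : Set (Set E)} {D : Finset E} (h : DependsOnTrace A D) :
    DependsOnTrace Aᶜ D :=
  fun S T hST hS hT => hS (h T S (fun e he => (hST e he).symm) hT)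

lemma DependsOnTrace.biInter {ι : Type*} [DecidableEq E] {A : ι → Set (Set E)} {D : ι → Finset E}
    {s : Finset ι} (h : ∀ i ∈ s, DependsOnTrace (A i) (D i)) :
    DependsOnTrace (⋂ i ∈ s, A i) (s.biUnion D) := by
  intro S T hST hS
  simp only [Set.mem_iInter] at hS ⊢
  exact fun i hi => h i hi S T (fun e he => hST e (Finset.mem_biUnion.2 ⟨i, hi, he⟩)) (hS i hi)

instance [Finite E] : DiscreteMeasurableSpace (Set E) := by
  have : MeasurableSingletonClass (Set E) := by infer_instance
  infer_instance

lemma iIndepFun_mem_setBernoulli [Finite E] (u : Set E) (p : I) :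
    iIndepFun (fun (e : E) (S : Set E) => e ∈ S) (setBernoulli u p) := by
  -- the factors of the product measure from which `setBernoulli` is built
  set ν : E → Measure Prop := fun e =>
    unitInterval.toNNReal p • Measure.dirac (e ∈ u) + unitInterval.toNNReal (σ p) • Measure.dirac False
  have hν : ∀ e, IsProbabilityMeasure (ν e) := by
    intro e; infer_instance
  have hm : ∀ e : E, Measurable (fun S : Set E => e ∈ S) := fun e => by fun_prop
  have key : (setBernoulli u p).map (fun S (e : E) => e ∈ S) = Measure.infinitePi ν := by
    rw [setBernoulli_eq_map, Measure.map_map (by fun_prop) (by fun_prop)]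
    exact Measure.map_id
  rw [iIndepFun_iff_map_fun_eq_infinitePi_map hm, key]
  congr 1
  ext1 e
  have : (fun S : Set E => e ∈ S) = (fun f : E → Prop => f e) ∘ (fun S (e : E) => e ∈ S) := rfl
  rw [this, ← Measure.map_map (by fun_prop) (by fun_prop), key, Measure.infinitePi_map_eval]

lemma measureReal_inter_of_dependsOnTrace [Finite E] [DecidableEq E] (u : Set E) (p : I)
    {A B : Set (Set E)} {D D' : Finset E}
    (hA : DependsOnTrace A D) (hB : DependsOnTrace B D') (hD : Disjoint D D') :
    (setBernoulli u p).real (A ∩ B) = (setBernoulli u p).real A * (setBernoulli u p).real B := by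
  have hm : ∀ e : E, Measurable (fun S : Set E => e ∈ S) := fun e => by fun_prop
  have h := (iIndepFun_mem_setBernoulli u p).indepFun_finset D D' hD hm
  -- a family that depends on its trace on `D` is a preimage under the restriction to `D`
  have lift : ∀ {A : Set (Set E)} {D : Finset E}, DependsOnTrace A D →
      A = (fun (S : Set E) (e : D) => (e : E) ∈ S) ⁻¹' {f | {e | ∃ h : e ∈ D, f ⟨e, h⟩} ∈ A} := by
    intro A D hA
    ext S
    constructor
    · exact hA S _ fun e he => by simp [he]
    · exact hA _ S fun e he => by simp [he]
  have := h.measure_inter_preimage_eq_mul {f | {e | ∃ h : e ∈ D, f ⟨e, h⟩} ∈ A}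
    {f | {e | ∃ h : e ∈ D', f ⟨e, h⟩} ∈ B} .of_discrete .of_discrete
  rw [← lift hA, ← lift hB] at this
  simp only [measureReal_def, this, ENNReal.toReal_mul]

/-- Events about a Bernoulli random set that depend on disjoint sets of elements are independent. -/
lemma measureReal_biInter_of_dependsOnTrace [Finite E] {ι : Type*} (u : Set E) (p : I)
    {A : ι → Set (Set E)} {D : ι → Finset E} {s : Finset ι}
    (hA : ∀ i ∈ s, DependsOnTrace (A i) (D i))
    (hD : (s : Set ι).PairwiseDisjoint D) :
    (setBernoulli u p).real (⋂ i ∈ s, A i) = ∏ i ∈ s, (setBernoulli u p).real (A i) := by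
  classical
  induction s using Finset.induction_on with
  | empty => simp
  | insert a s ha ih =>
    rw [Finset.set_biInter_insert, Finset.prod_insert ha,
      measureReal_inter_of_dependsOnTrace u p (hA a (by simp))
        (DependsOnTrace.biInter fun i hi => hA i (by simp [hi])), ih]
    · exact fun i hi => hA i (by simp [hi])
    · exact hD.subset (by simp)
    · rw [Finset.disjoint_biUnion_right]
      intro i hi
      exact hD (by simp) (by simp [hi]) (fun h => ha (h ▸ hi))

lemma setBernoulli_real_mem [Finite E] {u : Set E} (p : I) {e : E} (he : e ∈ u) :
    (setBernoulli u p).real {S | e ∈ S} = p := by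
  rw [setBernoulli_eq_map, measureReal_def, Measure.map_apply (by fun_prop) .of_discrete]
  have : (fun p : E → Prop => {i | p i}) ⁻¹' {S | e ∈ S} = (fun f => f e) ⁻¹' {True} := by
    ext f; simp
  rw [this, ← Measure.map_apply (by fun_prop) .of_discrete, Measure.infinitePi_map_eval]
  simp [he]

lemma setBernoulli_real_subset [Finite E] {u : Set E} (p : I) {F : Finset E} (hF : (F : Set E) ⊆ u) :
    (setBernoulli u p).real {S | (F : Set E) ⊆ S} = (p : ℝ) ^ F.card := by
  have : {S | (F : Set E) ⊆ S} = ⋂ e ∈ F, {S | e ∈ S} := by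
    ext S; simp [Set.subset_def]
  rw [this, measureReal_biInter_of_dependsOnTrace u p (D := fun e => {e}),
    Finset.prod_congr rfl fun e he => setBernoulli_real_mem p (hF he), Finset.prod_const]
  · intro e _ S T (h : ∀ e' ∈ ({e} : Finset E), e' ∈ S ↔ e' ∈ T) hS
    exact (h e (by simp)).1 hS
  · intro e _ f _ hef
    simpa using hef

lemma setBernoulli_real_disjoint [Finite E] {u : Set E} (p : I) {F : Finset E}
    (hF : (F : Set E) ⊆ u) :
    (setBernoulli u p).real {S | ∀ e ∈ F, e ∉ S} = (1 - (p : ℝ)) ^ F.card := by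
  have : {S : Set E | ∀ e ∈ F, e ∉ S} = ⋂ e ∈ F, {S : Set E | e ∈ S}ᶜ := by
    ext S; simp
  rw [this, measureReal_biInter_of_dependsOnTrace u p (D := fun e => {e}),
    Finset.prod_congr rfl fun e he => ?_, Finset.prod_const]
  · rw [probReal_compl_eq_one_sub .of_discrete, setBernoulli_real_mem p (hF he)]
  · intro e _
    refine DependsOnTrace.compl ?_
    intro S T h hS
    exact (h e (by simp)).1 hS
  · intro e _ f _ hef
    simpa using hef

/-- If the blocks `B i j` are pairwise disjoint and have size `b`, the probability that no row `i`
has all its blocks hit is explicit. -/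
lemma setBernoulli_real_forall_exists_disjoint [Finite E] {ι κ : Type*} {u : Set E} (p : I)
    {B : ι → κ → Finset E} {s : Finset ι} {t : Finset κ} {b : ℕ}
    (hB : ∀ i ∈ s, ∀ j ∈ t, (B i j : Set E) ⊆ u) (hcard : ∀ i ∈ s, ∀ j ∈ t, (B i j).card = b)
    (hdisj : ∀ i ∈ s, ∀ j ∈ t, ∀ i' ∈ s, ∀ j' ∈ t, ∀ e, e ∈ B i j → e ∈ B i' j' → i = i' ∧ j = j') :
    (setBernoulli u p).real {S | ∀ i ∈ s, ∃ j ∈ t, ∀ e ∈ B i j, e ∉ S} =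
      (1 - (1 - (1 - (p : ℝ)) ^ b) ^ t.card) ^ s.card := by
  classical
  set A : ι → κ → Set (Set E) := fun i j => {S | ∀ e ∈ B i j, e ∉ S} with hA
  have hdep : ∀ i j, DependsOnTrace (A i j) (B i j) := by
    intro i j S T h hS e he heT
    exact hS e he ((h e he).2 heT)
  have hrow : ∀ i ∈ s, (setBernoulli u p).real (⋂ j ∈ t, (A i j)ᶜ) =
      (1 - (1 - (p : ℝ)) ^ b) ^ t.card := by
    intro i hi
    rw [measureReal_biInter_of_dependsOnTrace u p (fun j _ => (hdep i j).compl),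
      Finset.prod_congr rfl fun j hj => ?_, Finset.prod_const]
    · rw [probReal_compl_eq_one_sub .of_discrete, hA, setBernoulli_real_disjoint p (hB i hi j hj),
        hcard i hi j hj]
    · intro j hj j' hj' hne
      exact Finset.disjoint_left.2 fun e h h' => hne (hdisj i hi j hj i hi j' hj' e h h').2
  have : {S | ∀ i ∈ s, ∃ j ∈ t, ∀ e ∈ B i j, e ∉ S} = ⋂ i ∈ s, (⋂ j ∈ t, (A i j)ᶜ)ᶜ := by
    ext S; simp [hA]
  rw [this, measureReal_biInter_of_dependsOnTrace u p (D := fun i => t.biUnion (B i)),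
    Finset.prod_congr rfl fun i hi => ?_, Finset.prod_const]
  · rw [probReal_compl_eq_one_sub .of_discrete, hrow i hi]
  · exact fun i _ => (DependsOnTrace.biInter fun j _ => (hdep i j).compl).compl
  · intro i hi i' hi' hne
    refine Finset.disjoint_left.2 fun e h h' => ?_
    obtain ⟨j, hj, he⟩ := Finset.mem_biUnion.1 h
    obtain ⟨j', hj', he'⟩ := Finset.mem_biUnion.1 h'
    exact hne (hdisj i hi j hj i' hi' j' hj' e he he').1

end RandomSet

/-! ### The random subgraph of the cube -/

instance {V : Type*} [Finite V] : DiscreteMeasurableSpace (SimpleGraph V) where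
  forall_measurableSet s := by
    have h := (SimpleGraph.measurableEmbedding_edgeSet (V := V))
    rw [← Set.preimage_image_eq s h.injective]
    exact h.measurable .of_discrete

lemma randomCubeSubgraph_real (n : ℕ) (p : I) (A : Set (SimpleGraph (Fin n → Bool))) :
    (randomCubeSubgraph n p).real A =
      (setBernoulli (hypercube n).edgeSet p).real {S | SimpleGraph.fromEdgeSet S ∈ A} := by
  rw [randomCubeSubgraph, measureReal_def,
    Measure.map_apply SimpleGraph.measurable_fromEdgeSet .of_discrete]
  rfl

/-- On edges of a simple graph `fromEdgeSet` loses nothing: it only discards the diagonal. -/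
lemma mem_edgeSet_fromEdgeSet_iff {V : Type*} {H : SimpleGraph V} {e : Sym2 V} (he : e ∈ H.edgeSet)
    (S : Set (Sym2 V)) : e ∈ (SimpleGraph.fromEdgeSet S).edgeSet ↔ e ∈ S := by
  have := H.not_isDiag_of_mem_edgeSet he
  simp [SimpleGraph.edgeSet_fromEdgeSet, this]

lemma randomCubeSubgraph_real_subset {n : ℕ} (p : I) {F : Finset (Sym2 (Fin n → Bool))}
    (hF : (F : Set _) ⊆ (hypercube n).edgeSet) :
    (randomCubeSubgraph n p).real {G | (F : Set _) ⊆ G.edgeSet} = (p : ℝ) ^ F.card := by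
  rw [randomCubeSubgraph_real, ← setBernoulli_real_subset p hF]
  congr 1
  ext S
  exact forall₂_congr fun e he => mem_edgeSet_fromEdgeSet_iff (hF he) S

lemma randomCubeSubgraph_real_disjoint {n : ℕ} (p : I) {F : Finset (Sym2 (Fin n → Bool))}
    (hF : (F : Set _) ⊆ (hypercube n).edgeSet) :
    (randomCubeSubgraph n p).real {G | ∀ e ∈ F, e ∉ G.edgeSet} = (1 - (p : ℝ)) ^ F.card := by
  rw [randomCubeSubgraph_real, ← setBernoulli_real_disjoint p hF]
  congr 1
  ext S
  exact forall₂_congr fun e he => not_congr (mem_edgeSet_fromEdgeSet_iff (hF he) S)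

lemma randomCubeSubgraph_real_forall_exists_disjoint {n : ℕ} {ι κ : Type*} (p : I)
    {B : ι → κ → Finset (Sym2 (Fin n → Bool))} {s : Finset ι} {t : Finset κ} {b : ℕ}
    (hB : ∀ i ∈ s, ∀ j ∈ t, (B i j : Set _) ⊆ (hypercube n).edgeSet)
    (hcard : ∀ i ∈ s, ∀ j ∈ t, (B i j).card = b)
    (hdisj : ∀ i ∈ s, ∀ j ∈ t, ∀ i' ∈ s, ∀ j' ∈ t, ∀ e, e ∈ B i j → e ∈ B i' j' → i = i' ∧ j = j') :
    (randomCubeSubgraph n p).real {G | ∀ i ∈ s, ∃ j ∈ t, ∀ e ∈ B i j, e ∉ G.edgeSet} =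
      (1 - (1 - (1 - (p : ℝ)) ^ b) ^ t.card) ^ s.card := by
  rw [randomCubeSubgraph_real, ← setBernoulli_real_forall_exists_disjoint p hB hcard hdisj]
  congr 1
  ext S
  refine forall₂_congr fun i hi => exists_congr fun j => and_congr_right fun hj => ?_
  exact forall₂_congr fun e he => not_congr (mem_edgeSet_fromEdgeSet_iff (hB i hi j hj he) S)

/-- The random subgraph is almost surely a subgraph of the cube. -/
lemma randomCubeSubgraph_ae_le (n : ℕ) (p : I) :
    ∀ᵐ G ∂(randomCubeSubgraph n p), G ≤ hypercube n := by
  rw [randomCubeSubgraph, ae_map_iff SimpleGraph.measurable_fromEdgeSet.aemeasurable .of_discrete]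
  filter_upwards [setBernoulli_ae_subset] with S hS
  rw [← SimpleGraph.edgeSet_subset_edgeSet, SimpleGraph.edgeSet_fromEdgeSet]
  exact Set.sdiff_subset.trans hS

/-- The first moment bound: the probability that some set of edges of a finite family is present. -/
lemma randomCubeSubgraph_real_exists_subset_le {n : ℕ} (p : I)
    {T : Finset (Finset (Sym2 (Fin n → Bool)))} {m : ℕ}
    (hT : ∀ F ∈ T, (F : Set _) ⊆ (hypercube n).edgeSet) (hcard : ∀ F ∈ T, F.card = m) :
    (randomCubeSubgraph n p).real {G | ∃ F ∈ T, (F : Set _) ⊆ G.edgeSet} ≤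
      T.card * (p : ℝ) ^ m := by
  have : {G : SimpleGraph (Fin n → Bool) | ∃ F ∈ T, (F : Set _) ⊆ G.edgeSet} =
      ⋃ F ∈ T, {G | (F : Set _) ⊆ G.edgeSet} := by
    ext G; simp
  rw [this]
  refine (measureReal_biUnion_finset_le _ _).trans ?_
  rw [Finset.sum_congr rfl fun F hF =>
    (randomCubeSubgraph_real_subset p (hT F hF)).trans (by rw [hcard F hF])]
  simp

/-! ### Spectral bounds for adjacency matrices -/

open Classical in
/-- The Perron vector of the star with centre `v` and leaf set `N`: it is `√|N|` at the centre and
`1` on the leaves. -/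
noncomputable def starVector {V : Type*} (v : V) (N : Finset V) (u : V) : ℝ :=
  if u = v then √N.card else if u ∈ N then 1 else 0

lemma starVector_ne_zero {V : Type*} {v : V} {N : Finset V} {u : V} (h : starVector v N u ≠ 0) :
    u = v ∨ u ∈ N := by
  by_contra! h'
  exact h (by simp [starVector, h'.1, h'.2])

section Spectral

variable {V : Type*} [Fintype V]

/-- The finset of neighbours of `v` in `G`, with classical decidability. -/
noncomputable def nb (G : SimpleGraph V) (v : V) : Finset V := by
  classical exact G.neighborFinset v

@[simp] lemma mem_nb {G : SimpleGraph V} {v w : V} : w ∈ nb G v ↔ G.Adj v w := by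
  classical simp [nb]

lemma card_nb_le_maxDeg (G : SimpleGraph V) (v : V) : (nb G v).card ≤ maxDeg G := by
  classical
  rw [nb, maxDeg, SimpleGraph.card_neighborFinset_eq_degree]
  convert! G.degree_le_maxDegree v

lemma exists_card_nb_eq_maxDeg [Nonempty V] (G : SimpleGraph V) :
    ∃ v, (nb G v).card = maxDeg G := by
  classical
  obtain ⟨v, hv⟩ := G.exists_maximal_degree_vertex
  refine ⟨v, ?_⟩
  rw [nb, maxDeg, SimpleGraph.card_neighborFinset_eq_degree]
  convert! hv.symm

lemma sum_nb_comm (G : SimpleGraph V) (S T : Finset V) (f : V → V → ℝ) [DecidableEq V] :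
    ∑ u ∈ S, ∑ w ∈ nb G u ∩ T, f u w = ∑ w ∈ T, ∑ u ∈ nb G w ∩ S, f u w := by
  refine Finset.sum_comm' fun u w => ?_
  simp [G.adj_comm w u]
  tauto

/-- The spectral theorem for the adjacency matrix, in coordinates: an orthonormal system `e` of
eigenvectors, with Parseval's identity. -/
lemma exists_adj_eigenvectors (G : SimpleGraph V) :
    ∃ e : V → V → ℝ, (∀ v u, ∑ w ∈ nb G u, e v w = adjEigenvalues G v * e v u) ∧
      (∀ v, ∑ u, e v u ^ 2 = 1) ∧
      ∀ x y : V → ℝ, ∑ v, (∑ u, e v u * x u) * (∑ u, e v u * y u) = ∑ u, x u * y u := by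
  classical
  set hA := G.isHermitian_adjMatrix ℝ
  refine ⟨fun v u => hA.eigenvectorBasis v u, fun v u => ?_, fun v => ?_, fun x y => ?_⟩
  · have := congrFun (hA.mulVec_eigenvectorBasis v) u
    rw [SimpleGraph.adjMatrix_mulVec_apply] at this
    simpa [nb, adjEigenvalues] using this
  · have := hA.eigenvectorBasis.orthonormal.1 v
    rw [EuclideanSpace.norm_eq, Real.sqrt_eq_one] at this
    simpa using this
  · have := hA.eigenvectorBasis.sum_inner_mul_inner (WithLp.toLp 2 x) (WithLp.toLp 2 y)
    simp only [PiLp.inner_apply, RCLike.inner_apply, conj_trivial] at this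
    rw [show ∑ u, x u * y u = ∑ u, y u * x u from Finset.sum_congr rfl fun _ _ => mul_comm _ _,
      ← this]
    refine Finset.sum_congr rfl fun v _ => ?_
    congr 1
    exact Finset.sum_congr rfl fun u _ => mul_comm _ _

/-- If there are nonzero vectors with disjoint, pairwise non-adjacent supports, each of Rayleigh
quotient at least `c`, there are at least as many eigenvalues that are at least `c`. -/
lemma card_le_card_adjEigenvalues_ge {ι : Type*} (G : SimpleGraph V) (s : Finset ι)
    (x : ι → V → ℝ) (c : ℝ)
    (hx : ∀ i ∈ s, ∃ u, x i u ≠ 0)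
    (hdisj : ∀ i ∈ s, ∀ j ∈ s, i ≠ j → ∀ u, x i u ≠ 0 → x j u = 0)
    (hadj : ∀ i ∈ s, ∀ j ∈ s, i ≠ j → ∀ u w, x i u ≠ 0 → x j w ≠ 0 → ¬ G.Adj u w)
    (hc : ∀ i ∈ s, c * ∑ u, x i u ^ 2 ≤ ∑ u, ∑ w ∈ nb G u, x i u * x i w) :
    s.card ≤ Nat.card {v // c ≤ adjEigenvalues G v} := by
  classical
  obtain ⟨e, he, -, hP⟩ := exists_adj_eigenvectors G
  by_contra! hlt
  -- otherwise some nonzero combination `y a` is orthogonal to all eigenvectors of eigenvalue `≥ c`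
  rw [Nat.card_eq_fintype_card] at hlt
  let y : (s → ℝ) → V → ℝ := fun a u => ∑ i, a i * x i u
  let f : (s → ℝ) →ₗ[ℝ] ({v // c ≤ adjEigenvalues G v} → ℝ) :=
    { toFun := fun a v => ∑ u, e v u * y a u
      map_add' := fun a b => by
        ext v
        simp only [y, Pi.add_apply, add_mul, Finset.sum_add_distrib, mul_add]
      map_smul' := fun r a => by
        ext v
        simp only [y, Pi.smul_apply, smul_eq_mul, RingHom.id_apply, Finset.mul_sum]
        refine Finset.sum_congr rfl fun u _ => Finset.sum_congr rfl fun i _ => by ring }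
  have hker : LinearMap.ker f ≠ ⊥ := LinearMap.ker_ne_bot_of_finrank_lt (by simpa using hlt)
  obtain ⟨a, ha, ha0⟩ := (Submodule.ne_bot_iff _).1 hker
  have hfa : ∀ v, c ≤ adjEigenvalues G v → ∑ u, e v u * y a u = 0 := fun v hv =>
    congrFun (LinearMap.mem_ker.1 ha) ⟨v, hv⟩
  -- the form and the norm of `y a` split over the supports
  have hsq : ∑ u, y a u ^ 2 = ∑ i, a i ^ 2 * ∑ u, x i u ^ 2 := by
    simp_rw [Finset.mul_sum]
    rw [Finset.sum_comm]
    refine Finset.sum_congr rfl fun u _ => ?_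
    simp only [y, pow_two, Finset.sum_mul_sum]
    refine Finset.sum_congr rfl fun i _ => ?_
    rw [Finset.sum_eq_single i]
    · ring
    · intro j _ hji
      have := hdisj i i.2 j j.2 (fun h => hji (Subtype.ext h.symm)) u
      by_cases hz : x i u = 0
      · simp [hz]
      · simp [this hz]
    · simp
  have hform : ∑ u, ∑ w ∈ nb G u, y a u * y a w =
      ∑ i, a i ^ 2 * ∑ u, ∑ w ∈ nb G u, x i u * x i w := by
    simp_rw [Finset.mul_sum]
    rw [Finset.sum_comm]
    refine Finset.sum_congr rfl fun u _ => ?_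
    rw [Finset.sum_comm]
    refine Finset.sum_congr rfl fun w hw => ?_
    simp only [y, Finset.sum_mul_sum]
    refine Finset.sum_congr rfl fun i _ => ?_
    rw [Finset.sum_eq_single i]
    · ring
    · intro j _ hji
      have := hadj i i.2 j j.2 (fun h => hji (Subtype.ext h.symm)) u w
      by_cases hz : x i u = 0
      · simp [hz]
      · by_cases hz' : x j w = 0
        · simp [hz']
        · exact absurd (mem_nb.1 hw) (this hz hz')
    · simp
  have hpos : 0 < ∑ u, y a u ^ 2 := by
    rw [hsq]
    obtain ⟨i, hi⟩ := Function.ne_iff.1 ha0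
    obtain ⟨u, hu⟩ := hx i i.2
    refine Finset.sum_pos' (fun j _ => by positivity) ⟨i, Finset.mem_univ _, ?_⟩
    have h1 : 0 < x i u ^ 2 := by positivity
    have h2 : x i u ^ 2 ≤ ∑ u, x i u ^ 2 :=
      Finset.single_le_sum (f := fun u => x i u ^ 2) (fun _ _ => sq_nonneg _) (Finset.mem_univ u)
    have h3 : 0 < a i ^ 2 := by
      have : a i ≠ 0 := hi
      positivity
    exact mul_pos h3 (h1.trans_le h2)
  have hge : c * ∑ u, y a u ^ 2 ≤ ∑ u, ∑ w ∈ nb G u, y a u * y a w := by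
    rw [hsq, hform, Finset.mul_sum]
    refine Finset.sum_le_sum fun i _ => ?_
    calc c * (a i ^ 2 * ∑ u, x i u ^ 2) = a i ^ 2 * (c * ∑ u, x i u ^ 2) := by ring
      _ ≤ _ := mul_le_mul_of_nonneg_left (hc i i.2) (sq_nonneg _)
  -- expand both in the eigenbasis
  have h1 : ∑ u, y a u ^ 2 = ∑ v, (∑ u, e v u * y a u) ^ 2 := by
    simp_rw [pow_two, hP]
  have h2 : ∑ u, ∑ w ∈ nb G u, y a u * y a w =
      ∑ v, adjEigenvalues G v * (∑ u, e v u * y a u) ^ 2 := by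
    have : ∀ v, ∑ u, e v u * ∑ w ∈ nb G u, y a w =
        adjEigenvalues G v * ∑ u, e v u * y a u := by
      intro v
      have h := sum_nb_comm G Finset.univ Finset.univ (fun u w => e v u * y a w)
      simp only [Finset.inter_univ] at h
      simp_rw [Finset.mul_sum]
      rw [h]
      refine Finset.sum_congr rfl fun u _ => ?_
      rw [← Finset.sum_mul, he]
      ring
    simp_rw [← Finset.mul_sum]
    rw [← hP]
    refine Finset.sum_congr rfl fun v _ => ?_
    rw [this]
    ring
  rw [h1] at hge hpos
  rw [h2, Finset.mul_sum] at hge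
  obtain ⟨v₀, -, hv₀⟩ : ∃ v ∈ Finset.univ, 0 < (∑ u, e v u * y a u) ^ 2 := by
    by_contra! h
    exact hpos.not_ge (Finset.sum_nonpos h)
  have : ∑ v, adjEigenvalues G v * (∑ u, e v u * y a u) ^ 2 <
      ∑ v, c * (∑ u, e v u * y a u) ^ 2 := by
    refine Finset.sum_lt_sum (fun v _ => ?_) ⟨v₀, Finset.mem_univ _, ?_⟩
    · rcases le_or_gt c (adjEigenvalues G v) with h | h
      · simp [hfa v h]
      · exact mul_le_mul_of_nonneg_right h.le (sq_nonneg _)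
    · rcases le_or_gt c (adjEigenvalues G v₀) with h | h
      · simp [hfa v₀ h] at hv₀
      · exact mul_lt_mul_of_pos_right h hv₀
  exact absurd hge this.not_ge

lemma exists_adjEigenvalues_eq_lambdaMax [Nonempty V] (G : SimpleGraph V) :
    ∃ v, adjEigenvalues G v = lambdaMax G :=
  exists_eq_ciSup_of_finite

lemma adjEigenvalues_le_lambdaMax (G : SimpleGraph V) (v : V) :
    adjEigenvalues G v ≤ lambdaMax G :=
  le_ciSup (Set.finite_range _).bddAbove v

lemma exists_lambdaMax_eigenvector [Nonempty V] (G : SimpleGraph V) :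
    ∃ x : V → ℝ, (∀ u, ∑ w ∈ nb G u, x w = lambdaMax G * x u) ∧ ∑ u, x u ^ 2 = 1 := by
  obtain ⟨e, he, h1, -⟩ := exists_adj_eigenvectors G
  obtain ⟨v, hv⟩ := exists_adjEigenvalues_eq_lambdaMax G
  exact ⟨e v, fun u => hv ▸ he v u, h1 v⟩

/-- The Rayleigh quotient of a star inside `G`. Further edges between its vertices only increase the
form, since the Perron vector is nonnegative. -/
lemma sqrt_card_mul_le_form_starVector (G : SimpleGraph V) (v : V) {N : Finset V}
    (hN : N ⊆ nb G v) :
    √N.card * ∑ u, starVector v N u ^ 2 ≤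
      ∑ u, ∑ w ∈ nb G u, starVector v N u * starVector v N w := by
  classical
  have hv : v ∉ N := fun h => G.loopless.irrefl v (mem_nb.1 (hN h))
  have h0 : ∀ u, 0 ≤ starVector v N u := by
    intro u; unfold starVector; split_ifs <;> positivity
  have hvv : starVector v N v = √N.card := by simp [starVector]
  have hNN : ∀ u ∈ N, starVector v N u = 1 := by
    intro u hu
    have : u ≠ v := fun h => hv (h ▸ hu)
    simp [starVector, this, hu]
  have hsum : ∑ u, starVector v N u ^ 2 = 2 * N.card := by
    rw [← Finset.sum_subset (Finset.subset_univ (insert v N)), Finset.sum_insert hv, hvv,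
      Real.sq_sqrt (by positivity), Finset.sum_congr rfl fun u hu => by rw [hNN u hu]]
    · simp; ring
    · intro u _ hu
      by_contra h
      rcases starVector_ne_zero (N := N) (v := v) (u := u) (by aesop) with h' | h' <;> simp_all
  have hnn : ∀ u w, 0 ≤ starVector v N u * starVector v N w := fun u w => mul_nonneg (h0 u) (h0 w)
  calc √N.card * ∑ u, starVector v N u ^ 2
      = ∑ w ∈ N, starVector v N v * starVector v N w +
          ∑ u ∈ N, starVector v N u * starVector v N v := by
        rw [hsum, hvv, ← Finset.mul_sum, ← Finset.sum_mul, Finset.sum_congr rfl hNN]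
        simp; ring
    _ ≤ ∑ w ∈ nb G v, starVector v N v * starVector v N w +
          ∑ u ∈ N, ∑ w ∈ nb G u, starVector v N u * starVector v N w := by
        refine add_le_add (Finset.sum_le_sum_of_subset_of_nonneg hN fun _ _ _ => hnn _ _)
          (Finset.sum_le_sum fun u hu => ?_)
        exact Finset.single_le_sum (f := fun w => starVector v N u * starVector v N w)
          (fun _ _ => hnn _ _) (mem_nb.2 (mem_nb.1 (hN hu)).symm)
    _ = ∑ u ∈ insert v N, ∑ w ∈ nb G u, starVector v N u * starVector v N w := by
        rw [Finset.sum_insert hv]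
    _ ≤ _ := Finset.sum_le_sum_of_subset_of_nonneg (Finset.subset_univ _)
        fun _ _ _ => Finset.sum_nonneg fun _ _ => hnn _ _

lemma sqrt_card_nb_le_lambdaMax (G : SimpleGraph V) (v : V) : √(nb G v).card ≤ lambdaMax G := by
  classical
  rcases (nb G v).eq_empty_or_nonempty with h | ⟨w, hw⟩
  · -- the star vector of an isolated vertex vanishes; a coordinate vector serves instead
    rw [h]
    have : 1 ≤ Nat.card {v // 0 ≤ adjEigenvalues G v} := by
      refine card_le_card_adjEigenvalues_ge G {()} (fun _ => Pi.single v 1) 0 ?_ ?_ ?_ ?_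
      · exact fun _ _ => ⟨v, by simp⟩
      · simp
      · simp
      · intro _ _
        rw [zero_mul]
        refine Finset.sum_nonneg fun u _ => Finset.sum_nonneg fun w _ => ?_
        simp only [Pi.single_apply]
        split_ifs <;> norm_num
    obtain ⟨⟨u, hu⟩⟩ := (Nat.card_pos_iff.1 this).1
    simpa using hu.trans (adjEigenvalues_le_lambdaMax G u)
  · have : 1 ≤ Nat.card {u // √(nb G v).card ≤ adjEigenvalues G u} := by
      refine card_le_card_adjEigenvalues_ge G {()} (fun _ => starVector v (nb G v)) _ ?_ ?_ ?_ ?_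
      · refine fun _ _ => ⟨w, ?_⟩
        have : w ≠ v := fun h => (mem_nb.1 hw).ne h.symm
        simp [starVector, this, mem_nb.1 hw]
      · simp
      · simp
      · exact fun _ _ => sqrt_card_mul_le_form_starVector G v subset_rfl
    obtain ⟨⟨u, hu⟩⟩ := (Nat.card_pos_iff.1 this).1
    exact hu.trans (adjEigenvalues_le_lambdaMax G u)

lemma sqrt_maxDeg_le_lambdaMax [Nonempty V] (G : SimpleGraph V) :
    √(maxDeg G : ℝ) ≤ lambdaMax G := by
  obtain ⟨v, hv⟩ := exists_card_nb_eq_maxDeg G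
  exact hv ▸ sqrt_card_nb_le_lambdaMax G v

/-- The block of the adjacency matrix with rows `U` and columns `H` has squared norm at most the
maximal number of walks `h → u → h'` with `u ∈ U` and `h' ∈ H`. -/
lemma sum_sq_block_le [DecidableEq V] (G : SimpleGraph V) (U H : Finset V) (x : V → ℝ) {R : ℝ}
    (hR : ∀ h ∈ H, ∑ u ∈ nb G h ∩ U, ((nb G u ∩ H).card : ℝ) ≤ R) :
    ∑ u ∈ U, (∑ h ∈ nb G u ∩ H, x h) ^ 2 ≤ R * ∑ h ∈ H, x h ^ 2 := by
  calc ∑ u ∈ U, (∑ h ∈ nb G u ∩ H, x h) ^ 2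
      ≤ ∑ u ∈ U, ∑ h ∈ nb G u ∩ H, ((nb G u ∩ H).card : ℝ) * x h ^ 2 := by
        refine Finset.sum_le_sum fun u _ => ?_
        rw [← Finset.mul_sum]
        exact sq_sum_le_card_mul_sum_sq
    _ = ∑ h ∈ H, (∑ u ∈ nb G h ∩ U, ((nb G u ∩ H).card : ℝ)) * x h ^ 2 := by
        rw [sum_nb_comm]
        simp_rw [Finset.sum_mul]
    _ ≤ ∑ h ∈ H, R * x h ^ 2 :=
        Finset.sum_le_sum fun h hh => mul_le_mul_of_nonneg_right (hR h hh) (sq_nonneg _)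
    _ = _ := by rw [Finset.mul_sum]

lemma sum_block_le [DecidableEq V] (G : SimpleGraph V) (U H : Finset V) (x : V → ℝ) {R : ℝ}
    (hR : ∀ h ∈ H, ∑ u ∈ nb G h ∩ U, ((nb G u ∩ H).card : ℝ) ≤ R) :
    ∑ u ∈ U, x u * ∑ h ∈ nb G u ∩ H, x h ≤
      √(∑ u ∈ U, x u ^ 2) * (√R * √(∑ h ∈ H, x h ^ 2)) := by
  refine (Real.sum_mul_le_sqrt_mul_sqrt _ _ _).trans ?_
  refine mul_le_mul_of_nonneg_left ?_ (Real.sqrt_nonneg _)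
  rw [← Real.sqrt_mul' _ (Finset.sum_nonneg fun _ _ => sq_nonneg _)]
  exact Real.sqrt_le_sqrt (sum_sq_block_le G U H x hR)

/-- Splitting the vertices into `H` and its complement, where degrees are at most `D`, bounds the
largest eigenvalue by the norms of the blocks. -/
lemma lambdaMax_le_of_split [Nonempty V] [DecidableEq V] (G : SimpleGraph V) (H : Finset V)
    {D : ℕ} {R₁ R₂ : ℝ} (hD : ∀ v ∉ H, (nb G v).card ≤ D)
    (hR₁ : ∀ h ∈ H, ∑ u ∈ nb G h, ((nb G u ∩ H).card : ℝ) ≤ R₁)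
    (hR₂ : ∀ h ∈ H, ∑ u ∈ nb G h ∩ H, ((nb G u ∩ H).card : ℝ) ≤ R₂) :
    lambdaMax G ≤ √R₁ + √R₂ + D := by
  obtain ⟨x, hx, h1⟩ := exists_lambdaMax_eigenvector G
  -- the form splits into the blocks `L × L`, twice `L × H`, and `H × H`
  set L := Hᶜ with hL
  set a := √(∑ u ∈ L, x u ^ 2) with ha
  set b := √(∑ u ∈ H, x u ^ 2) with hb
  have hab : a ^ 2 + b ^ 2 = 1 := by
    rw [ha, hb, Real.sq_sqrt (Finset.sum_nonneg fun _ _ => sq_nonneg _),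
      Real.sq_sqrt (Finset.sum_nonneg fun _ _ => sq_nonneg _), ← h1, hL,
      Finset.sum_compl_add_sum]
  have ha0 : 0 ≤ a := Real.sqrt_nonneg _
  have hb0 : 0 ≤ b := Real.sqrt_nonneg _
  have hLL := sum_block_le G L L x (R := (D : ℝ) ^ 2) fun h hh => by
    calc ∑ u ∈ nb G h ∩ L, ((nb G u ∩ L).card : ℝ) ≤ ∑ u ∈ nb G h ∩ L, (D : ℝ) := by
          refine Finset.sum_le_sum fun u hu => ?_
          have h2 : u ∉ H := by simpa [hL] using (Finset.mem_inter.1 hu).2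
          exact_mod_cast (Finset.card_le_card Finset.inter_subset_left).trans (hD u h2)
      _ ≤ (D : ℝ) ^ 2 := by
          have h2 : h ∉ H := by simpa [hL] using hh
          have : (nb G h ∩ L).card ≤ D :=
            (Finset.card_le_card Finset.inter_subset_left).trans (hD h h2)
          rw [Finset.sum_const, nsmul_eq_mul, pow_two]
          exact mul_le_mul_of_nonneg_right (by exact_mod_cast this) (by positivity)
  have hLH := sum_block_le G L H x (R := R₁) fun h hh => by
    refine le_trans ?_ (hR₁ h hh)
    exact Finset.sum_le_sum_of_subset_of_nonneg Finset.inter_subset_left fun _ _ _ => by positivity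
  have hHH := sum_block_le G H H x hR₂
  have hHL : ∑ u ∈ H, x u * ∑ h ∈ nb G u ∩ L, x h = ∑ u ∈ L, x u * ∑ h ∈ nb G u ∩ H, x h := by
    simp_rw [Finset.mul_sum]
    rw [sum_nb_comm]
    exact Finset.sum_congr rfl fun u _ => Finset.sum_congr rfl fun w _ => mul_comm _ _
  have hsplit : ∀ u, ∑ w ∈ nb G u, x w = ∑ w ∈ nb G u ∩ L, x w + ∑ w ∈ nb G u ∩ H, x w := by
    intro u
    rw [add_comm, hL, ← Finset.sdiff_eq_inter_compl, Finset.sum_inter_add_sum_sdiff]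
  have hlam : lambdaMax G = ∑ u, x u * ∑ w ∈ nb G u, x w := by
    simp_rw [hx]
    calc lambdaMax G = lambdaMax G * ∑ u, x u ^ 2 := by rw [h1, mul_one]
      _ = _ := by
        rw [Finset.mul_sum]
        exact Finset.sum_congr rfl fun u _ => by ring
  rw [hlam, ← Finset.sum_compl_add_sum H, ← hL]
  simp_rw [hsplit, mul_add, Finset.sum_add_distrib]
  rw [hHL]
  rw [Real.sqrt_sq (by positivity)] at hLL
  have hD0 : (0 : ℝ) ≤ D := by positivity
  have hs1 := Real.sqrt_nonneg R₁
  have hs2 := Real.sqrt_nonneg R₂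
  have e1 : a * (D * a) ≤ D := by nlinarith [mul_nonneg hD0 (sq_nonneg b)]
  have e2 : 2 * (a * (√R₁ * b)) ≤ √R₁ := by nlinarith [mul_nonneg hs1 (sq_nonneg (a - b))]
  have e3 : b * (√R₂ * b) ≤ √R₂ := by nlinarith [mul_nonneg hs2 (sq_nonneg a)]
  linarith

/-- For an eigenvector of positive eigenvalue of a bipartite graph the two colour classes carry
equal mass, and the eigenvalue is controlled by the number of edges inside the support; equality
forces the support to be complete bipartite. -/
lemma sq_eigenvalue_lt_or_complete (G : SimpleGraph V) (col : V → Prop) {μ : ℝ}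
    (hcol : ∀ u w, G.Adj u w → (col u ↔ ¬ col w)) (hμ : 0 < μ) (x : V → ℝ)
    (hx : ∀ u, ∑ w ∈ nb G u, x w = μ * x u) (hx0 : ∃ u, x u ≠ 0) (F : Finset (Sym2 V))
    (hF : ∀ u w, x u ≠ 0 → x w ≠ 0 → G.Adj u w → s(u, w) ∈ F) :
    (∃ u, x u ≠ 0 ∧ col u) ∧ (∃ u, x u ≠ 0 ∧ ¬ col u) ∧ μ ^ 2 ≤ F.card ∧
    (μ ^ 2 < F.card ∨ ∀ u w, x u ≠ 0 → x w ≠ 0 → col u → ¬ col w → G.Adj u w) := by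
  classical
  -- `A` and `B` are the colour classes of the support, `P` is the set of edges between them
  set A := Finset.univ.filter (fun u => x u ≠ 0 ∧ col u) with hA
  set B := Finset.univ.filter (fun u => x u ≠ 0 ∧ ¬ col u) with hB
  set P := (A ×ˢ B).filter (fun q => G.Adj q.1 q.2) with hP
  have hAsum : μ * ∑ u ∈ A, x u ^ 2 = ∑ q ∈ P, x q.1 * x q.2 := by
    rw [hP, Finset.sum_filter (s := A ×ˢ B), Finset.sum_product, Finset.mul_sum]
    refine Finset.sum_congr rfl fun u hu => ?_
    have hcu : col u := by simpa [hA] using ((Finset.mem_filter.1 hu).2).2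
    calc μ * x u ^ 2 = x u * (μ * x u) := by ring
      _ = ∑ w ∈ nb G u, x u * x w := by rw [← hx u, Finset.mul_sum]
      _ = ∑ w, if G.Adj u w then x u * x w else 0 := by
          rw [← Finset.sum_filter]; congr 1; ext; simp
      _ = _ := by
          symm
          refine Finset.sum_subset (Finset.subset_univ _) fun w _ hw => ?_
          split_ifs with h
          · have : x w = 0 := by
              by_contra h0
              exact hw (by simp [hB, h0, (hcol u w h).1 hcu])
            simp [this]
          · rfl
  have hBsum : μ * ∑ u ∈ B, x u ^ 2 = ∑ q ∈ P, x q.1 * x q.2 := by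
    rw [hP, Finset.sum_filter (s := A ×ˢ B), Finset.sum_product_right, Finset.mul_sum]
    refine Finset.sum_congr rfl fun u hu => ?_
    have hcu : ¬ col u := by simpa [hB] using ((Finset.mem_filter.1 hu).2).2
    calc μ * x u ^ 2 = x u * (μ * x u) := by ring
      _ = ∑ w ∈ nb G u, x w * x u := by
          rw [← hx u, Finset.mul_sum]; exact Finset.sum_congr rfl fun _ _ => mul_comm _ _
      _ = ∑ w, if G.Adj w u then x w * x u else 0 := by
          rw [← Finset.sum_filter]; congr 1; ext; simp [G.adj_comm]
      _ = _ := by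
          symm
          refine Finset.sum_subset (Finset.subset_univ _) fun w _ hw => ?_
          split_ifs with h
          · have : x w = 0 := by
              by_contra h0
              exact hw (by simp [hA, h0, (hcol w u h).2 hcu])
            simp [this]
          · rfl
  set M := ∑ u ∈ A, x u ^ 2 with hM
  have hMB : ∑ u ∈ B, x u ^ 2 = M := by
    have := hAsum.trans hBsum.symm
    exact (mul_left_cancel₀ hμ.ne' this).symm
  have hposA : A.Nonempty → 0 < M := fun h => Finset.sum_pos (fun u hu => by
    have : x u ≠ 0 := ((Finset.mem_filter.1 hu).2).1
    positivity) h
  have hposB : B.Nonempty → 0 < M := fun h => hMB ▸ Finset.sum_pos (fun u hu => by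
    have : x u ≠ 0 := ((Finset.mem_filter.1 hu).2).1
    positivity) h
  have hMpos : 0 < M := by
    obtain ⟨u, hu⟩ := hx0
    by_cases hc : col u
    · exact hposA ⟨u, by simp [hA, hu, hc]⟩
    · exact hposB ⟨u, by simp [hB, hu, hc]⟩
  have hAne : A.Nonempty := by
    by_contra h
    rw [Finset.not_nonempty_iff_eq_empty] at h
    simp [hM, h] at hMpos
  have hBne : B.Nonempty := by
    by_contra h
    rw [Finset.not_nonempty_iff_eq_empty] at h
    simp [← hMB, h] at hMpos
  have hcard : P.card ≤ F.card := by
    refine Finset.card_le_card_of_injOn (fun q => s(q.1, q.2)) ?_ ?_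
    · intro q hq
      simp only [hP, hA, hB, Finset.coe_filter, Finset.mem_product, Set.mem_ofPred_eq,
        Finset.mem_filter, Finset.mem_univ, true_and] at hq
      exact hF _ _ hq.1.1.1 hq.1.2.1 hq.2
    · intro q hq r hr h
      simp only [hP, hA, hB, Finset.coe_filter, Finset.mem_product, Set.mem_ofPred_eq,
        Finset.mem_filter, Finset.mem_univ, true_and] at hq hr
      rcases Sym2.eq_iff.1 h with h | h
      · exact Prod.ext h.1 h.2
      · exact absurd (h.1 ▸ hq.1.1.2) hr.1.2.2
  -- Cauchy–Schwarz over the edges, compared with the sum over all pairs in `A ×ˢ B`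
  have hCS : (μ * M) ^ 2 ≤ P.card * ∑ q ∈ P, (x q.1 * x q.2) ^ 2 := by
    rw [hAsum]
    exact sq_sum_le_card_mul_sum_sq
  have hfull : ∑ q ∈ A ×ˢ B, (x q.1 * x q.2) ^ 2 = M ^ 2 := by
    rw [Finset.sum_product, pow_two M]
    nth_rewrite 2 [← hMB]
    rw [hM, Finset.sum_mul_sum]
    exact Finset.sum_congr rfl fun u _ => Finset.sum_congr rfl fun w _ => by ring
  have hle : ∑ q ∈ P, (x q.1 * x q.2) ^ 2 ≤ M ^ 2 := by
    rw [← hfull]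
    exact Finset.sum_le_sum_of_subset_of_nonneg (Finset.filter_subset _ _)
      fun _ _ _ => sq_nonneg _
  have hcardR : (P.card : ℝ) ≤ F.card := by exact_mod_cast hcard
  have hM2 : 0 < M ^ 2 := by positivity
  have hb : μ ^ 2 * M ^ 2 ≤ F.card * ∑ q ∈ P, (x q.1 * x q.2) ^ 2 := by
    rw [← mul_pow]
    exact hCS.trans (mul_le_mul_of_nonneg_right hcardR (Finset.sum_nonneg fun _ _ => sq_nonneg _))
  have hF0 : (0 : ℝ) ≤ F.card := by positivity
  have hmain : μ ^ 2 ≤ F.card :=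
    le_of_mul_le_mul_right (hb.trans (mul_le_mul_of_nonneg_left hle hF0)) hM2
  refine ⟨?_, ?_, hmain, ?_⟩
  · obtain ⟨u, hu⟩ := hAne
    exact ⟨u, (Finset.mem_filter.1 hu).2⟩
  · obtain ⟨u, hu⟩ := hBne
    exact ⟨u, (Finset.mem_filter.1 hu).2⟩
  · by_contra! h
    obtain ⟨h1, u, w, hu, hw, hcu, hcw, hn⟩ := h
    have hlt : ∑ q ∈ P, (x q.1 * x q.2) ^ 2 < M ^ 2 := by
      rw [← hfull]
      refine Finset.sum_lt_sum_of_subset (Finset.filter_subset _ _) (i := (u, w)) ?_ ?_ ?_ ?_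
      · simp [hA, hB, hu, hw, hcu, hcw]
      · simp [hP, hn]
      · have : x u * x w ≠ 0 := mul_ne_zero hu hw
        positivity
      · exact fun _ _ _ => sq_nonneg _
    have hFpos : (0 : ℝ) < F.card := (pow_pos hμ 2).trans_le hmain
    have : μ ^ 2 * M ^ 2 < F.card * M ^ 2 := hb.trans_lt (mul_lt_mul_of_pos_left hlt hFpos)
    exact absurd (lt_of_mul_lt_mul_right this hM2.le) h1.not_gt

end Spectral

/-! ### Geometry of the cube -/

section Cube

variable {n : ℕ}

/-- The vertex obtained from `v` by changing the coordinate `i`. -/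
def flipAt (v : Fin n → Bool) (i : Fin n) : Fin n → Bool := Function.update v i (!v i)

@[simp] lemma flipAt_same (v : Fin n → Bool) (i : Fin n) : flipAt v i i = !v i := by
  simp [flipAt]

lemma flipAt_of_ne (v : Fin n → Bool) {i j : Fin n} (h : j ≠ i) : flipAt v i j = v j := by
  simp [flipAt, h]

@[simp] lemma flipAt_flipAt (v : Fin n → Bool) (i : Fin n) : flipAt (flipAt v i) i = v := by
  ext j
  by_cases h : j = i
  · subst h; simp
  · simp [flipAt_of_ne _ h]

lemma flipAt_right_injective (v : Fin n → Bool) : Function.Injective (flipAt v) := by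
  intro i j h
  by_contra hij
  have := congrFun h i
  rw [flipAt_same, flipAt_of_ne _ hij] at this
  simp at this

lemma flipAt_left_injective (i : Fin n) : Function.Injective fun v : Fin n → Bool => flipAt v i :=
  fun v w h => by simpa using congrArg (fun x => flipAt x i) h

lemma hypercube_adj_iff {v w : Fin n → Bool} : (hypercube n).Adj v w ↔ ∃ i, w = flipAt v i := by
  change hammingDist v w = 1 ↔ _
  rw [hammingDist, Finset.card_eq_one]
  refine exists_congr fun i => ⟨fun h => ?_, fun h => ?_⟩
  · ext j
    have := Finset.ext_iff.1 h j
    simp only [Finset.mem_filter, Finset.mem_univ, true_and, Finset.mem_singleton] at this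
    by_cases hj : j = i
    · subst hj
      have h1 : v j ≠ w j := by simpa using this
      rw [flipAt_same]
      cases hv : v j <;> cases hw : w j <;> simp_all
    · rw [flipAt_of_ne _ hj]
      have h1 : ¬ v j ≠ w j := fun h' => hj (this.1 h')
      exact (not_not.1 h1).symm
  · subst h
    ext j
    by_cases hj : j = i
    · subst hj; simp
    · simp [flipAt_of_ne _ hj, hj]

/-- A vertex of the cube is even when it has an even number of coordinates equal to one. -/
def IsEven (v : Fin n → Bool) : Prop := Even (Finset.univ.filter fun i => v i = true).card

lemma isEven_flipAt (v : Fin n → Bool) (i : Fin n) : IsEven (flipAt v i) ↔ ¬ IsEven v := by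
  have key : ∀ w : Fin n → Bool, w i = false → (IsEven (flipAt w i) ↔ ¬ IsEven w) := by
    intro w hw
    have : (Finset.univ.filter fun j => flipAt w i j = true) =
        insert i (Finset.univ.filter fun j => w j = true) := by
      ext j
      by_cases hj : j = i
      · subst hj; simp [hw]
      · simp [flipAt_of_ne _ hj, hj]
    rw [IsEven, IsEven, this, Finset.card_insert_of_notMem (by simp [hw]), Nat.even_add_one]
  cases hv : v i
  · exact key v hv
  · have := key (flipAt v i) (by simp [hv])
    rw [flipAt_flipAt] at this
    tauto

lemma isEven_iff_of_adj {v w : Fin n → Bool} (h : (hypercube n).Adj v w) :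
    IsEven v ↔ ¬ IsEven w := by
  obtain ⟨i, rfl⟩ := hypercube_adj_iff.1 h
  rw [isEven_flipAt]
  tauto

lemma adj_flipAt (v : Fin n → Bool) (i : Fin n) : (hypercube n).Adj v (flipAt v i) :=
  hypercube_adj_iff.2 ⟨i, rfl⟩

/-- The edge of the cube at `v` in direction `i`. -/
def cubeEdge (v : Fin n → Bool) (i : Fin n) : Sym2 (Fin n → Bool) := s(v, flipAt v i)

lemma cubeEdge_mem (v : Fin n → Bool) (i : Fin n) : cubeEdge v i ∈ (hypercube n).edgeSet :=
  adj_flipAt v i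

lemma cubeEdge_mem_edgeSet {G : SimpleGraph (Fin n → Bool)} {v : Fin n → Bool} {i : Fin n} :
    cubeEdge v i ∈ G.edgeSet ↔ G.Adj v (flipAt v i) := Iff.rfl

/-- The edges at vertices of the same parity are pairwise distinct. -/
lemma cubeEdge_inj {v w : Fin n → Bool} {i j : Fin n} (hvw : IsEven v ↔ IsEven w)
    (h : cubeEdge v i = cubeEdge w j) : v = w ∧ i = j := by
  rcases Sym2.eq_iff.1 h with ⟨h1, h2⟩ | ⟨h1, h2⟩
  · subst h1
    exact ⟨rfl, flipAt_right_injective v h2⟩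
  · have := isEven_flipAt w j
    rw [← h1] at this
    tauto

/-- The directions of the edges of `G` at `v`. -/
noncomputable def dirs (G : SimpleGraph (Fin n → Bool)) (v : Fin n → Bool) : Finset (Fin n) := by
  classical exact Finset.univ.filter fun i => G.Adj v (flipAt v i)

@[simp] lemma mem_dirs {G : SimpleGraph (Fin n → Bool)} {v : Fin n → Bool} {i : Fin n} :
    i ∈ dirs G v ↔ G.Adj v (flipAt v i) := by
  simp [dirs]

lemma nb_eq_image_dirs {G : SimpleGraph (Fin n → Bool)} (hG : G ≤ hypercube n)
    (v : Fin n → Bool) : nb G v = (dirs G v).image (flipAt v) := by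
  ext w
  simp only [mem_nb, Finset.mem_image, mem_dirs]
  constructor
  · intro h
    obtain ⟨i, rfl⟩ := hypercube_adj_iff.1 (hG h)
    exact ⟨i, h, rfl⟩
  · rintro ⟨i, h, rfl⟩
    exact h

lemma card_nb_eq_card_dirs {G : SimpleGraph (Fin n → Bool)} (hG : G ≤ hypercube n)
    (v : Fin n → Bool) : (nb G v).card = (dirs G v).card := by
  rw [nb_eq_image_dirs hG, Finset.card_image_of_injective _ (flipAt_right_injective v)]

/-- Two vertices of the cube have at most two common neighbours. -/
lemma card_nb_inter_nb_le_two {G : SimpleGraph (Fin n → Bool)} (hG : G ≤ hypercube n)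
    {u w : Fin n → Bool} (huw : u ≠ w) : (nb G u ∩ nb G w).card ≤ 2 := by
  rcases (nb G u ∩ nb G w).eq_empty_or_nonempty with h | ⟨c, hc⟩
  · simp [h]
  have hdir : ∀ c ∈ nb G u ∩ nb G w, ∃ i j, c = flipAt u i ∧ c = flipAt w j := by
    intro c hc
    rw [Finset.mem_inter, mem_nb, mem_nb] at hc
    obtain ⟨i, hi⟩ := hypercube_adj_iff.1 (hG hc.1)
    obtain ⟨j, hj⟩ := hypercube_adj_iff.1 (hG hc.2)
    exact ⟨i, j, hi, hj⟩
  obtain ⟨i₀, j₀, hi₀, hj₀⟩ := hdir c hc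
  have hsub : nb G u ∩ nb G w ⊆ ({i₀, j₀} : Finset (Fin n)).image (flipAt u) := by
    intro d hd
    obtain ⟨i, j, hi, hj⟩ := hdir d hd
    refine Finset.mem_image.2 ⟨i, ?_, hi.symm⟩
    -- `u` and `w` differ at `i`, but agree outside `{i₀, j₀}`
    have hne : u i ≠ w i := by
      intro he
      by_cases hij : i = j
      · subst hij
        exact huw (flipAt_left_injective i (hi.symm.trans hj))
      · have h1 := congrFun (hi.symm.trans hj) i
        rw [flipAt_same, flipAt_of_ne _ hij, ← he] at h1
        simp at h1
    by_contra hmem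
    simp only [Finset.mem_insert, Finset.mem_singleton, not_or] at hmem
    have h1 := congrFun (hi₀.symm.trans hj₀) i
    rw [flipAt_of_ne _ hmem.1, flipAt_of_ne _ hmem.2] at h1
    exact hne h1
  exact (Finset.card_le_card hsub).trans (Finset.card_image_le.trans Finset.card_le_two)

/-- The vertices at distance two from `v`. -/
def sphereTwo (v : Fin n → Bool) : Finset (Fin n → Bool) :=
  (Finset.univ.filter fun q : Fin n × Fin n => q.1 ≠ q.2).image fun q => flipAt (flipAt v q.1) q.2

lemma mem_sphereTwo_of_common_nb {G : SimpleGraph (Fin n → Bool)} (hG : G ≤ hypercube n)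
    {u v w : Fin n → Bool} (huv : G.Adj v u) (huw : G.Adj u w) (hvw : w ≠ v) :
    w ∈ sphereTwo v := by
  obtain ⟨i, rfl⟩ := hypercube_adj_iff.1 (hG huv)
  obtain ⟨j, rfl⟩ := hypercube_adj_iff.1 (hG huw)
  refine Finset.mem_image.2 ⟨(i, j), ?_, rfl⟩
  simp only [Finset.mem_filter, Finset.mem_univ, true_and]
  rintro rfl
  exact hvw (by simp)

lemma isEven_of_mem_sphereTwo {v w : Fin n → Bool} (h : w ∈ sphereTwo v) :
    IsEven w ↔ IsEven v := by
  obtain ⟨q, -, rfl⟩ := Finset.mem_image.1 h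
  rw [isEven_flipAt, isEven_flipAt, not_not]

lemma card_sphereTwo_le (v : Fin n → Bool) : (sphereTwo v).card ≤ n ^ 2 := by
  refine Finset.card_image_le.trans ((Finset.card_filter_le _ _).trans ?_)
  simp [pow_two]

/-- Walks of length two that start in `h` and end in `H` either return to `h` or end at distance
two; each end point in the second case is reached by at most two walks. -/
lemma sum_card_nb_inter_le {G : SimpleGraph (Fin n → Bool)} (hG : G ≤ hypercube n)
    (H U : Finset (Fin n → Bool)) (h : Fin n → Bool) :
    ∑ u ∈ nb G h ∩ U, (nb G u ∩ H).card ≤ (nb G h ∩ U).card + 2 * (sphereTwo h ∩ H).card := by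
  have h1 : ∀ u ∈ nb G h, (nb G u ∩ H).card ≤ 1 + (nb G u ∩ (sphereTwo h ∩ H)).card := by
    intro u hu
    have : nb G u ∩ H ⊆ {h} ∪ (nb G u ∩ (sphereTwo h ∩ H)) := by
      intro w hw
      rw [Finset.mem_inter] at hw
      by_cases hwh : w = h
      · simp [hwh]
      · have := mem_sphereTwo_of_common_nb hG (mem_nb.1 hu) (mem_nb.1 hw.1) hwh
        simp [this, hw.2, mem_nb.1 hw.1]
    exact (Finset.card_le_card this).trans ((Finset.card_union_le _ _).trans (by simp))
  calc ∑ u ∈ nb G h ∩ U, (nb G u ∩ H).card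
      ≤ ∑ u ∈ nb G h ∩ U, (1 + (nb G u ∩ (sphereTwo h ∩ H)).card) :=
        Finset.sum_le_sum fun u hu => h1 u (Finset.mem_inter.1 hu).1
    _ = (nb G h ∩ U).card + ∑ u ∈ nb G h ∩ U, (nb G u ∩ (sphereTwo h ∩ H)).card := by
        rw [Finset.sum_add_distrib]; simp
    _ ≤ (nb G h ∩ U).card + ∑ u ∈ nb G h, (nb G u ∩ (sphereTwo h ∩ H)).card := by
        gcongr
        exact Finset.inter_subset_left
    _ = (nb G h ∩ U).card + ∑ w ∈ sphereTwo h ∩ H, (nb G w ∩ nb G h).card := by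
        congr 1
        have := sum_nb_comm G (nb G h) (sphereTwo h ∩ H) fun _ _ => 1
        simp only [Finset.sum_const, nsmul_eq_mul, mul_one] at this
        exact_mod_cast this
    _ ≤ (nb G h ∩ U).card + ∑ w ∈ sphereTwo h ∩ H, 2 := by
        gcongr with w hw
        refine card_nb_inter_nb_le_two hG fun hwh => ?_
        have h2 := (Finset.mem_inter.1 hw).1
        rw [hwh] at h2
        obtain ⟨q, hq, hq'⟩ := Finset.mem_image.1 h2
        have := flipAt_right_injective (flipAt h q.1)
          (hq'.trans (flipAt_flipAt h q.1).symm)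
        exact (Finset.mem_filter.1 hq).2 this.symm
    _ = _ := by simp [mul_comm]

/-- If around each vertex at most `s` vertices at distance two have degree at least `D`, then
the largest eigenvalue is close to the square root of the maximum degree. -/
lemma lambdaMax_le_of_sphereTwo {G : SimpleGraph (Fin n → Bool)} (hG : G ≤ hypercube n) {D s : ℕ}
    (hs : ∀ v, ((sphereTwo v).filter fun w => D ≤ (nb G w).card).card ≤ s) :
    lambdaMax G ≤ √((maxDeg G : ℝ) + 2 * s) + √(3 * s + 1) + D := by
  set H : Finset (Fin n → Bool) := Finset.univ.filter fun w => D ≤ (nb G w).card with hH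
  have hsH : ∀ v, (sphereTwo v ∩ H).card ≤ s := by
    intro v
    convert hs v using 2
    ext w; simp [hH]
  have hdH : ∀ h, (nb G h ∩ H).card ≤ s + 1 := by
    intro h
    rcases (nb G h ∩ H).eq_empty_or_nonempty with h0 | ⟨u, hu⟩
    · simp [h0]
    rw [Finset.mem_inter] at hu
    have : nb G h ∩ H ⊆ (sphereTwo u ∩ H) ∪ {u} := by
      intro w hw
      rw [Finset.mem_inter] at hw
      by_cases hwu : w = u
      · simp [hwu]
      · have := mem_sphereTwo_of_common_nb hG (mem_nb.1 hu.1).symm (mem_nb.1 hw.1) hwu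
        simp [this, hw.2]
    refine (Finset.card_le_card this).trans ((Finset.card_union_le _ _).trans ?_)
    simpa using hsH u
  refine lambdaMax_le_of_split G H (fun v hv => ?_) (fun h _ => ?_) (fun h _ => ?_)
  · simp only [hH, Finset.mem_filter, Finset.mem_univ, true_and, not_le] at hv
    exact hv.le
  · have h1 := sum_card_nb_inter_le hG H Finset.univ h
    rw [Finset.inter_univ] at h1
    have h2 := card_nb_le_maxDeg G h
    have h3 := hsH h
    have : ∑ u ∈ nb G h, (nb G u ∩ H).card ≤ maxDeg G + 2 * s := by omega
    exact_mod_cast this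
  · have h1 := sum_card_nb_inter_le hG H H h
    have h2 := hdH h
    have h3 := hsH h
    have : ∑ u ∈ nb G h ∩ H, (nb G u ∩ H).card ≤ 3 * s + 1 := by omega
    exact_mod_cast this

/-- In a set of vertices that is closed under changing one coordinate, half of the vertices are
even. -/
lemma card_filter_isEven [DecidablePred (IsEven (n := n))] (X : Finset (Fin n → Bool)) (i : Fin n)
    (hX : ∀ v ∈ X, flipAt v i ∈ X) : 2 * (X.filter IsEven).card = X.card := by
  have h : (X.filter IsEven).card = (X.filter fun v => ¬ IsEven v).card := by
    refine Finset.card_bij' (fun v _ => flipAt v i) (fun v _ => flipAt v i) ?_ ?_ ?_ ?_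
    · intro v hv
      rw [Finset.mem_filter] at hv ⊢
      exact ⟨hX v hv.1, by rw [isEven_flipAt]; exact not_not.2 hv.2⟩
    · intro v hv
      rw [Finset.mem_filter] at hv ⊢
      exact ⟨hX v hv.1, by rw [isEven_flipAt]; exact hv.2⟩
    · simp
    · simp
  have := Finset.card_filter_add_card_filter_not (s := X) IsEven
  omega

end Cube

/-! ### Probability bounds for degrees -/

section Degrees

variable {n : ℕ}

/-- Monotonicity of the probability, where only subgraphs of the cube need to be considered. -/
lemma randomCubeSubgraph_real_mono (p : I) {A B : Set (SimpleGraph (Fin n → Bool))}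
    (h : ∀ G, G ≤ hypercube n → G ∈ A → G ∈ B) :
    (randomCubeSubgraph n p).real A ≤ (randomCubeSubgraph n p).real B := by
  refine ENNReal.toReal_mono (measure_ne_top _ _) (measure_mono_ae ?_)
  filter_upwards [randomCubeSubgraph_ae_le n p] with G hG hA
  exact h G hG hA

/-- The edges at `v` in the directions of `J`. -/
def edgesAt (v : Fin n → Bool) (J : Finset (Fin n)) : Finset (Sym2 (Fin n → Bool)) :=
  J.image (cubeEdge v)

lemma edgesAt_subset (v : Fin n → Bool) (J : Finset (Fin n)) :
    (edgesAt v J : Set (Sym2 (Fin n → Bool))) ⊆ (hypercube n).edgeSet := by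
  intro e he
  obtain ⟨i, -, rfl⟩ := Finset.mem_image.1 (Finset.mem_coe.1 he)
  exact cubeEdge_mem v i

lemma card_edgesAt (v : Fin n → Bool) (J : Finset (Fin n)) : (edgesAt v J).card = J.card :=
  Finset.card_image_of_injective _ fun _ _ h => (cubeEdge_inj Iff.rfl h).2

lemma edgesAt_subset_edgeSet {G : SimpleGraph (Fin n → Bool)} {v : Fin n → Bool}
    {J : Finset (Fin n)} (h : J ⊆ dirs G v) : (edgesAt v J : Set _) ⊆ G.edgeSet := by
  intro e he
  obtain ⟨i, hi, rfl⟩ := Finset.mem_image.1 (Finset.mem_coe.1 he)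
  exact mem_dirs.1 (h hi)

lemma randomCubeSubgraph_real_exists_degree_ge_le (p : I) (k : ℕ) :
    (randomCubeSubgraph n p).real {G | ∃ v, k ≤ (nb G v).card} ≤
      2 ^ n * (n.choose k * (p : ℝ) ^ k) := by
  classical
  set T : Finset (Finset (Sym2 (Fin n → Bool))) :=
    (Finset.univ ×ˢ Finset.powersetCard k Finset.univ).image fun q => edgesAt q.1 q.2 with hT
  have hTcard : (T.card : ℝ) ≤ 2 ^ n * n.choose k := by
    have : T.card ≤ 2 ^ n * n.choose k := by
      refine Finset.card_image_le.trans (le_of_eq ?_)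
      simp [Finset.card_product, Finset.card_powersetCard]
    exact_mod_cast this
  calc _ ≤ (randomCubeSubgraph n p).real {G | ∃ F ∈ T, (F : Set _) ⊆ G.edgeSet} := by
        refine randomCubeSubgraph_real_mono p fun G hG ⟨v, hv⟩ => ?_
        rw [card_nb_eq_card_dirs hG] at hv
        obtain ⟨J, hJ, hJk⟩ := Finset.exists_subset_card_eq hv
        refine ⟨edgesAt v J, Finset.mem_image.2 ⟨(v, J), ?_, rfl⟩, edgesAt_subset_edgeSet hJ⟩
        simp [Finset.mem_powersetCard, hJk]
    _ ≤ T.card * (p : ℝ) ^ k := by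
        refine randomCubeSubgraph_real_exists_subset_le p (fun F hF => ?_) (fun F hF => ?_)
        · obtain ⟨q, -, rfl⟩ := Finset.mem_image.1 hF
          exact edgesAt_subset _ _
        · obtain ⟨q, hq, rfl⟩ := Finset.mem_image.1 hF
          rw [card_edgesAt]
          exact (Finset.mem_powersetCard.1 (Finset.mem_product.1 hq).2).2
    _ ≤ 2 ^ n * n.choose k * (p : ℝ) ^ k :=
        mul_le_mul_of_nonneg_right hTcard (pow_nonneg p.2.1 _)
    _ = _ := by ring

/-- Many vertices of large degree at distance two from a vertex are unlikely: such vertices have the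
same parity, so their edges are distinct and present independently. -/
lemma randomCubeSubgraph_real_exists_sphereTwo_le (p : I) (D s : ℕ) :
    (randomCubeSubgraph n p).real
      {G | ∃ v, s ≤ ((sphereTwo v).filter fun w => D ≤ (nb G w).card).card} ≤
      2 ^ n * ((n : ℝ) ^ 2 * (n.choose D * (p : ℝ) ^ D)) ^ s := by
  classical
  -- `F f` is the union of `s` stars with `D` edges, and `R v` are the choices centred around `v`
  set F : (Fin s → (Fin n → Bool) × Finset (Fin n)) → Finset (Sym2 (Fin n → Bool)) :=
    fun f => Finset.univ.biUnion fun a => edgesAt (f a).1 (f a).2 with hF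
  set R : (Fin n → Bool) → Finset (Fin s → (Fin n → Bool) × Finset (Fin n)) := fun v =>
    Fintype.piFinset fun _ => sphereTwo v ×ˢ Finset.powersetCard D Finset.univ with hR
  set T : Finset (Finset (Sym2 (Fin n → Bool))) :=
    (Finset.univ.biUnion fun v => (R v).image F).filter fun E => E.card = s * D with hT
  have hTcard : (T.card : ℝ) ≤ 2 ^ n * ((n : ℝ) ^ 2 * n.choose D) ^ s := by
    have : T.card ≤ 2 ^ n * (n ^ 2 * n.choose D) ^ s := by
      refine (Finset.card_filter_le _ _).trans ?_
      refine (Finset.card_biUnion_le_card_mul _ _ _ fun v _ => Finset.card_image_le.trans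
        (?_ : _ ≤ (n ^ 2 * n.choose D) ^ s)).trans (le_of_eq (by simp))
      rw [hR, Fintype.card_piFinset, Finset.prod_const, Finset.card_product,
        Finset.card_powersetCard]
      simp only [Finset.card_univ, Fintype.card_fin]
      gcongr
      exact card_sphereTwo_le v
    exact_mod_cast this
  calc _ ≤ (randomCubeSubgraph n p).real {G | ∃ E ∈ T, (E : Set _) ⊆ G.edgeSet} := by
        refine randomCubeSubgraph_real_mono p fun G hG ⟨v, hv⟩ => ?_
        obtain ⟨S, hS, hScard⟩ := Finset.exists_subset_card_eq hv
        have hSsub : ∀ w ∈ S, w ∈ sphereTwo v ∧ D ≤ (dirs G w).card := fun w hw => by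
          have := Finset.mem_filter.1 (hS hw)
          rwa [card_nb_eq_card_dirs hG] at this
        choose! J hJ hJD using fun w hw => Finset.exists_subset_card_eq (hSsub w hw).2
        let g : Fin s ≃ S := (S.equivFinOfCardEq hScard).symm
        let f : Fin s → (Fin n → Bool) × Finset (Fin n) := fun a => (g a, J (g a))
        refine ⟨F f, Finset.mem_filter.2 ⟨Finset.mem_biUnion.2 ⟨v, Finset.mem_univ _,
          Finset.mem_image.2 ⟨f, ?_, rfl⟩⟩, ?_⟩, ?_⟩
        · rw [hR, Fintype.mem_piFinset]
          intro a
          rw [Finset.mem_product, Finset.mem_powersetCard]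
          exact ⟨(hSsub _ (g a).2).1, Finset.subset_univ _, hJD _ (g a).2⟩
        · rw [hF]
          dsimp only
          rw [Finset.card_biUnion]
          · simp only [card_edgesAt]
            rw [Finset.sum_congr rfl fun a _ => hJD _ (g a).2]
            simp
          · intro a _ b _ hab
            refine Finset.disjoint_left.2 fun e he he' => hab ?_
            obtain ⟨i, -, rfl⟩ := Finset.mem_image.1 he
            obtain ⟨j, -, hj⟩ := Finset.mem_image.1 he'
            have hp := (isEven_of_mem_sphereTwo (hSsub _ (g b).2).1).trans
              (isEven_of_mem_sphereTwo (hSsub _ (g a).2).1).symm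
            exact g.injective (Subtype.ext (cubeEdge_inj hp hj).1.symm)
        · rw [hF]
          intro e he
          obtain ⟨a, -, ha⟩ := Finset.mem_biUnion.1 (Finset.mem_coe.1 he)
          exact edgesAt_subset_edgeSet (hJ _ (g a).2) ha
    _ ≤ T.card * (p : ℝ) ^ (s * D) := by
        refine randomCubeSubgraph_real_exists_subset_le p (fun E hE => ?_)
          (fun E hE => (Finset.mem_filter.1 hE).2)
        obtain ⟨v, -, hv⟩ := Finset.mem_biUnion.1 (Finset.mem_filter.1 hE).1
        obtain ⟨f, -, rfl⟩ := Finset.mem_image.1 hv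
        intro e he
        obtain ⟨a, -, ha⟩ := Finset.mem_biUnion.1 (Finset.mem_coe.1 he)
        exact edgesAt_subset _ _ ha
    _ ≤ 2 ^ n * ((n : ℝ) ^ 2 * n.choose D) ^ s * (p : ℝ) ^ (s * D) :=
        mul_le_mul_of_nonneg_right hTcard (pow_nonneg p.2.1 _)
    _ = _ := by rw [mul_comm s D, pow_mul]; ring

/-- Even vertices have independent neighbourhoods, so the probability that each of them misses a
block of directions is explicit. -/
lemma randomCubeSubgraph_real_forall_even_miss (p : I) {X : Finset (Fin n → Bool)}
    (hX : ∀ v ∈ X, IsEven v) {κ : Type*} {t : Finset κ} (Bl : κ → Finset (Fin n)) {b : ℕ}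
    (hb : ∀ j ∈ t, (Bl j).card = b) (hBl : (t : Set κ).PairwiseDisjoint Bl) :
    (randomCubeSubgraph n p).real {G | ∀ v ∈ X, ∃ j ∈ t, ∀ i ∈ Bl j, i ∉ dirs G v} =
      (1 - (1 - (1 - (p : ℝ)) ^ b) ^ t.card) ^ X.card := by
  rw [← randomCubeSubgraph_real_forall_exists_disjoint p (B := fun v j => edgesAt v (Bl j))
    (s := X) (t := t) (fun v _ j _ => edgesAt_subset v _)
    (fun v _ j hj => (card_edgesAt v _).trans (hb j hj))]
  · congr 1
    ext G
    simp [edgesAt, cubeEdge_mem_edgeSet]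
  · intro v hv j hj w hw j' hj' e he he'
    obtain ⟨i, hi, rfl⟩ := Finset.mem_image.1 he
    obtain ⟨i', hi', hii⟩ := Finset.mem_image.1 he'
    obtain ⟨h1, h2⟩ := cubeEdge_inj (iff_of_true (hX w hw) (hX v hv)) hii
    refine ⟨h1.symm, ?_⟩
    by_contra hne
    exact Finset.disjoint_left.1 (hBl hj hj' hne) hi (h2 ▸ hi')

/-- The first `k` directions. -/
def firstDirs (n k : ℕ) : Finset (Fin n) := Finset.univ.filter fun i => i.val < k

lemma card_firstDirs {n k : ℕ} (hk : k ≤ n) : (firstDirs n k).card = k := by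
  rw [firstDirs, Fin.card_filter_val_lt, min_eq_right hk]

lemma randomCubeSubgraph_real_forall_not_firstDirs_le (p : I) {X : Finset (Fin n → Bool)}
    (hX : ∀ v ∈ X, IsEven v) {k : ℕ} (hk : k ≤ n) :
    (randomCubeSubgraph n p).real {G | ∀ v ∈ X, ¬ firstDirs n k ⊆ dirs G v} ≤
      Real.exp (-(X.card * (p : ℝ) ^ k)) := by
  have h := randomCubeSubgraph_real_forall_even_miss p hX (t := firstDirs n k) (fun i => {i})
    (b := 1) (by simp) (fun i _ j _ hij => by simpa using hij)
  have hset : {G : SimpleGraph (Fin n → Bool) | ∀ v ∈ X, ¬ firstDirs n k ⊆ dirs G v} =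
      {G | ∀ v ∈ X, ∃ j ∈ firstDirs n k, ∀ i ∈ ({j} : Finset (Fin n)), i ∉ dirs G v} := by
    ext G
    simp [Finset.subset_iff]
  rw [hset, h, card_firstDirs hk, pow_one, sub_sub_cancel]
  have h1 : (p : ℝ) ^ k ≤ 1 := pow_le_one₀ p.2.1 p.2.2
  calc (1 - (p : ℝ) ^ k) ^ X.card ≤ Real.exp (-(p : ℝ) ^ k) ^ X.card := by
        exact pow_le_pow_left₀ (by linarith) (Real.one_sub_le_exp_neg _) _
    _ = _ := by rw [← Real.exp_nat_mul]; ring_nf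

open Classical in
lemma two_mul_card_even (hn : n ≠ 0) :
    2 * (Finset.univ.filter (IsEven (n := n))).card = 2 ^ n := by
  rw [card_filter_isEven Finset.univ ⟨0, Nat.pos_of_ne_zero hn⟩ (by simp)]
  simp

/-- A lower bound for the largest degree: the stars in the first `k` directions at the even vertices
are present independently. -/
lemma randomCubeSubgraph_real_forall_degree_lt_le (p : I) {k : ℕ} (hk : k ≤ n) (hn : n ≠ 0) :
    (randomCubeSubgraph n p).real {G | ∀ v, (nb G v).card < k} ≤
      Real.exp (-(2 ^ n / 2 * (p : ℝ) ^ k)) := by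
  classical
  have hcard : ((Finset.univ.filter (IsEven (n := n))).card : ℝ) = 2 ^ n / 2 := by
    have : (2 : ℝ) * (Finset.univ.filter (IsEven (n := n))).card = 2 ^ n := by
      exact_mod_cast two_mul_card_even hn
    linarith
  rw [← hcard]
  refine le_trans (randomCubeSubgraph_real_mono p (B := {G | ∀ v ∈ Finset.univ.filter
    IsEven, ¬ firstDirs n k ⊆ dirs G v}) fun G hG h v _ hsub => ?_)
    (randomCubeSubgraph_real_forall_not_firstDirs_le p
      (X := Finset.univ.filter IsEven) (by simp) hk)
  have h1 := Finset.card_le_card hsub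
  rw [card_firstDirs hk, ← card_nb_eq_card_dirs hG] at h1
  exact absurd (h v) h1.not_gt

/-- A lower bound for the largest degree that is sharp up to constants for bounded `k`: the
directions are cut into `k` blocks, each of which has to contain an edge. -/
lemma randomCubeSubgraph_real_forall_degree_lt_le' (p : I) {k b : ℕ} (hkb : k * b ≤ n)
    (hn : n ≠ 0) :
    (randomCubeSubgraph n p).real {G | ∀ v, (nb G v).card < k} ≤
      Real.exp (-(2 ^ n / 2 * (1 - (1 - (p : ℝ)) ^ b) ^ k)) := by
  classical
  have hcard : ((Finset.univ.filter (IsEven (n := n))).card : ℝ) = 2 ^ n / 2 := by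
    have : (2 : ℝ) * (Finset.univ.filter (IsEven (n := n))).card = 2 ^ n := by
      exact_mod_cast two_mul_card_even hn
    linarith
  set Bl : Fin k → Finset (Fin n) := fun j =>
    Finset.univ.image fun a : Fin b => ⟨j * b + a, by
      have : (j : ℕ) * b + a < (j + 1) * b := by rw [add_mul]; omega
      exact this.trans_le ((Nat.mul_le_mul_right b j.2).trans hkb)⟩ with hBl
  -- `Bl j` consists of the directions `j * b, …, j * b + b - 1`
  have hmem : ∀ j i, i ∈ Bl j → (i : ℕ) / b = j := by
    intro j i hi
    obtain ⟨a, -, rfl⟩ := Finset.mem_image.1 hi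
    have ha := a.2
    simp only
    rw [mul_comm, Nat.mul_add_div (by omega), Nat.div_eq_of_lt ha, add_zero]
  have hdisj : ((Finset.univ : Finset (Fin k)) : Set (Fin k)).PairwiseDisjoint Bl := by
    intro j _ j' _ hne
    refine Finset.disjoint_left.2 fun i hi hi' => hne (Fin.ext ?_)
    rw [← hmem j i hi, ← hmem j' i hi']
  have h := randomCubeSubgraph_real_forall_even_miss p (X := Finset.univ.filter IsEven)
    (by simp) (t := Finset.univ) Bl (b := b) (fun j _ => by
      rw [hBl, Finset.card_image_of_injective]
      · simp
      · intro a a' haa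
        have := congrArg Fin.val haa
        simp only at this
        exact Fin.ext (by omega)) hdisj
  refine le_trans (randomCubeSubgraph_real_mono p (B := {G | ∀ v ∈ Finset.univ.filter IsEven,
    ∃ j ∈ Finset.univ, ∀ i ∈ Bl j, i ∉ dirs G v}) fun G hG hlt v _ => ?_) (h.trans_le ?_)
  · by_contra! hno
    choose i hi hid using fun j => hno j (Finset.mem_univ _)
    have hinj : Function.Injective i := fun j j' hjj => Fin.ext (by
      rw [← hmem j _ (hi j), ← hmem j' _ (hi j'), hjj])
    have h1 := Finset.card_le_card (s := Finset.univ.image i) (t := dirs G v) (by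
      intro x hx
      obtain ⟨j, -, rfl⟩ := Finset.mem_image.1 hx
      exact hid j)
    rw [Finset.card_image_of_injective _ hinj, Finset.card_univ, Fintype.card_fin,
      ← card_nb_eq_card_dirs hG] at h1
    exact absurd (hlt v) h1.not_gt
  · rw [Finset.card_univ, Fintype.card_fin]
    set q := (1 - (1 - (p : ℝ)) ^ b) ^ k with hq
    have hp1 : 0 ≤ 1 - (p : ℝ) := by linarith [p.2.2]
    have h01 : 0 ≤ 1 - (1 - (p : ℝ)) ^ b := by
      linarith [pow_le_one₀ (n := b) hp1 (by linarith [p.2.1])]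
    have hq1 : q ≤ 1 := pow_le_one₀ h01 (by linarith [pow_nonneg hp1 b])
    calc (1 - q) ^ _ ≤ Real.exp (-q) ^ (Finset.univ.filter (IsEven (n := n))).card := by
          exact pow_le_pow_left₀ (by linarith) (Real.one_sub_le_exp_neg _) _
      _ = _ := by rw [← Real.exp_nat_mul, hcard]; ring_nf

end Degrees

/-! ### The regime of subexponentially small probabilities: almost sure asymptotics -/

section Subexponential

/-- Borel–Cantelli for the sequence of random subgraphs. -/
lemma ae_eventually_notMem_of_summable (p : ℕ → I) (A : (n : ℕ) → Set (SimpleGraph (Fin n → Bool)))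
    {b : ℕ → ℝ} (hb : Summable b)
    (hA : ∀ᶠ n in atTop, (randomCubeSubgraph n (p n)).real (A n) ≤ b n) :
    ∀ᵐ G ∂(randomCubeSubgraphs p), ∀ᶠ n in atTop, G n ∉ A n := by
  have hmeas : ∀ n, randomCubeSubgraphs p {G | G n ∈ A n} = randomCubeSubgraph n (p n) (A n) := by
    intro n
    have h := Measure.infinitePi_map_eval (fun n => randomCubeSubgraph n (p n)) n
    rw [← h, Measure.map_apply (measurable_pi_apply n) .of_discrete]
    rfl
  have hsum : Summable fun n => (randomCubeSubgraph n (p n)).real (A n) := by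
    refine summable_of_isBigO_nat hb (IsBigO.of_bound 1 ?_)
    filter_upwards [hA] with n hn
    rw [one_mul, Real.norm_of_nonneg measureReal_nonneg]
    exact hn.trans (le_abs_self _)
  have h := measure_limsup_atTop_eq_zero (μ := randomCubeSubgraphs p)
    (s := fun n => {G | G n ∈ A n}) (by
      simp_rw [hmeas]
      have : ∀ n, randomCubeSubgraph n (p n) (A n) =
          ENNReal.ofReal ((randomCubeSubgraph n (p n)).real (A n)) := fun n => by
        rw [measureReal_def, ENNReal.ofReal_toReal (measure_ne_top _ _)]
      simp_rw [this]
      exact hsum.tsum_ofReal_ne_top)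
  rw [measure_eq_zero_iff_ae_notMem] at h
  filter_upwards [h] with G hG
  rw [mem_limsup_iff_frequently_mem, not_frequently] at hG
  exact hG

lemma pow_eq_exp_neg {q : ℝ} (hq : 0 < q) (k : ℕ) :
    q ^ k = Real.exp (-(k * Real.log q⁻¹)) := by
  rw [Real.log_inv, mul_neg, neg_neg, mul_comm, Real.exp_mul, Real.exp_log hq, Real.rpow_natCast]

lemma choose_mul_pow_le {n k : ℕ} (hn : n ≠ 0) (hk : k ≠ 0) {q : ℝ} (hq : 0 < q) :
    (n.choose k : ℝ) * q ^ k ≤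
      Real.exp (-(k * (Real.log q⁻¹ - 1 - Real.log (n / k)))) := by
  have hn' : (0 : ℝ) < n := by positivity
  have hk' : (0 : ℝ) < k := by positivity
  have h1 : (n.choose k : ℝ) ≤ Real.exp (k * (1 + Real.log (n / k))) := by
    calc (n.choose k : ℝ) ≤ (n : ℝ) ^ k / k.factorial := Nat.choose_le_pow_div k n
      _ = ((n : ℝ) / k) ^ k * ((k : ℝ) ^ k / k.factorial) := by
          rw [div_pow]; field_simp
      _ ≤ ((n : ℝ) / k) ^ k * Real.exp k := by
          gcongr
          exact Real.pow_div_factorial_le_exp _ hk'.le _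
      _ = _ := by
          rw [mul_add, mul_one, Real.exp_add, mul_comm, mul_comm (k : ℝ) (Real.log _), Real.exp_mul,
            Real.exp_log (by positivity), Real.rpow_natCast]
  rw [pow_eq_exp_neg hq]
  calc _ ≤ Real.exp (k * (1 + Real.log (n / k))) * Real.exp (-(k * Real.log q⁻¹)) := by gcongr
    _ = _ := by rw [← Real.exp_add]; ring_nf

variable {p : ℕ → I}

lemma eventually_pos_of_subexponential
    (h : ∀ γ : ℝ, 1 < γ → (fun n : ℕ => (γ ^ n)⁻¹) =o[atTop] (fun n => (p n : ℝ))) :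
    ∀ᶠ n in atTop, 0 < (p n : ℝ) := by
  filter_upwards [(h 2 (by norm_num)).bound (c := 1) (by norm_num)] with n hn
  rw [one_mul, Real.norm_of_nonneg (by positivity), Real.norm_of_nonneg (p n).2.1] at hn
  exact lt_of_lt_of_le (by positivity) hn

lemma eventually_log_inv_le_of_subexponential
    (h : ∀ γ : ℝ, 1 < γ → (fun n : ℕ => (γ ^ n)⁻¹) =o[atTop] (fun n => (p n : ℝ)))
    {δ : ℝ} (hδ : 0 < δ) : ∀ᶠ n in atTop, Real.log (p n : ℝ)⁻¹ ≤ δ * n := by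
  filter_upwards [(h (Real.exp δ) (Real.one_lt_exp_iff.2 hδ)).bound (c := 1) (by norm_num)]
    with n hn
  rw [one_mul, Real.norm_of_nonneg (by positivity), Real.norm_of_nonneg (p n).2.1] at hn
  have h1 := Real.log_le_log (by positivity) hn
  rw [Real.log_inv, Real.log_pow, Real.log_exp] at h1
  rw [Real.log_inv]
  linarith

/-- The form in which `p ≤ n ^ (-1 + o(1))` is used. The constant `17 / 16` is chosen
to go with the constants in `highDeg` and `highCount`. -/
lemma eventually_log_le_mul_log_inv
    (hp : ∃ ε : ℕ → ℝ, Tendsto ε atTop (𝓝 0) ∧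
      ∀ᶠ n : ℕ in atTop, (p n : ℝ) ≤ (n : ℝ) ^ (-1 + ε n))
    (hpos : ∀ᶠ n in atTop, 0 < (p n : ℝ)) :
    ∀ᶠ n : ℕ in atTop, Real.log n ≤ 17 / 16 * Real.log (p n : ℝ)⁻¹ := by
  obtain ⟨ε, hε, hpε⟩ := hp
  filter_upwards [hpε, hpos, hε.eventually (gt_mem_nhds (show (0 : ℝ) < 1 / 17 by norm_num)),
    eventually_ge_atTop 1] with n h1 h2 h3 hn
  have hn' : (1 : ℝ) ≤ n := by exact_mod_cast hn
  have h4 := Real.log_le_log h2 h1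
  rw [Real.log_rpow (by linarith)] at h4
  rw [Real.log_inv]
  nlinarith [Real.log_nonneg hn']

lemma tendsto_log_inv_atTop
    (hp : ∃ ε : ℕ → ℝ, Tendsto ε atTop (𝓝 0) ∧
      ∀ᶠ n : ℕ in atTop, (p n : ℝ) ≤ (n : ℝ) ^ (-1 + ε n))
    (hpos : ∀ᶠ n in atTop, 0 < (p n : ℝ)) :
    Tendsto (fun n => Real.log (p n : ℝ)⁻¹) atTop atTop := by
  have h1 : Tendsto (fun n : ℕ => Real.log n * (16 / 17)) atTop atTop :=
    (Real.tendsto_log_atTop.comp tendsto_natCast_atTop_atTop).atTop_mul_const (by norm_num)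
  refine tendsto_atTop_mono' _ ?_ h1
  filter_upwards [eventually_log_le_mul_log_inv hp hpos] with n hn
  linarith

/-- The asymptotic size of the maximum degree. -/
noncomputable def degScale (p : ℕ → I) (n : ℕ) : ℝ :=
  (n : ℝ) * Real.log 2 / Real.log (p n : ℝ)⁻¹

lemma tendsto_degScale
    (h : ∀ γ : ℝ, 1 < γ → (fun n : ℕ => (γ ^ n)⁻¹) =o[atTop] (fun n => (p n : ℝ)))
    (hL : Tendsto (fun n => Real.log (p n : ℝ)⁻¹) atTop atTop) :
    Tendsto (degScale p) atTop atTop := by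
  have hl2 : 0 < Real.log 2 := Real.log_pos (by norm_num)
  refine tendsto_atTop.2 fun b => ?_
  have hb : 0 < Real.log 2 / (|b| + 1) := by positivity
  filter_upwards [eventually_log_inv_le_of_subexponential h hb, hL.eventually_gt_atTop 0]
    with n h1 h2
  rw [degScale, le_div_iff₀ h2]
  have h3 : b ≤ |b| + 1 := by linarith [le_abs_self b]
  calc b * Real.log (p n : ℝ)⁻¹ ≤ (|b| + 1) * (Real.log 2 / (|b| + 1) * n) := by gcongr
    _ = n * Real.log 2 := by field_simp

lemma degScale_mul_log_inv {n : ℕ} (hL : 0 < Real.log (p n : ℝ)⁻¹) :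
    degScale p n * Real.log (p n : ℝ)⁻¹ = n * Real.log 2 := by
  rw [degScale, div_mul_cancel₀ _ hL.ne']

lemma exp_neg_mul_log_two (n : ℕ) (c : ℝ) :
    Real.exp (-(c * (n * Real.log 2))) = (Real.exp (-(c * Real.log 2))) ^ n := by
  rw [← Real.exp_nat_mul]; ring_nf

lemma two_pow_eq_exp (n : ℕ) : (2 : ℝ) ^ n = Real.exp (n * Real.log 2) := by
  rw [mul_comm, Real.exp_mul, Real.exp_log (by norm_num), Real.rpow_natCast]

lemma summable_exp_neg_mul {c : ℝ} (hc : 0 < c) :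
    Summable fun n : ℕ => Real.exp (-(c * (n * Real.log 2))) := by
  simp_rw [exp_neg_mul_log_two]
  refine summable_geometric_of_lt_one (Real.exp_pos _).le (Real.exp_lt_one_iff.2 ?_)
  have : 0 < Real.log 2 := Real.log_pos (by norm_num)
  nlinarith [mul_pos hc this]

/-- Eventually `log x` is dominated by any multiple of `x`. -/
lemma eventually_add_log_le {δ : ℝ} (hδ : 0 < δ) (c : ℝ) {x : ℕ → ℝ}
    (hx : Tendsto x atTop atTop) : ∀ᶠ n in atTop, c + Real.log (x n) ≤ δ * x n := by
  have h1 := hx.eventually (Real.isLittleO_log_id_atTop.bound (c := δ / 2) (by positivity))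
  filter_upwards [h1, hx.eventually_ge_atTop (2 * c / δ), hx.eventually_ge_atTop 0]
    with n h1 h2 h3
  rw [id, Real.norm_of_nonneg h3] at h1
  rw [div_le_iff₀ hδ] at h2
  linarith [le_abs_self (Real.log (x n)), Real.norm_eq_abs (Real.log (x n))]

/-- The factor `n.choose k` costs only `k * log (n / k)`, which is of smaller order than
`k * log p⁻¹` since `n / k` is at most of order `log p⁻¹`. -/
lemma eventually_real_degree_upper
    (h : ∀ γ : ℝ, 1 < γ → (fun n : ℕ => (γ ^ n)⁻¹) =o[atTop] (fun n => (p n : ℝ)))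
    (hL : Tendsto (fun n => Real.log (p n : ℝ)⁻¹) atTop atTop) {ε : ℝ} (hε : 0 < ε)
    (hε1 : ε ≤ 1) :
    ∀ᶠ n in atTop, (randomCubeSubgraph n (p n)).real
      {G | ∃ v, ⌈(1 + ε) * degScale p n⌉₊ ≤ (nb G v).card} ≤
      Real.exp (-(ε / 2 * (n * Real.log 2))) := by
  have hl2 : 0 < Real.log 2 := Real.log_pos (by norm_num)
  filter_upwards [eventually_pos_of_subexponential h, hL.eventually_gt_atTop 0,
    (tendsto_degScale h hL).eventually_ge_atTop 1, eventually_ge_atTop 1,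
    eventually_add_log_le (show 0 < ε / 4 by positivity) (1 - Real.log (Real.log 2)) hL]
    with n hp0 hL0 hd hn hlog
  set L := Real.log (p n : ℝ)⁻¹ with hLdef
  set d := degScale p n with hddef
  set k := ⌈(1 + ε) * d⌉₊ with hk
  have hkd : (1 + ε) * d ≤ k := Nat.le_ceil _
  have hdk : d ≤ k := by nlinarith
  have hk0 : 0 < (k : ℝ) := by linarith
  have hn0 : 0 < (n : ℝ) := by exact_mod_cast hn
  have hdL : d * L = n * Real.log 2 := degScale_mul_log_inv hL0
  have h1 : Real.log (n / k) ≤ Real.log L - Real.log (Real.log 2) := by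
    rw [← Real.log_div hL0.ne' hl2.ne']
    refine Real.log_le_log (by positivity) ?_
    rw [div_le_div_iff₀ hk0 hl2, ← hdL]
    nlinarith
  refine (randomCubeSubgraph_real_exists_degree_ge_le (p n) k).trans ?_
  calc _ ≤ 2 ^ n * Real.exp (-(k * (L - 1 - Real.log (n / k)))) := by
        gcongr
        exact choose_mul_pow_le (by omega) (by exact_mod_cast hk0.ne') hp0
    _ ≤ Real.exp (n * Real.log 2) * Real.exp (-((1 + ε) * (1 - ε / 4) * (n * Real.log 2))) := by
        rw [two_pow_eq_exp]
        refine mul_le_mul_of_nonneg_left (Real.exp_le_exp.2 (neg_le_neg ?_)) (Real.exp_pos _).le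
        have h2 : (1 - ε / 4) * L ≤ L - 1 - Real.log (n / k) := by linarith
        have h3 : 0 ≤ (1 - ε / 4) * L := mul_nonneg (by linarith) hL0.le
        calc (1 + ε) * (1 - ε / 4) * (n * Real.log 2) = ((1 + ε) * d) * ((1 - ε / 4) * L) := by
              rw [← hdL]; ring
          _ ≤ k * (L - 1 - Real.log (n / k)) := mul_le_mul hkd h2 h3 hk0.le
    _ ≤ _ := by
        rw [← Real.exp_add]
        gcongr
        have : 0 ≤ n * Real.log 2 := by positivity
        nlinarith [mul_nonneg (mul_nonneg hε.le (sub_nonneg.2 hε1)) this]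

lemma eventually_real_degree_lower
    (h : ∀ γ : ℝ, 1 < γ → (fun n : ℕ => (γ ^ n)⁻¹) =o[atTop] (fun n => (p n : ℝ)))
    (hL : Tendsto (fun n => Real.log (p n : ℝ)⁻¹) atTop atTop) {ε : ℝ} (hε : 0 < ε)
    (hε1 : ε ≤ 1) :
    ∀ᶠ n in atTop, (randomCubeSubgraph n (p n)).real
      {G | ∀ v, (nb G v).card < ⌊(1 - ε) * degScale p n⌋₊} ≤
      2 * Real.exp (-(ε * (n * Real.log 2))) := by
  have hl2 : 0 < Real.log 2 := Real.log_pos (by norm_num)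
  filter_upwards [eventually_pos_of_subexponential h, hL.eventually_ge_atTop (Real.log 2),
    (tendsto_degScale h hL).eventually_ge_atTop 1, eventually_ge_atTop 1]
    with n hp0 hL0 hd hn
  have hLpos := hl2.trans_le hL0
  set L := Real.log (p n : ℝ)⁻¹ with hLdef
  set d := degScale p n with hddef
  set k := ⌊(1 - ε) * d⌋₊ with hk
  have hn0 : 0 < (n : ℝ) := by exact_mod_cast hn
  have hdL : d * L = n * Real.log 2 := degScale_mul_log_inv hLpos
  have hkd : (k : ℝ) ≤ (1 - ε) * d := Nat.floor_le (mul_nonneg (by linarith) (by linarith))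
  have hdn : d ≤ n := by
    rw [hddef, degScale, div_le_iff₀ hLpos]
    gcongr
  have hkn : k ≤ n := by
    have : (k : ℝ) ≤ n := by nlinarith
    exact_mod_cast this
  refine (randomCubeSubgraph_real_forall_degree_lt_le (p n) hkn (by omega)).trans ?_
  have hpow : Real.exp (-((1 - ε) * (n * Real.log 2))) ≤ (p n : ℝ) ^ k := by
    rw [pow_eq_exp_neg hp0, ← hdL, ← mul_assoc]
    gcongr
  set y := Real.exp (ε * (n * Real.log 2)) with hy
  have hy0 : 0 < y := Real.exp_pos _
  have hx : y / 2 ≤ 2 ^ n / 2 * (p n : ℝ) ^ k := by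
    calc y / 2 = Real.exp (n * Real.log 2) / 2 * Real.exp (-((1 - ε) * (n * Real.log 2))) := by
          rw [div_mul_eq_mul_div, ← Real.exp_add]; ring_nf; rw [hy]; ring_nf
      _ ≤ _ := by rw [two_pow_eq_exp]; gcongr
  calc _ ≤ Real.exp (-(y / 2)) := by gcongr
    _ ≤ (y / 2)⁻¹ := by
        rw [Real.exp_neg]
        gcongr
        linarith [Real.add_one_le_exp (y / 2)]
    _ = _ := by rw [Real.exp_neg, ← hy]; field_simp

/-- The degree from which on a vertex counts as a vertex of high degree: it is of smaller order than
`√d`, where `d` is the degree scale, yet large enough to make such vertices rare. -/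
noncomputable def highDeg (p : ℕ → I) (n : ℕ) : ℕ := ⌈degScale p n ^ (1 / 3 : ℝ)⌉₊

/-- The number of vertices of high degree that may occur at distance two from a vertex. It is of
smaller order than the degree scale. -/
noncomputable def highCount (p : ℕ → I) (n : ℕ) : ℕ := ⌈16 * degScale p n / highDeg p n⌉₊

/-- It is unlikely that some vertex has many vertices of high degree at distance two: one such
vertex, together with its choice among `n ^ 2` candidates, costs `exp (-D * log p⁻¹ / 8)`, so
`16 * d / D` of them cost `2 ^ (-2 n)`. -/
lemma eventually_real_sphereTwo
    (hlogn : ∀ᶠ n : ℕ in atTop, Real.log n ≤ 17 / 16 * Real.log (p n : ℝ)⁻¹)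
    (h : ∀ γ : ℝ, 1 < γ → (fun n : ℕ => (γ ^ n)⁻¹) =o[atTop] (fun n => (p n : ℝ)))
    (hL : Tendsto (fun n => Real.log (p n : ℝ)⁻¹) atTop atTop) :
    ∀ᶠ n in atTop, (randomCubeSubgraph n (p n)).real
      {G | ∃ v, highCount p n ≤ ((sphereTwo v).filter fun w => highDeg p n ≤ (nb G w).card).card} ≤
      Real.exp (-(1 * (n * Real.log 2))) := by
  have hl2 : 0 < Real.log 2 := Real.log_pos (by norm_num)
  filter_upwards [eventually_pos_of_subexponential h, hL.eventually_ge_atTop 1, hlogn,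
    (tendsto_degScale h hL).eventually_ge_atTop (17 ^ 3), eventually_ge_atTop 1,
    eventually_add_log_le (show (0 : ℝ) < 1 / 8 by positivity) (3 - Real.log (Real.log 2)) hL]
    with n hp0 hL0 hnL hd hn hlog
  set L := Real.log (p n : ℝ)⁻¹ with hLdef
  set d := degScale p n with hddef
  set D := highDeg p n with hD
  set s := highCount p n with hs
  have hLpos : 0 < L := by linarith
  have hn0 : 0 < (n : ℝ) := by exact_mod_cast hn
  have hdL : d * L = n * Real.log 2 := degScale_mul_log_inv hLpos
  have hd0 : 0 < d := by linarith [show (0 : ℝ) < 17 ^ 3 by norm_num]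
  have hDd : d ^ (1 / 3 : ℝ) ≤ D := Nat.le_ceil _
  have hD17 : (17 : ℝ) ≤ D := by
    refine le_trans ?_ hDd
    calc (17 : ℝ) = ((17 : ℝ) ^ 3) ^ (1 / 3 : ℝ) := by
          rw [← Real.rpow_natCast, ← Real.rpow_mul (by norm_num)]; norm_num
      _ ≤ _ := Real.rpow_le_rpow (by norm_num) hd (by norm_num)
  have hD0 : 0 < (D : ℝ) := by linarith
  have hlogD : (1 / 3) * (Real.log n + Real.log (Real.log 2) - Real.log L) ≤ Real.log D := by
    have h1 := Real.log_le_log (Real.rpow_pos_of_pos hd0 _) hDd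
    rw [Real.log_rpow hd0] at h1
    have h2 : Real.log d = Real.log n + Real.log (Real.log 2) - Real.log L := by
      rw [hddef, degScale, Real.log_div (by positivity) hLpos.ne',
        Real.log_mul hn0.ne' hl2.ne']
    rwa [h2] at h1
  have hlognD : Real.log (n / D) = Real.log n - Real.log D := Real.log_div hn0.ne' hD0.ne'
  have hmain : (n : ℝ) ^ 2 * (n.choose D * (p n : ℝ) ^ D) ≤ Real.exp (-(D * L / 8)) := by
    calc _ ≤ Real.exp (2 * Real.log n) * Real.exp (-(D * (L - 1 - Real.log (n / D)))) := by
          have : (n : ℝ) ^ 2 = Real.exp (2 * Real.log n) := by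
            rw [mul_comm, Real.exp_mul, Real.exp_log hn0]; norm_num
          rw [this]
          gcongr
          exact choose_mul_pow_le (by omega) (by exact_mod_cast hD0.ne') hp0
      _ ≤ _ := by
          rw [← Real.exp_add]
          gcongr
          have h3 : L / 4 ≤ L - 1 - Real.log (n / D) := by
            rw [hlognD]; linarith
          have h4 : D * (L / 4) ≤ D * (L - 1 - Real.log (n / D)) := by gcongr
          have h5 : 17 * L ≤ D * L := by gcongr
          linarith
  have hsD : 16 * d ≤ s * D := by
    rw [← div_le_iff₀ hD0]
    exact Nat.le_ceil _
  refine (randomCubeSubgraph_real_exists_sphereTwo_le (p n) D s).trans ?_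
  calc _ ≤ 2 ^ n * Real.exp (-(D * L / 8)) ^ s := by
        have h0 : 0 ≤ (n : ℝ) ^ 2 * (n.choose D * (p n : ℝ) ^ D) := by
          have := (p n).2.1
          positivity
        gcongr
    _ ≤ _ := by
        rw [two_pow_eq_exp, ← Real.exp_nat_mul, ← Real.exp_add]
        gcongr
        have : 16 * d * (L / 8) ≤ s * D * (L / 8) := by gcongr
        nlinarith

/-- The deterministic part of the almost sure asymptotics, for one fixed sequence of graphs. -/
lemma isEquivalent_lambdaMax_of_eventually {lam d : ℕ → ℝ} {Δ D s : ℕ → ℕ}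
    (hd : Tendsto d atTop atTop)
    (hup : ∀ ε : ℝ, 0 < ε → ε ≤ 1 → ∀ᶠ n in atTop, Δ n < ⌈(1 + ε) * d n⌉₊)
    (hlow : ∀ ε : ℝ, 0 < ε → ε ≤ 1 → ∀ᶠ n in atTop, ⌊(1 - ε) * d n⌋₊ ≤ Δ n)
    (hD : Tendsto (fun n => (D n : ℝ) / √(d n)) atTop (𝓝 0))
    (hs : Tendsto (fun n => (s n : ℝ) / d n) atTop (𝓝 0))
    (hlam : ∀ᶠ n in atTop, √(Δ n : ℝ) ≤ lam n ∧
      lam n ≤ √((Δ n : ℝ) + 2 * s n) + √(3 * s n + 1) + D n) :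
    lam ~[atTop] (fun n => √(Δ n : ℝ)) ∧ (fun n => √(Δ n : ℝ)) ~[atTop] (fun n => √(d n)) := by
  have hratio : Tendsto (fun n => (Δ n : ℝ) / d n) atTop (𝓝 1) := by
    refine tendsto_order.2 ⟨fun a ha => ?_, fun a ha => ?_⟩
    · set ε := min ((1 - a) / 2) 1
      have hε : 0 < ε := lt_min (by linarith) one_pos
      have hε2 : ε ≤ (1 - a) / 2 := min_le_left _ _
      filter_upwards [hlow ε hε (min_le_right _ _), hd.eventually_gt_atTop 0,
        hd.eventually_gt_atTop (2 / (1 - a))] with n h1 h2 h3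
      rw [lt_div_iff₀ h2]
      have h4 := Nat.lt_floor_add_one ((1 - ε) * d n)
      have h5 : (⌊(1 - ε) * d n⌋₊ : ℝ) ≤ Δ n := by exact_mod_cast h1
      rw [div_lt_iff₀ (by linarith)] at h3
      nlinarith
    · set ε := min (a - 1) 1
      have hε : 0 < ε := lt_min (by linarith) one_pos
      have hε2 : ε ≤ a - 1 := min_le_left _ _
      filter_upwards [hup ε hε (min_le_right _ _), hd.eventually_gt_atTop 0] with n h1 h2
      rw [div_lt_iff₀ h2]
      have h5 : (Δ n : ℝ) < (1 + ε) * d n := Nat.lt_ceil.1 h1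
      nlinarith
  have hpos := hd.eventually_gt_atTop 0
  have hequiv : (fun n => √(Δ n : ℝ)) ~[atTop] (fun n => √(d n)) := by
    refine isEquivalent_of_tendsto_one ?_
    have := (Real.continuous_sqrt.tendsto 1).comp hratio
    rw [Real.sqrt_one] at this
    refine this.congr fun n => ?_
    simp [Real.sqrt_div (Nat.cast_nonneg (Δ n))]
  refine ⟨?_, hequiv⟩
  have hr : (fun n => √(2 * s n) + √(3 * s n + 1) + D n) =o[atTop] (fun n => √(d n)) := by
    rw [isLittleO_iff_tendsto' (by
      filter_upwards [hpos] with n hn h0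
      exact absurd h0 (Real.sqrt_pos.2 hn).ne')]
    have e1 : Tendsto (fun n => √(2 * ((s n : ℝ) / d n))) atTop (𝓝 0) := by
      have := (Real.continuous_sqrt.tendsto _).comp (hs.const_mul 2)
      rwa [mul_zero, Real.sqrt_zero] at this
    have e2 : Tendsto (fun n => √(3 * ((s n : ℝ) / d n) + (d n)⁻¹)) atTop (𝓝 0) := by
      have := (Real.continuous_sqrt.tendsto _).comp ((hs.const_mul 3).add hd.inv_tendsto_atTop)
      rwa [mul_zero, add_zero, Real.sqrt_zero] at this
    have e3 := (e1.add e2).add hD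
    simp only [add_zero] at e3
    refine e3.congr fun n => ?_
    rw [add_div, add_div, ← Real.sqrt_div (by positivity), ← Real.sqrt_div (by positivity)]
    congr 3 <;> ring_nf
  have hbound : (lam - fun n => √(Δ n : ℝ)) =O[atTop]
      (fun n => √(2 * s n) + √(3 * s n + 1) + D n) := by
    refine IsBigO.of_bound 1 ?_
    filter_upwards [hlam] with n hn
    have h1 : √((Δ n : ℝ) + 2 * s n) ≤ √(Δ n : ℝ) + √(2 * s n) := by
      refine Real.sqrt_le_iff.2 ⟨by positivity, ?_⟩
      have e1 := Real.sq_sqrt (show 0 ≤ (Δ n : ℝ) by positivity)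
      have e2 := Real.sq_sqrt (show 0 ≤ 2 * (s n : ℝ) by positivity)
      nlinarith [mul_nonneg (Real.sqrt_nonneg (Δ n : ℝ)) (Real.sqrt_nonneg (2 * (s n : ℝ)))]
    rw [Pi.sub_apply, one_mul, Real.norm_of_nonneg (by linarith [hn.1]),
      Real.norm_of_nonneg (by positivity)]
    linarith [hn.2]
  exact (hbound.trans_isLittleO hr).trans_isBigO hequiv.isBigO_symm

lemma tendsto_highDeg_div (hd : Tendsto (degScale p) atTop atTop) :
    Tendsto (fun n => (highDeg p n : ℝ) / √(degScale p n)) atTop (𝓝 0) := by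
  have h1 : Tendsto (fun n => degScale p n ^ (-(1 / 6) : ℝ) + degScale p n ^ (-(1 / 2) : ℝ)) atTop
      (𝓝 0) := by
    simpa using ((tendsto_rpow_neg_atTop (y := 1 / 6) (by norm_num)).comp hd).add
      ((tendsto_rpow_neg_atTop (y := 1 / 2) (by norm_num)).comp hd)
  refine squeeze_zero' (Eventually.of_forall fun n => by positivity) ?_ h1
  filter_upwards [hd.eventually_gt_atTop 0] with n hn
  rw [div_le_iff₀ (Real.sqrt_pos.2 hn), Real.sqrt_eq_rpow, add_mul, ← Real.rpow_add hn,
    ← Real.rpow_add hn]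
  norm_num
  exact (Nat.ceil_lt_add_one (by positivity)).le.trans (by norm_num)

lemma tendsto_highCount_div (hd : Tendsto (degScale p) atTop atTop) :
    Tendsto (fun n => (highCount p n : ℝ) / degScale p n) atTop (𝓝 0) := by
  have h1 : Tendsto (fun n => 16 * degScale p n ^ (-(1 / 3) : ℝ) + (degScale p n)⁻¹) atTop
      (𝓝 0) := by
    simpa using (((tendsto_rpow_neg_atTop (y := 1 / 3) (by norm_num)).comp hd).const_mul 16).add
      hd.inv_tendsto_atTop
  refine squeeze_zero' (by
    filter_upwards [hd.eventually_gt_atTop 0] with n hn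
    positivity) ?_ h1
  filter_upwards [hd.eventually_gt_atTop 0] with n hn
  have hD : degScale p n ^ (1 / 3 : ℝ) ≤ highDeg p n := Nat.le_ceil _
  have hD0 : 0 < degScale p n ^ (1 / 3 : ℝ) := by positivity
  rw [div_le_iff₀ hn, add_mul, inv_mul_cancel₀ hn.ne']
  refine (Nat.ceil_lt_add_one (by positivity)).le.trans ?_
  gcongr
  rw [Real.rpow_neg hn.le]
  calc 16 * degScale p n / highDeg p n ≤ 16 * degScale p n / degScale p n ^ (1 / 3 : ℝ) := by
        gcongr
    _ = _ := by ring

/-- Almost surely the largest eigenvalue, the square root of the maximum degree and the square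
root of the degree scale are equivalent. -/
theorem ae_isEquivalent_of_subexponential
    (hp : ∃ ε : ℕ → ℝ, Tendsto ε atTop (𝓝 0) ∧
      ∀ᶠ n : ℕ in atTop, (p n : ℝ) ≤ (n : ℝ) ^ (-1 + ε n))
    (h : ∀ γ : ℝ, 1 < γ → (fun n : ℕ => (γ ^ n)⁻¹) =o[atTop] (fun n => (p n : ℝ))) :
    ∀ᵐ G ∂(randomCubeSubgraphs p),
      ((fun n => lambdaMax (G n)) ~[atTop] (fun n => √(maxDeg (G n) : ℝ))) ∧
      ((fun n => √(maxDeg (G n) : ℝ)) ~[atTop] (fun n => √(degScale p n))) := by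
  have hpos := eventually_pos_of_subexponential h
  have hL := tendsto_log_inv_atTop hp hpos
  have hd := tendsto_degScale h hL
  have hsub : ∀ᵐ G ∂(randomCubeSubgraphs p), ∀ᶠ n in atTop, G n ∉ {G | ¬ G ≤ hypercube n} := by
    refine ae_eventually_notMem_of_summable p _ summable_zero (Eventually.of_forall fun n => ?_)
    exact le_of_eq (by
      rw [measureReal_def, ENNReal.toReal_eq_zero_iff]
      exact Or.inl (randomCubeSubgraph_ae_le n (p n)))
  -- countably many `ε = 1 / (j + 1)` suffice
  have hε : ∀ j : ℕ, 0 < 1 / ((j : ℝ) + 1) ∧ 1 / ((j : ℝ) + 1) ≤ 1 := fun j =>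
    ⟨by positivity, by rw [div_le_one (by positivity)]; linarith [Nat.cast_nonneg (α := ℝ) j]⟩
  have h1 := ae_all_iff.2 fun j : ℕ => ae_eventually_notMem_of_summable p _
    (summable_exp_neg_mul (half_pos (hε j).1))
    (eventually_real_degree_upper h hL (hε j).1 (hε j).2)
  have h2 := ae_all_iff.2 fun j : ℕ => ae_eventually_notMem_of_summable p _
    ((summable_exp_neg_mul (hε j).1).mul_left 2)
    (eventually_real_degree_lower h hL (hε j).1 (hε j).2)
  have h3 := ae_eventually_notMem_of_summable p _ (summable_exp_neg_mul one_pos)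
    (eventually_real_sphereTwo (eventually_log_le_mul_log_inv hp hpos) h hL)
  filter_upwards [hsub, h1, h2, h3] with G hG g1 g2 g3
  refine isEquivalent_lambdaMax_of_eventually (D := highDeg p) (s := highCount p) hd ?_ ?_
    (tendsto_highDeg_div hd) (tendsto_highCount_div hd) ?_
  · intro ε hε0 _
    obtain ⟨j, hj⟩ := exists_nat_one_div_lt hε0
    filter_upwards [g1 j, hd.eventually_gt_atTop 0] with n hn hdn
    obtain ⟨v, hv⟩ := exists_card_nb_eq_maxDeg (G n)
    rw [← hv]
    have : (nb (G n) v).card < ⌈(1 + 1 / ((j : ℝ) + 1)) * degScale p n⌉₊ := by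
      by_contra! hc
      exact hn ⟨v, hc⟩
    exact this.trans_le (Nat.ceil_le_ceil (by gcongr))
  · intro ε hε0 _
    obtain ⟨j, hj⟩ := exists_nat_one_div_lt hε0
    filter_upwards [g2 j, hd.eventually_gt_atTop 0] with n hn hdn
    obtain ⟨v, hv⟩ : ∃ v, ⌊(1 - 1 / ((j : ℝ) + 1)) * degScale p n⌋₊ ≤ (nb (G n) v).card := by
      by_contra! hc
      exact hn hc
    refine (Nat.floor_le_floor ?_).trans (hv.trans (card_nb_le_maxDeg _ _))
    gcongr
  · filter_upwards [hG, g3] with n hn h3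
    refine ⟨sqrt_maxDeg_le_lambdaMax _, lambdaMax_le_of_sphereTwo (not_not.1 hn) fun v => ?_⟩
    by_contra! hc
    exact h3 ⟨v, hc.le⟩

end Subexponential

/-! ### The regime of subexponentially small probabilities: many large eigenvalues -/

section ManyEigenvalues

variable {n : ℕ}

/-- The subcube of the vertices that agree with `y` on the coordinates in `S`. -/
def agreeOn (S : Finset (Fin n)) (y : Fin n → Bool) : Finset (Fin n → Bool) :=
  Finset.univ.filter fun v => ∀ i ∈ S, v i = y i

lemma mem_agreeOn {S : Finset (Fin n)} {y v : Fin n → Bool} :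
    v ∈ agreeOn S y ↔ ∀ i ∈ S, v i = y i := by
  simp [agreeOn]

lemma card_agreeOn (S : Finset (Fin n)) (y : Fin n → Bool) :
    (agreeOn S y).card = 2 ^ (n - S.card) := by
  have : agreeOn S y = Fintype.piFinset fun i => if i ∈ S then {y i} else Finset.univ := by
    ext v
    rw [mem_agreeOn, Fintype.mem_piFinset]
    refine forall_congr' fun i => ?_
    split_ifs with h <;> simp [h]
  rw [this, Fintype.card_piFinset]
  have h1 : ∀ i, (if i ∈ S then ({y i} : Finset Bool) else Finset.univ).card =
      if i ∈ S then 1 else 2 := by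
    intro i; split_ifs <;> simp
  simp_rw [h1]
  rw [Finset.prod_ite]
  simp only [Finset.prod_const, one_pow, one_mul]
  congr 1
  rw [Finset.filter_not, Finset.card_sdiff_of_subset (Finset.filter_subset _ _)]
  simp

open Classical in
lemma two_mul_card_even_agreeOn {S : Finset (Fin n)} (y : Fin n → Bool) {i : Fin n} (hi : i ∉ S) :
    2 * ((agreeOn S y).filter IsEven).card = 2 ^ (n - S.card) := by
  rw [card_filter_isEven _ i, card_agreeOn]
  intro v hv
  rw [mem_agreeOn] at hv ⊢
  intro j hj
  rw [flipAt_of_ne _ (fun h : j = i => hi (h ▸ hj)), hv j hj]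

/-- The vertex `v` is the centre of a star in the first `k` directions. -/
def HasFirstStar (G : SimpleGraph (Fin n → Bool)) (k : ℕ) (v : Fin n → Bool) : Prop :=
  firstDirs n k ⊆ dirs G v

/-- Subcubes in the first `m` directions are labelled by vertices that vanish in these directions.
Two even labels differ in at least two coordinates, so no edge joins their subcubes, and stars found
in different such subcubes contribute separate eigenvalues. -/
lemma card_good_le_card_adjEigenvalues {G : SimpleGraph (Fin n → Bool)} (hG : G ≤ hypercube n)
    {k m : ℕ} (hk : k ≠ 0) (hkm : k ≤ m) (hmn : m ≤ n) {c : ℝ} (hc : c ≤ √(k : ℝ))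
    (Y : Finset (Fin n → Bool)) (hYev : ∀ y ∈ Y, IsEven y)
    (hY0 : ∀ y ∈ Y, ∀ i ∈ firstDirs n m, y i = false)
    (hstar : ∀ y ∈ Y, ∃ v ∈ agreeOn (firstDirs n m)ᶜ y, HasFirstStar G k v) :
    Y.card ≤ Nat.card {v // c ≤ adjEigenvalues G v} := by
  classical
  choose! f hf hfs using hstar
  let N : (Fin n → Bool) → Finset (Fin n → Bool) := fun y =>
    (firstDirs n k).image (flipAt (f y))
  have hNcard : ∀ y, (N y).card = k := fun y => by
    rw [Finset.card_image_of_injective _ (flipAt_right_injective _), card_firstDirs (hkm.trans hmn)]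
  have hNsub : ∀ y ∈ Y, N y ⊆ nb G (f y) := fun y hy => by
    rw [nb_eq_image_dirs hG]
    exact Finset.image_subset_image (hfs y hy)
  -- the star of label `y` stays in the subcube of label `y`
  have hlab : ∀ y ∈ Y, ∀ u, starVector (f y) (N y) u ≠ 0 → ∀ i ∉ firstDirs n m, u i = y i := by
    intro y hy u hu i hi
    have h1 : f y i = y i := mem_agreeOn.1 (hf y hy) i (by simpa using hi)
    rcases starVector_ne_zero hu with rfl | h
    · exact h1
    · obtain ⟨j, hj, rfl⟩ := Finset.mem_image.1 h
      rw [flipAt_of_ne, h1]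
      rintro rfl
      exact hi (by simp only [firstDirs, Finset.mem_filter, Finset.mem_univ, true_and] at hj ⊢
                   omega)
  refine card_le_card_adjEigenvalues_ge G Y (fun y => starVector (f y) (N y)) c ?_ ?_ ?_ ?_
  · intro y _
    refine ⟨f y, ?_⟩
    simp [starVector, hNcard, hk]
  · intro y hy y' hy' hne u hu
    by_contra hu'
    refine hne (funext fun i => ?_)
    by_cases hi : i ∈ firstDirs n m
    · rw [hY0 y hy i hi, hY0 y' hy' i hi]
    · rw [← hlab y hy u hu i hi, hlab y' hy' u hu' i hi]
  · intro y hy y' hy' hne u w hu hw hadj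
    obtain ⟨i, rfl⟩ := hypercube_adj_iff.1 (hG hadj)
    by_cases hi : i ∈ firstDirs n m
    · refine hne (funext fun j => ?_)
      by_cases hj : j ∈ firstDirs n m
      · rw [hY0 y hy j hj, hY0 y' hy' j hj]
      · rw [← hlab y hy u hu j hj, ← hlab y' hy' _ hw j hj, flipAt_of_ne]
        rintro rfl
        exact hj hi
    · have : y' = flipAt y i := by
        ext j
        by_cases hj : j = i
        · subst hj
          rw [← hlab y' hy' _ hw j hi, flipAt_same, flipAt_same, hlab y hy u hu j hi]
        · rw [flipAt_of_ne _ hj]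
          by_cases hjm : j ∈ firstDirs n m
          · rw [hY0 y hy j hjm, hY0 y' hy' j hjm]
          · rw [← hlab y hy u hu j hjm, ← hlab y' hy' _ hw j hjm, flipAt_of_ne _ hj]
      have h1 := isEven_flipAt y i
      rw [← this] at h1
      exact h1.1 (hYev y' hy') (hYev y hy)
  · intro y hy
    have h1 := sqrt_card_mul_le_form_starVector G (f y) (hNsub y hy)
    rw [hNcard] at h1
    exact (mul_le_mul_of_nonneg_right hc (Finset.sum_nonneg fun _ _ => sq_nonneg _)).trans h1

/-- Few large eigenvalues force half of the `2 ^ (a - 1)` even labels to be bad, that is, to have no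
star at an even vertex of their subcube; there are at most `2 ^ 2 ^ (a - 1)` choices of the bad labels,
and the `2 ^ (m - 1)` even vertices of each subcube are independent, where `m = n - a`. -/
lemma randomCubeSubgraph_real_few_eigenvalues_le (p : I) {k a : ℕ} (hk : k ≠ 0) (ha : 2 ≤ a)
    (hka : k + a ≤ n) {c : ℝ} (hc : c ≤ √(k : ℝ)) :
    (randomCubeSubgraph n p).real
      {G | (2 : ℝ) ^ a / (2 * (n : ℝ) ^ 2) ≤ (Nat.card {v // c ≤ adjEigenvalues G v} : ℝ)}ᶜ ≤
      2 ^ (2 ^ (a - 1)) * Real.exp (-(2 ^ (a - 2) * (2 ^ (n - a) / 2) * (p : ℝ) ^ k)) := by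
  classical
  obtain ⟨m, hm⟩ : ∃ m, n = m + a := ⟨n - a, by omega⟩
  have hmn : m ≤ n := by omega
  have hkm : k ≤ m := by omega
  have hna : n - a = m := by omega
  rw [hna]
  set Y := (agreeOn (firstDirs n m) (fun _ => false)).filter IsEven with hY
  have hYcard : Y.card = 2 ^ (a - 1) := by
    have h := two_mul_card_even_agreeOn (S := firstDirs n m) (fun _ => false)
      (i := ⟨m, by omega⟩) (by simp [firstDirs])
    rw [card_firstDirs hmn, ← hY, show n - m = (a - 1) + 1 by omega, pow_succ] at h
    omega
  have hXcard : ∀ y, (((agreeOn (firstDirs n m)ᶜ y).filter IsEven).card : ℝ) = 2 ^ m / 2 := by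
    intro y
    have h := two_mul_card_even_agreeOn (S := (firstDirs n m)ᶜ) y (i := ⟨0, by omega⟩)
      (by simp [firstDirs]; omega)
    rw [Finset.card_compl, card_firstDirs hmn, Fintype.card_fin, show n - (n - m) = m by omega] at h
    have : (2 : ℝ) * (((agreeOn (firstDirs n m)ᶜ y).filter IsEven).card : ℝ) = 2 ^ m := by
      exact_mod_cast h
    linarith
  let X : Finset (Fin n → Bool) → Finset (Fin n → Bool) := fun T =>
    T.biUnion fun y => (agreeOn (firstDirs n m)ᶜ y).filter IsEven
  have hXX : ∀ T ⊆ Y, T.card = 2 ^ (a - 2) → ((X T).card : ℝ) = 2 ^ (a - 2) * (2 ^ m / 2) := by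
    intro T hT hTc
    rw [Finset.card_biUnion, Nat.cast_sum, Finset.sum_congr rfl fun y _ => hXcard y,
      Finset.sum_const, hTc, nsmul_eq_mul]
    · push_cast; ring
    · intro y hy y' hy' hne
      refine Finset.disjoint_left.2 fun v hv hv' => hne (funext fun i => ?_)
      have h1 := mem_agreeOn.1 (Finset.mem_filter.1 (hT hy)).1
      have h2 := mem_agreeOn.1 (Finset.mem_filter.1 (hT hy')).1
      have h3 := mem_agreeOn.1 (Finset.mem_filter.1 hv).1
      have h4 := mem_agreeOn.1 (Finset.mem_filter.1 hv').1
      by_cases hi : i ∈ firstDirs n m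
      · rw [h1 i hi, h2 i hi]
      · rw [← h3 i (by simpa using hi), ← h4 i (by simpa using hi)]
  calc _ ≤ (randomCubeSubgraph n p).real (⋃ T ∈ Finset.powersetCard (2 ^ (a - 2)) Y,
        {G | ∀ v ∈ X T, ¬ firstDirs n k ⊆ dirs G v}) := by
        refine randomCubeSubgraph_real_mono p fun G hG hfew => ?_
        set good := Y.filter fun y =>
          ∃ v ∈ (agreeOn (firstDirs n m)ᶜ y).filter IsEven, HasFirstStar G k v with hgood
        have h1 := card_good_le_card_adjEigenvalues hG hk hkm hmn hc good
          (fun y hy => (Finset.mem_filter.1 (Finset.mem_filter.1 hy).1).2)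
          (fun y hy => mem_agreeOn.1 (Finset.mem_filter.1 (Finset.mem_filter.1 hy).1).1)
          (fun y hy => by
            obtain ⟨v, hv, hvs⟩ := (Finset.mem_filter.1 hy).2
            exact ⟨v, (Finset.mem_filter.1 hv).1, hvs⟩)
        have h2 : (good.card : ℝ) < 2 ^ (a - 2) := by
          have h3 : (good.card : ℝ) < (2 : ℝ) ^ a / (2 * (n : ℝ) ^ 2) :=
            lt_of_le_of_lt (by exact_mod_cast h1) (not_le.1 hfew)
          refine h3.trans_le ?_
          have hn2 : (2 : ℝ) ≤ n := by exact_mod_cast (by omega : 2 ≤ n)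
          rw [div_le_iff₀ (by positivity)]
          have : (2 : ℝ) ^ a = 2 ^ (a - 2) * 4 := by
            rw [show (4 : ℝ) = 2 ^ 2 by norm_num, ← pow_add]; congr 1; omega
          rw [this]
          gcongr
          nlinarith
        have h2' : good.card < 2 ^ (a - 2) := by exact_mod_cast h2
        have h4 : 2 ^ (a - 2) ≤ (Y \ good).card := by
          have hc : (Y \ good).card = Y.card - good.card :=
            Finset.card_sdiff_of_subset (Finset.filter_subset _ _)
          rw [hc, hYcard]
          have : 2 ^ (a - 1) = 2 * 2 ^ (a - 2) := by
            rw [← pow_succ']; congr 1; omega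
          omega
        obtain ⟨T, hT, hTc⟩ := Finset.exists_subset_card_eq h4
        simp only [Set.mem_iUnion]
        refine ⟨T, Finset.mem_powersetCard.2 ⟨hT.trans Finset.sdiff_subset, hTc⟩, ?_⟩
        intro v hv hs
        obtain ⟨y, hy, hvy⟩ := Finset.mem_biUnion.1 hv
        have h5 := Finset.mem_sdiff.1 (hT hy)
        exact h5.2 (Finset.mem_filter.2 ⟨h5.1, v, hvy, hs⟩)
    _ ≤ ∑ T ∈ Finset.powersetCard (2 ^ (a - 2)) Y,
        Real.exp (-(2 ^ (a - 2) * (2 ^ m / 2) * (p : ℝ) ^ k)) := by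
        refine (measureReal_biUnion_finset_le _ _).trans (Finset.sum_le_sum fun T hT => ?_)
        rw [Finset.mem_powersetCard] at hT
        rw [← hXX T hT.1 hT.2]
        refine randomCubeSubgraph_real_forall_not_firstDirs_le p (fun v hv => ?_) (hkm.trans hmn)
        obtain ⟨y, -, hvy⟩ := Finset.mem_biUnion.1 hv
        exact (Finset.mem_filter.1 hvy).2
    _ ≤ _ := by
        rw [Finset.sum_const, nsmul_eq_mul]
        gcongr
        have h := Finset.card_le_card (t := Y.powerset) (fun T hT =>
          Finset.mem_powerset.2 (Finset.mem_powersetCard (n := 2 ^ (a - 2)).1 hT).1)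
        rw [Finset.card_powerset, hYcard] at h
        exact_mod_cast h

/-- The number of choices of bad labels is absorbed by the probability that all of them are bad, and
what remains is smaller than the error term `exp (-(2 q log q⁻¹)⁻²)`. -/
lemma two_pow_mul_exp_le {q : ℝ} {a m k : ℕ} (hp0 : 0 < q) (ha7 : 7 ≤ a)
    (hL0 : 2 ≤ Real.log q⁻¹) (hpk : q⁻¹ ≤ 2 ^ m * q ^ k)
    (hLa : 2 * Real.log q⁻¹ ≤ (a - 3) * Real.log 2) :
    (2 : ℝ) ^ (2 ^ (a - 1)) * Real.exp (-(2 ^ (a - 2) * (2 ^ m / 2) * q ^ k)) ≤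
      Real.exp (-((2 * q * Real.log q⁻¹) ^ 2)⁻¹) := by
  set L := Real.log q⁻¹ with hLdef
  have hpinv4 : 4 ≤ q⁻¹ := by
    have h1 := Real.add_one_le_exp L
    rw [hLdef, Real.exp_log (by positivity)] at h1
    rw [← hLdef] at h1
    have h2 : Real.exp 2 ≤ q⁻¹ := by
      rw [← Real.exp_log (show 0 < q⁻¹ by positivity)]
      gcongr
    have h3 : (4 : ℝ) ≤ Real.exp 2 := by
      have := Real.exp_one_gt_d9
      rw [show (2 : ℝ) = 1 + 1 by norm_num, Real.exp_add]
      nlinarith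
    linarith
  set M : ℝ := 2 ^ (a - 3) with hM
  have hM0 : 0 < M := by positivity
  have e1 : (2 : ℝ) ^ (a - 2) = 2 * M := by rw [hM, ← pow_succ']; congr 1; omega
  have e2 : (2 : ℝ) ^ (a - 1) = 4 * M := by
    rw [hM, show (4 : ℝ) = 2 ^ 2 by norm_num, ← pow_add]; congr 1; omega
  have hleft : (2 : ℝ) ^ (2 ^ (a - 1)) *
      Real.exp (-(2 ^ (a - 2) * (2 ^ (m) / 2) * q ^ k)) ≤ Real.exp (-M) := by
    rw [two_pow_eq_exp, ← Real.exp_add]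
    gcongr
    push_cast
    rw [e1, e2]
    have h3 : Real.log 2 ≤ 0.7 := by linarith [Real.log_two_lt_d9]
    have h4 : M * 4 ≤ M * (2 ^ (m) * q ^ k) := by
      gcongr
      exact hpinv4.trans hpk
    nlinarith
  have hright : ((2 * q * L) ^ 2)⁻¹ ≤ M := by
    have h1 : ((2 * q * L) ^ 2)⁻¹ ≤ (q ^ 2)⁻¹ := by
      gcongr
      nlinarith
    have h2 : (q ^ 2)⁻¹ = Real.exp (2 * L) := by
      rw [← inv_pow, mul_comm, Real.exp_mul, hLdef, Real.exp_log (by positivity)]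
      norm_num
    have h3 : M = Real.exp ((a - 3) * Real.log 2) := by
      rw [hM, two_pow_eq_exp, Nat.cast_sub (by omega)]
      norm_num
    rw [h2] at h1
    refine h1.trans ?_
    rw [h3]
    gcongr
  exact hleft.trans (Real.exp_le_exp.2 (neg_le_neg hright))

variable {p : ℕ → I}

/-- With `k = ⌈Z - 2⌉`, where `Z - 2` is the expression under the root, a subcube with `n - ⌊α n⌋`
free directions has many centres of stars with `k` leaves on average. -/
theorem eventually_many_eigenvalues
    (hp : ∃ ε : ℕ → ℝ, Tendsto ε atTop (𝓝 0) ∧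
      ∀ᶠ n : ℕ in atTop, (p n : ℝ) ≤ (n : ℝ) ^ (-1 + ε n))
    (h : ∀ γ : ℝ, 1 < γ → (fun n : ℕ => (γ ^ n)⁻¹) =o[atTop] (fun n => (p n : ℝ)))
    {α : ℝ} (hα : 0 < α) (hα1 : α < 1) :
    ∀ᶠ n : ℕ in atTop,
        1 - (2 : ℝ) ^ (α * (n : ℝ)) *
            Real.exp (-((2 * (p n : ℝ) * Real.log (p n : ℝ)⁻¹) ^ 2)⁻¹) ≤
          (randomCubeSubgraph n (p n)).real
            {G | (2 : ℝ) ^ ⌊α * (n : ℝ)⌋₊ / (2 * (n : ℝ) ^ 2) ≤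
              (Nat.card {v // √((1 - α) * (n : ℝ) * Real.log 2 *
                    (1 - 1 / Real.log (Real.log (p n : ℝ)⁻¹)) / Real.log (p n : ℝ)⁻¹ - 2) ≤
                  adjEigenvalues G v} : ℝ)} := by
  have hl2 : 0 < Real.log 2 := Real.log_pos (by norm_num)
  have hl21 : Real.log 2 < 1 := by
    rw [← Real.log_exp 1]
    exact Real.log_lt_log (by norm_num) (by linarith [Real.exp_one_gt_d9])
  have hpos := eventually_pos_of_subexponential h
  have hL := tendsto_log_inv_atTop hp hpos
  have hd := tendsto_degScale h hL
  filter_upwards [hpos, hL.eventually_ge_atTop 2,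
    (Real.tendsto_log_atTop.comp hL).eventually_ge_atTop 2,
    hd.eventually_ge_atTop (6 / (1 - α)),
    eventually_log_inv_le_of_subexponential h (show 0 < α * Real.log 2 / 4 by positivity),
    eventually_ge_atTop 2, (tendsto_natCast_atTop_atTop (R := ℝ)).eventually_ge_atTop (8 / α)]
    with n hp0 hL0 hLL hdn hLn hn hn8
  set L := Real.log (p n : ℝ)⁻¹ with hLdef
  set d := degScale p n with hddef
  rw [Function.comp] at hLL
  have hLpos : 0 < L := by linarith
  have hn0 : (0 : ℝ) < n := by positivity
  have hα' : 0 < 1 - α := by linarith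
  have hdL : d * L = n * Real.log 2 := degScale_mul_log_inv hLpos
  set δ := 1 / Real.log L with hδ
  have hδ0 : 0 < δ := by positivity
  have hδ1 : δ ≤ 1 / 2 := by
    rw [hδ]; exact one_div_le_one_div_of_le (by norm_num) hLL
  set Z := (1 - α) * (n : ℝ) * Real.log 2 * (1 - δ) / L with hZ
  have hZd : Z = (1 - α) * (1 - δ) * d := by
    rw [hZ, hddef, degScale]; ring
  have hZL : Z * L ≤ (1 - α) * (n * Real.log 2) := by
    rw [hZd, mul_assoc, hdL]
    have : 0 ≤ (1 - α) * (n * Real.log 2) := by positivity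
    nlinarith
  have hZ3 : 3 ≤ Z := by
    rw [hZd]
    rw [div_le_iff₀ hα'] at hdn
    nlinarith
  set k := ⌈Z - 2⌉₊ with hk
  have hkZ : Z - 2 ≤ k := Nat.le_ceil _
  have hkZ' : (k : ℝ) ≤ Z - 1 := by
    have := Nat.ceil_lt_add_one (show 0 ≤ Z - 2 by linarith)
    linarith
  set a := ⌊α * (n : ℝ)⌋₊ with ha
  have haα : (a : ℝ) ≤ α * n := Nat.floor_le (by positivity)
  have haα' : α * n < a + 1 := Nat.lt_floor_add_one _
  have h8 : 8 ≤ α * n := by rwa [div_le_iff₀ hα, mul_comm] at hn8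
  have ha7 : 7 ≤ a := by
    have : (7 : ℝ) < a + 1 := by linarith
    have : (7 : ℝ) < ((a + 1 : ℕ) : ℝ) := by push_cast; exact this
    have := Nat.cast_lt.1 (by exact_mod_cast this : ((7 : ℕ) : ℝ) < ((a + 1 : ℕ) : ℝ))
    omega
  have hk0 : k ≠ 0 := by
    have : (0 : ℝ) < k := by linarith
    exact_mod_cast this.ne'
  have hZn : Z ≤ (1 - α) * n := by
    have h1 : Z * 1 ≤ Z * L := by gcongr; linarith
    have h2 : (1 - α) * (n * Real.log 2) ≤ (1 - α) * n := by
      gcongr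
      nlinarith
    linarith
  have hkan : k + a ≤ n := by
    have : ((k + a : ℕ) : ℝ) ≤ n := by push_cast; linarith
    exact_mod_cast this
  have hmain := randomCubeSubgraph_real_few_eigenvalues_le (p n) hk0 (by omega) hkan
    (Real.sqrt_le_sqrt hkZ)
  rw [probReal_compl_eq_one_sub .of_discrete] at hmain
  suffices hs : (2 : ℝ) ^ (2 ^ (a - 1)) *
      Real.exp (-(2 ^ (a - 2) * (2 ^ (n - a) / 2) * (p n : ℝ) ^ k)) ≤
      (2 : ℝ) ^ (α * (n : ℝ)) * Real.exp (-((2 * (p n : ℝ) * L) ^ 2)⁻¹) by linarith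
  -- each subcube is expected to contain at least `1 / (2 p)` stars
  have hpk : (p n : ℝ)⁻¹ ≤ 2 ^ (n - a) * (p n : ℝ) ^ k := by
    have hpinv : (p n : ℝ)⁻¹ = Real.exp L := (Real.exp_log (by positivity)).symm
    rw [hpinv, two_pow_eq_exp, pow_eq_exp_neg hp0, ← Real.exp_add, Nat.cast_sub (by omega)]
    gcongr
    rw [← hLdef]
    have h1 : k * L ≤ (Z - 1) * L := by gcongr
    have h2 : (1 - α) * n * Real.log 2 ≤ (n - a) * Real.log 2 := by
      gcongr; linarith
    linarith
  have hLa : 2 * L ≤ (a - 3) * Real.log 2 := by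
    have h5 : 2 * L ≤ (α * n / 2) * Real.log 2 := by linarith
    have h6 : (α * n / 2) * Real.log 2 ≤ (a - 3) * Real.log 2 := by
      gcongr; linarith
    linarith
  refine (two_pow_mul_exp_le hp0 ha7 hL0 hpk hLa).trans ?_
  exact le_mul_of_one_le_left (Real.exp_pos _).le (Real.one_le_rpow (by norm_num) (by positivity))

end ManyEigenvalues

/-! ### Small components -/

section Components

variable {n : ℕ}

open Classical in
/-- The explorations with `j` edges from `v`: pairs of a set of vertices reached from `v` and the set
of the `j` edges used, where each step adds a new edge of the cube at a vertex already reached. -/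
noncomputable def explorations (v : Fin n → Bool) :
    ℕ → Finset (Finset (Fin n → Bool) × Finset (Sym2 (Fin n → Bool)))
  | 0 => {({v}, ∅)}
  | j + 1 => (explorations v j).biUnion fun q =>
      ((q.1 ×ˢ Finset.univ).filter fun r : (Fin n → Bool) × Fin n => cubeEdge r.1 r.2 ∉ q.2).image
        fun r => (insert (flipAt r.1 r.2) q.1, insert (cubeEdge r.1 r.2) q.2)

lemma mem_explorations_succ {v : Fin n → Bool} {j : ℕ}
    {q : Finset (Fin n → Bool) × Finset (Sym2 (Fin n → Bool))} :
    q ∈ explorations v (j + 1) ↔ ∃ r ∈ explorations v j, ∃ u ∈ r.1, ∃ i, cubeEdge u i ∉ r.2 ∧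
      (insert (flipAt u i) r.1, insert (cubeEdge u i) r.2) = q := by
  classical
  simp only [explorations, Finset.mem_biUnion, Finset.mem_image, Finset.mem_filter,
    Finset.mem_product, Finset.mem_univ, and_true, Prod.exists]
  constructor
  · rintro ⟨C, F, hr, u, i, ⟨hu, hi⟩, he⟩
    exact ⟨C, F, hr, u, hu, i, hi, by convert he⟩
  · rintro ⟨C, F, hr, u, hu, i, hi, he⟩
    exact ⟨C, F, hr, u, i, ⟨hu, hi⟩, by convert he⟩

lemma explorations_spec (v : Fin n → Bool) (j : ℕ) :
    ∀ q ∈ explorations v j, v ∈ q.1 ∧ q.1.card ≤ j + 1 ∧ q.2.card = j ∧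
      (q.2 : Set _) ⊆ (hypercube n).edgeSet ∧ ∀ u w, s(u, w) ∈ q.2 → u ∈ q.1 ∧ w ∈ q.1 := by
  induction j with
  | zero => intro q hq; simp [explorations] at hq; subst hq; simp
  | succ j ih =>
    intro q hq
    obtain ⟨r, hr, u, hu, i, hi, rfl⟩ := mem_explorations_succ.1 hq
    obtain ⟨h1, h2, h3, h4, h5⟩ := ih r hr
    refine ⟨by simp [h1], (Finset.card_insert_le _ _).trans (by simpa using h2),
      by simp [Finset.card_insert_of_notMem hi, h3], ?_, ?_⟩
    · rw [Finset.coe_insert]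
      exact Set.insert_subset (cubeEdge_mem u i) h4
    · intro a b hab
      rcases Finset.mem_insert.1 hab with h | h
      · rcases Sym2.eq_iff.1 h with ⟨rfl, rfl⟩ | ⟨rfl, rfl⟩ <;> simp [hu]
      · have := h5 a b h
        simp [this.1, this.2]

lemma card_explorations_le (v : Fin n → Bool) (j : ℕ) :
    (explorations v j).card ≤ j.factorial * n ^ j := by
  classical
  induction j with
  | zero => simp [explorations]
  | succ j ih =>
    rw [explorations]
    refine (Finset.card_biUnion_le_card_mul _ _ ((j + 1) * n) fun q hq => ?_).trans ?_
    · refine Finset.card_image_le.trans ((Finset.card_filter_le _ _).trans ?_)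
      rw [Finset.card_product, Finset.card_univ, Fintype.card_fin]
      exact Nat.mul_le_mul_right _ (explorations_spec v j q hq).2.1
    · calc _ ≤ (j.factorial * n ^ j) * ((j + 1) * n) := Nat.mul_le_mul_right _ ih
        _ = _ := by rw [Nat.factorial_succ]; ring

/-- If no exploration of `G` from `v` reaches `k + 1` edges, the component of `v` is contained in a
set that is closed under adjacency and spans at most `k` edges. -/
lemma exists_closed_of_no_exploration {G : SimpleGraph (Fin n → Bool)} (hG : G ≤ hypercube n)
    {k : ℕ} (v : Fin n → Bool)
    (hk : ¬ ∃ q ∈ explorations v (k + 1), (q.2 : Set _) ⊆ G.edgeSet) :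
    ∃ C : Finset (Fin n → Bool), ∃ F : Finset (Sym2 (Fin n → Bool)), v ∈ C ∧ F.card ≤ k ∧
      ∀ u ∈ C, ∀ w, G.Adj u w → w ∈ C ∧ s(u, w) ∈ F := by
  have key : ∀ j, (∃ q ∈ explorations v j, (q.2 : Set _) ⊆ G.edgeSet) ∨
      ∃ C : Finset (Fin n → Bool), ∃ F : Finset (Sym2 (Fin n → Bool)), v ∈ C ∧ F.card < j ∧
        ∀ u ∈ C, ∀ w, G.Adj u w → w ∈ C ∧ s(u, w) ∈ F := by
    intro j
    induction j with
    | zero => exact Or.inl ⟨({v}, ∅), by simp [explorations], by simp⟩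
    | succ j ih =>
      rcases ih with ⟨q, hq, hqG⟩ | ⟨C, F, hv, hF, hC⟩
      · obtain ⟨h1, h2, h3, h4, h5⟩ := explorations_spec v j q hq
        by_cases hcl : ∀ u ∈ q.1, ∀ w, G.Adj u w → s(u, w) ∈ q.2
        · exact Or.inr ⟨q.1, q.2, h1, by omega, fun u hu w hw =>
            ⟨(h5 u w (hcl u hu w hw)).2, hcl u hu w hw⟩⟩
        · push Not at hcl
          obtain ⟨u, hu, w, hw, hn⟩ := hcl
          obtain ⟨i, rfl⟩ := hypercube_adj_iff.1 (hG hw)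
          refine Or.inl ⟨_, mem_explorations_succ.2 ⟨q, hq, u, hu, i, hn, rfl⟩, ?_⟩
          rw [Finset.coe_insert]
          exact Set.insert_subset hw hqG
      · exact Or.inr ⟨C, F, hv, by omega, hC⟩
  rcases key (k + 1) with h | ⟨C, F, hv, hF, hC⟩
  · exact absurd h hk
  · exact ⟨C, F, hv, by omega, hC⟩

/-- Every component of `G` has at most `k` edges: no connected set of `k + 1` edges of the cube is
contained in `G`. -/
def SmallComponents (G : SimpleGraph (Fin n → Bool)) (k : ℕ) : Prop :=
  ∀ v : Fin n → Bool, ¬ ∃ q ∈ explorations v (k + 1), (q.2 : Set (Sym2 (Fin n → Bool))) ⊆ G.edgeSet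

/-- `G` contains a cycle of length four. -/
def HasFourCycle (G : SimpleGraph (Fin n → Bool)) : Prop :=
  ∃ u u' w w', u ≠ u' ∧ w ≠ w' ∧ G.Adj u w ∧ G.Adj u w' ∧ G.Adj u' w ∧ G.Adj u' w'

lemma lambdaMax_nonneg (G : SimpleGraph (Fin n → Bool)) : 0 ≤ lambdaMax G :=
  (Real.sqrt_nonneg _).trans (sqrt_maxDeg_le_lambdaMax G)

/-- An eigenvector of the largest eigenvalue that lives on a set spanning few edges. -/
lemma exists_lambdaMax_eigenvector_of_smallComponents {G : SimpleGraph (Fin n → Bool)}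
    (hG : G ≤ hypercube n) {k : ℕ} (hk : SmallComponents G k) :
    ∃ x : (Fin n → Bool) → ℝ, (∀ u, ∑ w ∈ nb G u, x w = lambdaMax G * x u) ∧ (∃ u, x u ≠ 0) ∧
      ∃ F : Finset (Sym2 (Fin n → Bool)), F.card ≤ k ∧
        ∀ u w, x u ≠ 0 → x w ≠ 0 → G.Adj u w → s(u, w) ∈ F := by
  classical
  obtain ⟨x, hx, h1⟩ := exists_lambdaMax_eigenvector G
  obtain ⟨v, hv⟩ : ∃ v, x v ≠ 0 := by
    by_contra! h
    simp [h] at h1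
  obtain ⟨C, F, hvC, hF, hC⟩ := exists_closed_of_no_exploration hG v (hk v)
  -- the restriction of an eigenvector to a set closed under adjacency is an eigenvector or zero
  refine ⟨fun u => if u ∈ C then x u else 0, fun u => ?_, ⟨v, by simp [hvC, hv]⟩, F, hF, ?_⟩
  · dsimp only
    by_cases hu : u ∈ C
    · rw [if_pos hu, ← hx u]
      exact Finset.sum_congr rfl fun w hw => if_pos (hC u hu w (mem_nb.1 hw)).1
    · rw [if_neg hu, mul_zero]
      refine Finset.sum_eq_zero fun w hw => if_neg fun hwC => hu ?_
      exact (hC w hwC u (mem_nb.1 hw).symm).1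
  · intro u w hu _ huw
    have : u ∈ C := by
      by_contra h
      simp [h] at hu
    exact (hC u this w huw).2

lemma sq_lambdaMax_le_of_smallComponents {G : SimpleGraph (Fin n → Bool)}
    (hG : G ≤ hypercube n) {k : ℕ} (hk : SmallComponents G k) : lambdaMax G ^ 2 ≤ k := by
  rcases (lambdaMax_nonneg G).eq_or_lt with h0 | hpos
  · rw [← h0, zero_pow two_ne_zero]; positivity
  obtain ⟨x, hx, hx0, F, hF, hxF⟩ := exists_lambdaMax_eigenvector_of_smallComponents hG hk
  have h := (sq_eigenvalue_lt_or_complete G IsEven (fun u w huw => isEven_iff_of_adj (hG huw))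
    hpos x hx hx0 F hxF).2.2.1
  exact h.trans (by exact_mod_cast hF)

/-- If the support of an eigenvector is a star around `u`, the eigenvalue is that of the star. -/
lemma sq_eigenvalue_le_maxDeg {V : Type*} [Fintype V] (G : SimpleGraph V) {μ : ℝ} (x : V → ℝ)
    (hx : ∀ u, ∑ w ∈ nb G u, x w = μ * x u) {u : V} (hu : x u ≠ 0)
    (hstar : ∀ w, G.Adj u w → x w ≠ 0 → ∀ u', G.Adj w u' → x u' ≠ 0 → u' = u) :
    μ ^ 2 ≤ maxDeg G := by
  classical
  have h1 : ∀ w ∈ nb G u, μ * x w = if x w ≠ 0 then x u else 0 := by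
    intro w hw
    split_ifs with h0
    · rw [← hx w]
      refine Finset.sum_eq_single u (fun u' hu' hne => ?_) fun h => ?_
      · by_contra h
        exact hne (hstar w (mem_nb.1 hw) h0 u' (mem_nb.1 hu') h)
      · exact absurd (mem_nb.2 (mem_nb.1 hw).symm) h
    · rw [not_not.1 h0, mul_zero]
  have h2 : μ ^ 2 * x u = ((nb G u).filter fun w => x w ≠ 0).card * x u := by
    calc μ ^ 2 * x u = ∑ w ∈ nb G u, μ * x w := by rw [← Finset.mul_sum, hx u]; ring
      _ = _ := by
        rw [Finset.sum_congr rfl h1, ← Finset.sum_filter, Finset.sum_const, nsmul_eq_mul]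
  rw [mul_right_cancel₀ hu h2]
  exact_mod_cast (Finset.card_filter_le _ _).trans (card_nb_le_maxDeg G u)

/-- With components of at most `k` edges, the bound `k` for the square of the largest eigenvalue is
only attained by stars, or by cycles of length four: two vertices of the cube have at most two common
neighbours, so it contains no larger complete bipartite graph. -/
lemma sq_lambdaMax_lt_or_le_maxDeg {G : SimpleGraph (Fin n → Bool)}
    (hG : G ≤ hypercube n) {k : ℕ} (hk : SmallComponents G k)
    (h4 : k ≤ 4 → ¬ HasFourCycle G) :
    lambdaMax G ^ 2 < k ∨ lambdaMax G ^ 2 ≤ maxDeg G := by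
  classical
  rcases (lambdaMax_nonneg G).eq_or_lt with h0 | hpos
  · right; rw [← h0, zero_pow two_ne_zero]; positivity
  obtain ⟨x, hx, hx0, F, hF, hxF⟩ := exists_lambdaMax_eigenvector_of_smallComponents hG hk
  have hcol : ∀ u w, G.Adj u w → (IsEven u ↔ ¬ IsEven w) := fun u w huw =>
    isEven_iff_of_adj (hG huw)
  obtain ⟨⟨u, hu, hue⟩, ⟨w, hw, hwo⟩, -, h⟩ :=
    sq_eigenvalue_lt_or_complete G IsEven hcol hpos x hx hx0 F hxF
  rcases h with h | hcomp
  · exact Or.inl (h.trans_le (by exact_mod_cast hF))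
  by_cases hA : ∀ u', x u' ≠ 0 → IsEven u' → u' = u
  · right
    refine sq_eigenvalue_le_maxDeg G x hx hu fun w' h1 _ u' h2 h3 => hA u' h3 ?_
    have := hcol _ _ h1
    have := hcol _ _ h2
    tauto
  by_cases hB : ∀ w', x w' ≠ 0 → ¬ IsEven w' → w' = w
  · right
    refine sq_eigenvalue_le_maxDeg G x hx hw fun u' h1 _ w' h2 h3 => hB w' h3 ?_
    have := hcol _ _ h1
    have := hcol _ _ h2
    tauto
  push Not at hA hB
  obtain ⟨u', hu', hue', huu⟩ := hA
  obtain ⟨w', hw', hwo', hww⟩ := hB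
  have hk5 : 5 ≤ k := by
    by_contra hlt
    exact h4 (by omega) ⟨u, u', w, w', huu.symm, hww.symm, hcomp u w hu hw hue hwo,
      hcomp u w' hu hw' hue hwo', hcomp u' w hu' hw hue' hwo, hcomp u' w' hu' hw' hue' hwo'⟩
  -- each colour class of the support lies in a common neighbourhood of two vertices
  left
  set F' := ((nb G w ∩ nb G w') ×ˢ (nb G u ∩ nb G u')).image fun q => s(q.1, q.2) with hF'
  have hF'card : F'.card ≤ 4 := by
    refine Finset.card_image_le.trans ?_
    rw [Finset.card_product]
    exact Nat.mul_le_mul (card_nb_inter_nb_le_two hG hww.symm)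
      (card_nb_inter_nb_le_two hG huu.symm)
  have h := (sq_eigenvalue_lt_or_complete G IsEven hcol hpos x hx hx0 F' ?_).2.2.1
  · refine h.trans_lt ?_
    have h1 : (F'.card : ℝ) ≤ 4 := by exact_mod_cast hF'card
    have h2 : (5 : ℝ) ≤ k := by exact_mod_cast hk5
    linarith
  · intro a b ha hb hab
    have key : ∀ a b, x a ≠ 0 → x b ≠ 0 → IsEven a → ¬ IsEven b → s(a, b) ∈ F' := by
      intro a b ha hb hae hbo
      refine Finset.mem_image.2 ⟨(a, b), ?_, rfl⟩
      simp only [Finset.mem_product, Finset.mem_inter, mem_nb]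
      exact ⟨⟨(hcomp a w ha hw hae hwo).symm, (hcomp a w' ha hw' hae hwo').symm⟩,
        hcomp u b hu hb hue hbo, hcomp u' b hu' hb hue' hbo⟩
    by_cases hae : IsEven a
    · exact key a b ha hb hae ((hcol a b hab).1 hae)
    · have hbe : IsEven b := by
        by_contra hb'
        exact hae ((hcol a b hab).2 hb')
      rw [Sym2.eq_swap]
      exact key b a hb ha hbe hae

lemma randomCubeSubgraph_real_not_smallComponents_le (p : I) (k : ℕ) :
    (randomCubeSubgraph n p).real {G | ¬ SmallComponents G k} ≤
      (k + 1).factorial * (2 ^ n * (n * (p : ℝ)) ^ (k + 1)) := by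
  classical
  set T : Finset (Finset (Sym2 (Fin n → Bool))) :=
    Finset.univ.biUnion fun v => (explorations v (k + 1)).image Prod.snd with hT
  have hTc : (T.card : ℝ) ≤ 2 ^ n * ((k + 1).factorial * n ^ (k + 1)) := by
    have : T.card ≤ 2 ^ n * ((k + 1).factorial * n ^ (k + 1)) := by
      refine (Finset.card_biUnion_le_card_mul _ _ _ fun v _ =>
        Finset.card_image_le.trans (card_explorations_le v (k + 1))).trans (le_of_eq ?_)
      simp
    exact_mod_cast this
  have hspec : ∀ F ∈ T, ∃ v, ∃ q ∈ explorations v (k + 1), q.2 = F := by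
    intro F hF
    obtain ⟨v, -, hv⟩ := Finset.mem_biUnion.1 hF
    obtain ⟨q, hq, rfl⟩ := Finset.mem_image.1 hv
    exact ⟨v, q, hq, rfl⟩
  calc _ ≤ (randomCubeSubgraph n p).real {G | ∃ F ∈ T, (F : Set _) ⊆ G.edgeSet} := by
        refine randomCubeSubgraph_real_mono p fun G _ h => ?_
        simp only [SmallComponents, not_forall, not_not, Set.mem_ofPred_eq] at h
        obtain ⟨v, q, hq, hqG⟩ := h
        exact ⟨q.2, Finset.mem_biUnion.2 ⟨v, Finset.mem_univ _, Finset.mem_image_of_mem _ hq⟩, hqG⟩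
    _ ≤ T.card * (p : ℝ) ^ (k + 1) := by
        refine randomCubeSubgraph_real_exists_subset_le p (fun F hF => ?_) (fun F hF => ?_)
        · obtain ⟨v, q, hq, rfl⟩ := hspec F hF
          exact (explorations_spec v _ q hq).2.2.2.1
        · obtain ⟨v, q, hq, rfl⟩ := hspec F hF
          exact (explorations_spec v _ q hq).2.2.1
    _ ≤ 2 ^ n * ((k + 1).factorial * n ^ (k + 1)) * (p : ℝ) ^ (k + 1) :=
        mul_le_mul_of_nonneg_right hTc (pow_nonneg p.2.1 _)
    _ = _ := by rw [mul_pow]; ring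

/-- A cycle of length four is determined by a vertex and three directions. -/
lemma randomCubeSubgraph_real_hasFourCycle_le (p : I) :
    (randomCubeSubgraph n p).real {G | HasFourCycle G} ≤ 2 ^ n * (n : ℝ) ^ 3 * (p : ℝ) ^ 4 := by
  classical
  -- the edges between `{v, v + i + l}` and `{v + i, v + j}`; for some choices this is no cycle
  let C : (Fin n → Bool) × (Fin n × Fin n × Fin n) → Finset (Sym2 (Fin n → Bool)) := fun r =>
    (({r.1, flipAt (flipAt r.1 r.2.1) r.2.2.2} : Finset (Fin n → Bool)) ×ˢ
      ({flipAt r.1 r.2.1, flipAt r.1 r.2.2.1} : Finset (Fin n → Bool))).image fun q => s(q.1, q.2)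
  set T : Finset (Finset (Sym2 (Fin n → Bool))) := (Finset.univ.image C).filter
    fun F : Finset (Sym2 (Fin n → Bool)) => F.card = 4 ∧ (F : Set _) ⊆ (hypercube n).edgeSet with hT
  have hTc : (T.card : ℝ) ≤ 2 ^ n * (n : ℝ) ^ 3 := by
    have : T.card ≤ 2 ^ n * n ^ 3 := by
      refine (Finset.card_filter_le _ _).trans (Finset.card_image_le.trans (le_of_eq ?_))
      simp [Fintype.card_prod]
      ring
    exact_mod_cast this
  calc _ ≤ (randomCubeSubgraph n p).real {G | ∃ F ∈ T, (F : Set _) ⊆ G.edgeSet} := by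
        refine randomCubeSubgraph_real_mono p fun G hG h => ?_
        obtain ⟨u, u', w, w', huu, hww, h1, h2, h3, h4⟩ := h
        obtain ⟨i, rfl⟩ := hypercube_adj_iff.1 (hG h1)
        obtain ⟨j, rfl⟩ := hypercube_adj_iff.1 (hG h2)
        obtain ⟨l, rfl⟩ := hypercube_adj_iff.1 (hG h3.symm)
        have hsub : (C (u, i, j, l) : Set _) ⊆ G.edgeSet := by
          intro e he
          obtain ⟨⟨a, b⟩, hab, rfl⟩ := Finset.mem_image.1 (Finset.mem_coe.1 he)
          simp only [Finset.mem_product, Finset.mem_insert, Finset.mem_singleton] at hab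
          rcases hab with ⟨rfl | rfl, rfl | rfl⟩ <;> assumption
        refine ⟨C (u, i, j, l), Finset.mem_filter.2 ⟨Finset.mem_image_of_mem _ (Finset.mem_univ _),
          ?_, hsub.trans (SimpleGraph.edgeSet_subset_edgeSet.2 hG)⟩, hsub⟩
        rw [Finset.card_image_of_injOn, Finset.card_product, Finset.card_pair huu,
          Finset.card_pair hww]
        rintro ⟨a, b⟩ hab ⟨c, d⟩ hcd hs
        simp only [Finset.coe_product, Finset.coe_insert, Finset.coe_singleton, Set.mem_prod,
          Set.mem_insert_iff, Set.mem_singleton_iff] at hab hcd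
        rcases Sym2.eq_iff.1 hs with ⟨h5, h6⟩ | ⟨h5, h6⟩
        · exact Prod.ext h5 h6
        · exfalso
          simp only at h5
          subst h5
          rcases hab.1 with rfl | rfl <;> rcases hcd.2 with h7 | h7
          · exact h1.ne h7
          · exact h2.ne h7
          · exact h3.ne h7
          · exact h4.ne h7
    _ ≤ T.card * (p : ℝ) ^ 4 :=
        randomCubeSubgraph_real_exists_subset_le p (fun F hF => (Finset.mem_filter.1 hF).2.2)
          (fun F hF => (Finset.mem_filter.1 hF).2.1)
    _ ≤ _ := mul_le_mul_of_nonneg_right hTc (pow_nonneg p.2.1 _)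

end Components

/-! ### Exponentially small probabilities: bounded degrees -/

section ExponentiallySmall

lemma withHighProb_of_forall_eventually_le {p : ℕ → I}
    {E : (n : ℕ) → SimpleGraph (Fin n → Bool) → Prop}
    (h : ∀ ε : ℝ, 0 < ε → ∀ᶠ n in atTop, (randomCubeSubgraph n (p n)).real {G | ¬ E n G} ≤ ε) :
    WithHighProb p E := by
  have h0 : Tendsto (fun n => (randomCubeSubgraph n (p n)).real {G | ¬ E n G}) atTop (𝓝 0) := by
    refine tendsto_order.2 ⟨fun a ha => Eventually.of_forall fun n =>
      ha.trans_le measureReal_nonneg, fun a ha => ?_⟩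
    filter_upwards [h (a / 2) (half_pos ha)] with n hn
    linarith
  have h1 : Tendsto (fun n => (randomCubeSubgraph n (p n)).real {G | E n G}) atTop (𝓝 1) := by
    have := h0.const_sub 1
    rw [sub_zero] at this
    refine this.congr fun n => ?_
    rw [show {G | ¬ E n G} = {G | E n G}ᶜ from rfl, probReal_compl_eq_one_sub .of_discrete]
    ring
  rw [WithHighProb, ← ENNReal.tendsto_toReal_iff (fun n => measure_ne_top _ _) (by simp)]
  simpa [measureReal_def] using h1

lemma natCast_mul_threshold {k n : ℕ} (hn : n ≠ 0) :
    (n : ℝ) * threshold k n = (2 : ℝ) ^ (-((n : ℝ) / k)) := by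
  rw [threshold]
  field_simp

lemma threshold_nonneg (k n : ℕ) : 0 ≤ threshold k n := by
  rw [threshold]; positivity

lemma threshold_pos {n : ℕ} (k : ℕ) (hn : n ≠ 0) : 0 < threshold k n := by
  rw [threshold]; positivity

lemma natCast_mul_threshold_le_one {k n : ℕ} (hn : n ≠ 0) : (n : ℝ) * threshold k n ≤ 1 := by
  rw [natCast_mul_threshold hn]
  exact Real.rpow_le_one_of_one_le_of_nonpos (by norm_num) (by
    rw [neg_nonpos]; positivity)

/-- The threshold is where `2 ^ n * (n * p) ^ k` is of order one. -/
lemma two_pow_mul_threshold_pow {k n : ℕ} (hk : k ≠ 0) (hn : n ≠ 0) :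
    (2 : ℝ) ^ n * (n * threshold k n) ^ k = 1 := by
  rw [natCast_mul_threshold hn, ← Real.rpow_natCast, ← Real.rpow_natCast, ← Real.rpow_mul (by norm_num),
    ← Real.rpow_add (by norm_num)]
  have : (n : ℝ) + -((n : ℝ) / k) * k = 0 := by
    have : (k : ℝ) ≠ 0 := by exact_mod_cast hk
    field_simp
    ring
  rw [this, Real.rpow_zero]

lemma le_two_pow_mul_pow {k n : ℕ} (hk : k ≠ 0) (hn : n ≠ 0) {q C : ℝ} (hC : 0 ≤ C)
    (h : C * threshold k n ≤ q) : C ^ k ≤ (2 : ℝ) ^ n * (n * q) ^ k := by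
  have ht := threshold_nonneg k n
  calc C ^ k = C ^ k * ((2 : ℝ) ^ n * (n * threshold k n) ^ k) := by
        rw [two_pow_mul_threshold_pow hk hn, mul_one]
    _ = (2 : ℝ) ^ n * (n * (C * threshold k n)) ^ k := by rw [mul_pow, mul_pow, mul_pow]; ring
    _ ≤ _ := by gcongr

lemma two_pow_mul_pow_le {k n : ℕ} (hk : k ≠ 0) (hn : n ≠ 0) {q C : ℝ} (hq : 0 ≤ q)
    (h : q ≤ C * threshold k n) : (2 : ℝ) ^ n * (n * q) ^ k ≤ C ^ k := by
  calc (2 : ℝ) ^ n * (n * q) ^ k ≤ (2 : ℝ) ^ n * (n * (C * threshold k n)) ^ k := by gcongr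
    _ = C ^ k * ((2 : ℝ) ^ n * (n * threshold k n) ^ k) := by rw [mul_pow, mul_pow, mul_pow]; ring
    _ = C ^ k := by rw [two_pow_mul_threshold_pow hk hn, mul_one]

lemma tendsto_natCast_mul_threshold {k : ℕ} (hk : k ≠ 0) :
    Tendsto (fun n : ℕ => (n : ℝ) * threshold k n) atTop (𝓝 0) := by
  have hk' : (0 : ℝ) < k := by positivity
  have h : Tendsto (fun n : ℕ => (2 : ℝ) ^ (-((n : ℝ) / k))) atTop (𝓝 0) :=
    (tendsto_rpow_atBot_of_base_gt_one 2 (by norm_num)).comp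
      (tendsto_neg_atTop_atBot.comp (tendsto_natCast_atTop_atTop.atTop_div_const hk'))
  refine h.congr' ?_
  filter_upwards [eventually_ne_atTop 0] with n hn
  rw [natCast_mul_threshold hn]

/-- The threshold `k` is reached exactly when the predicted degree is at least `k`. -/
lemma threshold_le_iff {k n : ℕ} (hk : k ≠ 0) (hn : n ≠ 0) {q : ℝ} (hq : 0 < q)
    (hL : 0 < Real.log q⁻¹ - Real.log n) :
    threshold k n ≤ q ↔ (k : ℝ) ≤ n * Real.log 2 / (Real.log q⁻¹ - Real.log n) := by
  have hk' : (0 : ℝ) < k := by positivity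
  have hn' : (n : ℝ) ≠ 0 := by positivity
  rw [← Real.log_le_log_iff (threshold_pos k hn) hq, threshold,
    Real.log_mul (by positivity) (by positivity), Real.log_rpow (by norm_num), Real.log_inv,
    le_div_iff₀ hL, Real.log_inv]
  have : -((n : ℝ) / k) * Real.log 2 = -(n * Real.log 2 / k) := by ring
  rw [this]
  constructor
  · intro h
    have h1 : -Real.log q - Real.log n ≤ n * Real.log 2 / k := by linarith
    rw [le_div_iff₀ hk'] at h1
    linarith
  · intro h
    have h1 : -Real.log q - Real.log n ≤ n * Real.log 2 / k := by
      rw [le_div_iff₀ hk']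
      linarith
    linarith

lemma one_sub_pow_le_inv {q : ℝ} (hq0 : 0 ≤ q) (hq1 : q ≤ 1) (b : ℕ) :
    (1 - q) ^ b ≤ (1 + b * q)⁻¹ := by
  have h1 : 1 + b * q ≤ (1 + q) ^ b := one_add_mul_le_pow (by linarith) b
  have hpos : 0 < 1 + b * q := by positivity
  rw [← one_div, le_div_iff₀ hpos]
  have h0 : 0 ≤ 1 - q := by linarith
  calc (1 - q) ^ b * (1 + b * q) ≤ (1 - q) ^ b * (1 + q) ^ b := by gcongr
    _ = ((1 - q) * (1 + q)) ^ b := (mul_pow _ _ _).symm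
    _ ≤ 1 := pow_le_one₀ (by positivity) (by nlinarith)

/-- For bounded `k` the maximum degree is likely to be at least `k` once `2 ^ n * (n * p) ^ k` is
large. -/
lemma randomCubeSubgraph_real_forall_degree_lt_le_exp {n k : ℕ} (p : I) (hk : k ≠ 0) (hkn : k ≤ n)
    (hnp : n * (p : ℝ) ≤ 1) :
    (randomCubeSubgraph n p).real {G | ∀ v, (nb G v).card < k} ≤
      Real.exp (-((2 * (4 * (k : ℝ)) ^ k)⁻¹ * (2 ^ n * (n * (p : ℝ)) ^ k))) := by
  have hp0 := p.2.1
  have hp1 := p.2.2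
  have hk' : (0 : ℝ) < k := by positivity
  set b := n / k with hb
  have hkb : k * b ≤ n := Nat.mul_div_le n k
  have hb1 : 1 ≤ b := Nat.div_pos hkn (by omega)
  have hnb : (n : ℝ) ≤ 2 * k * b := by
    have h1 : n < k * (b + 1) := Nat.lt_mul_div_succ n (by omega)
    have h2 : n ≤ 2 * k * b := by nlinarith
    exact_mod_cast h2
  have hbp : b * (p : ℝ) ≤ 1 := by
    refine le_trans ?_ hnp
    gcongr
    exact Nat.div_le_self n k
  refine (randomCubeSubgraph_real_forall_degree_lt_le' p hkb (by omega)).trans ?_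
  have hbp0 : 0 ≤ b * (p : ℝ) := by positivity
  have h1 : n * (p : ℝ) / (4 * k) ≤ 1 - (1 - (p : ℝ)) ^ b := by
    have h2 := one_sub_pow_le_inv hp0 hp1 b
    have h3 : (1 + b * (p : ℝ))⁻¹ ≤ 1 - b * (p : ℝ) / 2 := by
      rw [inv_le_iff_one_le_mul₀ (by positivity)]
      nlinarith
    have h4 : n * (p : ℝ) / (4 * k) ≤ b * (p : ℝ) / 2 := by
      rw [div_le_div_iff₀ (by positivity) (by norm_num)]
      nlinarith
    linarith
  have h5 : (n * (p : ℝ) / (4 * k)) ^ k ≤ (1 - (1 - (p : ℝ)) ^ b) ^ k := by gcongr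
  refine Real.exp_le_exp.2 (neg_le_neg ?_)
  calc _ = 2 ^ n / 2 * (n * (p : ℝ) / (4 * k)) ^ k := by
        rw [div_pow]; field_simp
    _ ≤ _ := by gcongr

variable {p : ℕ → I}

/-- Between two consecutive thresholds, and far from both of them, the maximum degree and the largest
eigenvalue are determined. -/
lemma eventually_real_between_thresholds {k : ℕ} (hk : k ≠ 0)
    (hlow : ∀ C : ℝ, 1 ≤ C → ∀ᶠ n in atTop, threshold k n ≤ p n → C * threshold k n ≤ p n)
    (hup : ∀ C : ℝ, 1 ≤ C → ∀ᶠ n in atTop,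
      (p n : ℝ) < threshold (k + 1) n → (p n : ℝ) ≤ C⁻¹ * threshold (k + 1) n)
    {ε : ℝ} (hε : 0 < ε) :
    ∀ᶠ n in atTop, threshold k n ≤ p n → (p n : ℝ) < threshold (k + 1) n →
      (randomCubeSubgraph n (p n)).real
        {G | ¬ (lambdaMax G = √(maxDeg G : ℝ) ∧ maxDeg G = k)} ≤ ε := by
  -- `C` is chosen to make each of the two exceptional events below have probability at most `ε / 2`
  set c : ℝ := (2 * (4 * (k : ℝ)) ^ k)⁻¹ with hc
  have hc0 : 0 < c := by positivity
  set C : ℝ := max 1 (max (2 * (k + 1).factorial / ε) (2 / (ε * c))) with hC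
  have hC1 : 1 ≤ C := le_max_left _ _
  have hC2 : 2 * (k + 1).factorial / ε ≤ C := (le_max_left _ _).trans (le_max_right _ _)
  have hC3 : 2 / (ε * c) ≤ C := (le_max_right _ _).trans (le_max_right _ _)
  have hC0 : 0 < C := by linarith
  filter_upwards [hlow C hC1, hup C hC1, eventually_ge_atTop k] with n hl hu hn h1 h2
  have hn0 : n ≠ 0 := by omega
  have hp0 := (p n).2.1
  have e1 : (2 : ℝ) ^ n * (n * (p n : ℝ)) ^ (k + 1) ≤ C⁻¹ := by
    refine (two_pow_mul_pow_le (by omega) hn0 hp0 (hu h2)).trans ?_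
    exact pow_le_of_le_one (by positivity) (inv_le_one_of_one_le₀ hC1) (by omega)
  have e2 : C ≤ (2 : ℝ) ^ n * (n * (p n : ℝ)) ^ k :=
    (le_self_pow₀ hC1 hk).trans (le_two_pow_mul_pow hk hn0 hC0.le (hl h1))
  have hnp : n * (p n : ℝ) ≤ 1 :=
    (mul_le_mul_of_nonneg_left h2.le (by positivity)).trans (natCast_mul_threshold_le_one hn0)
  have b1 := randomCubeSubgraph_real_not_smallComponents_le (n := n) (p n) k
  have b2 := randomCubeSubgraph_real_forall_degree_lt_le_exp (p n) hk hn hnp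
  have f1 : ((k + 1).factorial : ℝ) * (2 ^ n * (n * (p n : ℝ)) ^ (k + 1)) ≤ ε / 2 := by
    refine (mul_le_mul_of_nonneg_left e1 (by positivity)).trans ?_
    rw [div_le_iff₀ hε] at hC2
    rw [← div_eq_mul_inv, div_le_iff₀ hC0]
    linarith
  have f2 : Real.exp (-(c * (2 ^ n * (n * (p n : ℝ)) ^ k))) ≤ ε / 2 := by
    have hx : 2 / ε ≤ c * (2 ^ n * (n * (p n : ℝ)) ^ k) := by
      calc 2 / ε = c * (2 / (ε * c)) := by field_simp
        _ ≤ _ := mul_le_mul_of_nonneg_left (hC3.trans e2) hc0.le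
    calc _ ≤ Real.exp (-(2 / ε)) := by gcongr
      _ ≤ (2 / ε)⁻¹ := by
        rw [Real.exp_neg]
        gcongr
        linarith [Real.add_one_le_exp (2 / ε)]
      _ = ε / 2 := inv_div _ _
  calc _ ≤ (randomCubeSubgraph n (p n)).real
        ({G | ¬ SmallComponents G k} ∪ {G | ∀ v, (nb G v).card < k}) := by
        refine randomCubeSubgraph_real_mono _ fun G hG hbad => ?_
        by_contra hgood
        simp only [Set.mem_union, Set.mem_ofPred_eq, not_or, not_not, not_forall, not_lt] at hgood
        obtain ⟨hs, v, hv⟩ := hgood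
        have g1 := sq_lambdaMax_le_of_smallComponents hG hs
        have g2 := sqrt_maxDeg_le_lambdaMax G
        have g3 : (k : ℝ) ≤ maxDeg G := by exact_mod_cast hv.trans (card_nb_le_maxDeg G v)
        have g4 := Real.sqrt_le_sqrt g3
        have g5 : lambdaMax G ≤ √(k : ℝ) := Real.le_sqrt_of_sq_le g1
        have g6 : √(maxDeg G : ℝ) = √(k : ℝ) := by linarith
        rw [Real.sqrt_inj (by positivity) (by positivity)] at g6
        refine hbad ⟨by linarith, by exact_mod_cast g6⟩
    _ ≤ _ := (measureReal_union_le _ _).trans (by linarith)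

/-- Away from the thresholds the largest eigenvalue is exactly the square root of the maximum
degree. -/
theorem withHighProb_of_nowhereProportional
    (h1 : threshold 1 =o[atTop] (fun n => (p n : ℝ)))
    (hγ : ∃ γ : ℝ, 1 < γ ∧ γ ≤ 2 ∧ ∀ᶠ n : ℕ in atTop, (p n : ℝ) ≤ (γ ^ n)⁻¹)
    (hk : ∀ k : ℕ, 2 ≤ k → NowhereProportional (fun n => (p n : ℝ)) (threshold k)) :
    WithHighProb p (fun n G =>
      lambdaMax G = √(maxDeg G : ℝ) ∧
      √(maxDeg G : ℝ) =
        √(⌊(n : ℝ) * Real.log 2 / (Real.log (p n : ℝ)⁻¹ - Real.log (n : ℝ))⌋ : ℝ)) := by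
  obtain ⟨γ, hγ1, -, hγp⟩ := hγ
  have hl2 : 0 < Real.log 2 := Real.log_pos (by norm_num)
  have hlγ : 0 < Real.log γ := Real.log_pos hγ1
  -- since `p` is exponentially small, only finitely many degrees are possible
  obtain ⟨K, hK⟩ := exists_nat_gt (2 * Real.log 2 / Real.log γ)
  have hlow : ∀ k : ℕ, k ≠ 0 → ∀ C : ℝ, 1 ≤ C →
      ∀ᶠ n in atTop, threshold k n ≤ p n → C * threshold k n ≤ p n := by
    intro k hk0 C hC
    rcases eq_or_ne k 1 with rfl | hk1
    · filter_upwards [h1.bound (c := C⁻¹) (by positivity)] with n hn _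
      rw [Real.norm_of_nonneg (threshold_nonneg _ _), Real.norm_of_nonneg (p n).2.1] at hn
      rwa [inv_mul_eq_div, le_div_iff₀ (by linarith), mul_comm] at hn
    · filter_upwards [hk k (by omega) C (by linarith)] with n hn hlt
      by_contra hc
      refine hn ⟨le_trans ?_ hlt, (not_le.1 hc).le⟩
      exact mul_le_of_le_one_left (threshold_nonneg _ _) (inv_le_one_of_one_le₀ hC)
  have hup : ∀ k : ℕ, k ≠ 0 → ∀ C : ℝ, 1 ≤ C → ∀ᶠ n in atTop,
      (p n : ℝ) < threshold (k + 1) n → (p n : ℝ) ≤ C⁻¹ * threshold (k + 1) n := by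
    intro k hk0 C hC
    filter_upwards [hk (k + 1) (by omega) C (by linarith)] with n hn hlt
    by_contra hc
    refine hn ⟨(not_le.1 hc).le, hlt.le.trans ?_⟩
    exact le_mul_of_one_le_left (threshold_nonneg _ _) hC
  refine withHighProb_of_forall_eventually_le fun ε hε => ?_
  have hall : ∀ᶠ n in atTop, ∀ k ∈ Finset.Icc 1 K, threshold k n ≤ p n →
      (p n : ℝ) < threshold (k + 1) n → (randomCubeSubgraph n (p n)).real
        {G | ¬ (lambdaMax G = √(maxDeg G : ℝ) ∧ maxDeg G = k)} ≤ ε := by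
    rw [Filter.eventually_all_finset]
    intro k hkK
    have hk0 : k ≠ 0 := by have := (Finset.mem_Icc.1 hkK).1; omega
    exact eventually_real_between_thresholds hk0 (hlow k hk0) (hup k hk0) hε
  have hlogn : ∀ᶠ n : ℕ in atTop, 0 + Real.log (n : ℝ) ≤ Real.log γ / 2 * n :=
    eventually_add_log_le (half_pos hlγ) 0 tendsto_natCast_atTop_atTop
  filter_upwards [hall, hlogn, hγp, eventually_ge_atTop 1, h1.bound (c := 1) one_pos]
    with n hn hlog hpγ hn1 ht1
  have hn0 : n ≠ 0 := by omega
  have hn0' : (0 : ℝ) < n := by positivity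
  rw [one_mul, Real.norm_of_nonneg (threshold_nonneg _ _), Real.norm_of_nonneg (p n).2.1] at ht1
  have hp0 : 0 < (p n : ℝ) := (threshold_pos 1 hn0).trans_le ht1
  have hLγ : n * Real.log γ ≤ Real.log (p n : ℝ)⁻¹ := by
    have := Real.log_le_log hp0 hpγ
    rw [Real.log_inv, Real.log_pow] at this
    rw [Real.log_inv]
    linarith
  set q := Real.log (p n : ℝ)⁻¹ - Real.log (n : ℝ) with hq
  have hq1 : n * Real.log γ / 2 ≤ q := by linarith
  have hq0 : 0 < q := lt_of_lt_of_le (by positivity) hq1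
  set x := (n : ℝ) * Real.log 2 / q with hx
  have hx0 : 0 ≤ x := by positivity
  have hx1 : 1 ≤ x := by exact_mod_cast (threshold_le_iff one_ne_zero hn0 hp0 hq0).1 ht1
  have hk1 : 1 ≤ ⌊x⌋₊ := Nat.le_floor (by exact_mod_cast hx1)
  have hxK : x ≤ K := by
    refine le_trans ?_ hK.le
    rw [hx, div_le_div_iff₀ hq0 hlγ]
    nlinarith
  have hkK : ⌊x⌋₊ ≤ K := Nat.floor_le_of_le hxK
  refine (measureReal_mono ?_).trans (hn ⌊x⌋₊ (Finset.mem_Icc.2 ⟨hk1, hkK⟩)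
    ((threshold_le_iff (by omega) hn0 hp0 hq0).2 (Nat.floor_le hx0)) ?_)
  · intro G hG hgood
    refine hG ⟨hgood.1, ?_⟩
    rw [hgood.2, ← natCast_floor_eq_intCast_floor hx0]
  · rw [← not_le, threshold_le_iff (by omega) hn0 hp0 hq0, not_le]
    push_cast
    exact Nat.lt_floor_add_one x

/-- At the threshold `k` the maximum degree is `k - 1` or `k`, and all components have at most `k`
edges. If `λ ^ 2` reached `Δ + 1`, then `Δ = k - 1` and some component would attain `λ ^ 2 = k` without
being a star. -/
theorem withHighProb_of_isTheta_threshold {k : ℕ} (hk : 2 ≤ k)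
    (hθ : (fun n => (p n : ℝ)) =Θ[atTop] threshold k) :
    WithHighProb p (fun n G =>
      √(maxDeg G : ℝ) ≤ lambdaMax G ∧ lambdaMax G < √((maxDeg G : ℝ) + 1) ∧
      |(maxDeg G : ℤ) -
        ⌊(n : ℝ) * Real.log 2 / (Real.log (p n : ℝ)⁻¹ - Real.log (n : ℝ))⌋| ≤ 1) := by
  obtain ⟨C, hC0, hC⟩ := hθ.1.exists_pos
  obtain ⟨c', hc'0, hc'⟩ := hθ.2.exists_pos
  set c := c'⁻¹ with hc
  have hc0 : 0 < c := inv_pos.2 hc'0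
  have hk0 : k ≠ 0 := by omega
  have hupper : ∀ᶠ n in atTop, (p n : ℝ) ≤ C * threshold k n := by
    filter_upwards [hC.bound] with n hn
    rwa [Real.norm_of_nonneg (threshold_nonneg _ _), Real.norm_of_nonneg (p n).2.1] at hn
  have hlower : ∀ᶠ n in atTop, c * threshold k n ≤ (p n : ℝ) := by
    filter_upwards [hc'.bound] with n hn
    rw [Real.norm_of_nonneg (threshold_nonneg _ _), Real.norm_of_nonneg (p n).2.1] at hn
    rwa [hc, inv_mul_eq_div, div_le_iff₀ hc'0, mul_comm]
  have hnp : Tendsto (fun n : ℕ => (n : ℝ) * p n) atTop (𝓝 0) := by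
    have h2 := (tendsto_natCast_mul_threshold hk0).const_mul C
    rw [mul_zero] at h2
    refine squeeze_zero' (Eventually.of_forall fun n => mul_nonneg (by positivity) (p n).2.1) ?_ h2
    filter_upwards [hupper] with n hn
    calc (n : ℝ) * p n ≤ n * (C * threshold k n) := by gcongr
      _ = _ := by ring
  refine withHighProb_of_forall_eventually_le fun ε hε => ?_
  set c₁ : ℝ := (2 * (4 * ((k - 1 : ℕ) : ℝ)) ^ (k - 1))⁻¹ with hc₁
  have hk1' : (0 : ℝ) < ((k - 1 : ℕ) : ℝ) := by
    have : 0 < k - 1 := by omega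
    exact_mod_cast this
  have hc₁0 : 0 < c₁ := by positivity
  set δ : ℝ := min (min 1 (c ^ k)) (min (ε / 3 / ((k + 1).factorial * C ^ k)) (c₁ * c ^ k * (ε / 3)))
    with hδ
  have hδ0 : 0 < δ := by positivity
  have hδ1 : δ ≤ 1 := (min_le_left _ _).trans (min_le_left _ _)
  have hδ2 : δ ≤ ε / 3 / ((k + 1).factorial * C ^ k) := (min_le_right _ _).trans (min_le_left _ _)
  have hδ3 : δ ≤ c₁ * c ^ k * (ε / 3) := (min_le_right _ _).trans (min_le_right _ _)
  have hδ4 : δ ≤ c ^ k := (min_le_left _ _).trans (min_le_right _ _)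
  filter_upwards [hupper, hlower, hnp.eventually (gt_mem_nhds (lt_min hδ0
      (show (0 : ℝ) < (C ^ k + 1)⁻¹ by positivity))),
    eventually_ge_atTop k, (tendsto_natCast_atTop_atTop (R := ℝ)).eventually_ge_atTop
      (C ^ k / (ε / 3))] with n hu hl hlt hnk hnε
  have hn0 : n ≠ 0 := by omega
  have hn0' : (0 : ℝ) < n := by positivity
  have hp0 : 0 < (p n : ℝ) := lt_of_lt_of_le (mul_pos hc0 (threshold_pos k hn0)) hl
  set r := (n : ℝ) * p n with hr
  have hr0 : 0 < r := by positivity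
  have hrδ : r < δ := hlt.trans_le (min_le_left _ _)
  have hrC : r < (C ^ k + 1)⁻¹ := hlt.trans_le (min_le_right _ _)
  have hr1 : r < 1 := hrδ.trans_le hδ1
  have e1 : (2 : ℝ) ^ n * r ^ k ≤ C ^ k := two_pow_mul_pow_le hk0 hn0 hp0.le hu
  have e2 : c ^ k ≤ (2 : ℝ) ^ n * r ^ k := le_two_pow_mul_pow hk0 hn0 hc0.le hl
  have e3 : (2 : ℝ) ^ n * r ^ (k + 1) ≤ C ^ k * r := by
    rw [pow_succ, ← mul_assoc]; gcongr
  have e4 : c ^ k / r ≤ (2 : ℝ) ^ n * r ^ (k - 1) := by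
    rw [div_le_iff₀ hr0, mul_assoc, ← pow_succ, show k - 1 + 1 = k by omega]
    exact e2
  -- the three exceptional events
  have b1 := randomCubeSubgraph_real_not_smallComponents_le (n := n) (p n) k
  have b2 := randomCubeSubgraph_real_forall_degree_lt_le_exp (p n) (k := k - 1) (by omega)
    (by omega) hr1.le
  have f1 : ((k + 1).factorial : ℝ) * (2 ^ n * r ^ (k + 1)) ≤ ε / 3 := by
    rw [le_div_iff₀ (by positivity)] at hδ2
    calc _ ≤ ((k + 1).factorial : ℝ) * (C ^ k * r) := by gcongr
      _ ≤ δ * ((k + 1).factorial * C ^ k) := by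
        rw [mul_comm δ, ← mul_assoc]; gcongr
      _ ≤ _ := hδ2
  have f2 : Real.exp (-(c₁ * (2 ^ n * r ^ (k - 1)))) ≤ ε / 3 := by
    have hx : (ε / 3)⁻¹ ≤ c₁ * (2 ^ n * r ^ (k - 1)) := by
      refine le_trans ?_ (mul_le_mul_of_nonneg_left e4 hc₁0.le)
      rw [← mul_div_assoc, le_div_iff₀ hr0, inv_mul_le_iff₀ (by positivity)]
      linarith
    calc _ ≤ Real.exp (-(ε / 3)⁻¹) := by gcongr
      _ ≤ ((ε / 3)⁻¹)⁻¹ := by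
        rw [Real.exp_neg]
        gcongr
        linarith [Real.add_one_le_exp (ε / 3)⁻¹]
      _ = ε / 3 := inv_inv _
  have b3 : (randomCubeSubgraph n (p n)).real {G | k ≤ 4 ∧ HasFourCycle G} ≤ ε / 3 := by
    by_cases hk4 : k ≤ 4
    · calc _ ≤ (randomCubeSubgraph n (p n)).real {G | HasFourCycle G} :=
            measureReal_mono fun G hG => hG.2
        _ ≤ 2 ^ n * (n : ℝ) ^ 3 * (p n : ℝ) ^ 4 := randomCubeSubgraph_real_hasFourCycle_le (p n)
        _ = 2 ^ n * r ^ 4 / n := by rw [hr]; field_simp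
        _ ≤ 2 ^ n * r ^ k / n := by
            have := pow_le_pow_of_le_one hr0.le hr1.le hk4
            gcongr
        _ ≤ C ^ k / n := by gcongr
        _ ≤ ε / 3 := by
            rw [div_le_iff₀ (by positivity)] at hnε
            rw [div_le_iff₀ hn0']
            linarith
    · simp [hk4]; positivity
  -- the predicted degree is `k - 1` or `k`
  have hq0 : 0 < Real.log (p n : ℝ)⁻¹ - Real.log n := by
    have := Real.log_neg hr0 hr1
    rw [hr, Real.log_mul hn0'.ne' hp0.ne'] at this
    rw [Real.log_inv]
    linarith
  set x := (n : ℝ) * Real.log 2 / (Real.log (p n : ℝ)⁻¹ - Real.log n) with hx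
  have hx1 : ((k - 1 : ℕ) : ℝ) ≤ x := by
    rw [hx, ← threshold_le_iff (by omega) hn0 hp0 hq0]
    by_contra! hlt
    have h2 := two_pow_mul_pow_le (k := k - 1) (C := 1) (by omega) hn0 hp0.le
      (by rw [one_mul]; exact hlt.le)
    rw [one_pow, ← hr] at h2
    have h3 := e4.trans h2
    rw [div_le_one hr0] at h3
    linarith
  have hx2 : x < k + 1 := by
    have h2 : ¬ threshold (k + 1) n ≤ p n := fun hle => by
      have h3 := le_two_pow_mul_pow (k := k + 1) (C := 1) (q := p n) (by omega) hn0 (by norm_num)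
        (by rw [one_mul]; exact hle)
      rw [one_pow, ← hr] at h3
      have h4 := h3.trans e3
      rw [lt_inv_comm₀ hr0 (by positivity)] at hrC
      have h5 : (C ^ k + 1) * r < 1 := by
        have := mul_lt_mul_of_pos_right hrC hr0
        rwa [inv_mul_cancel₀ hr0.ne'] at this
      nlinarith
    rw [threshold_le_iff (by omega) hn0 hp0 hq0, not_le] at h2
    exact_mod_cast h2
  have hfl1 : (k : ℤ) - 1 ≤ ⌊x⌋ := by
    rw [Int.le_floor]
    push_cast [Nat.cast_sub (show 1 ≤ k by omega)] at hx1 ⊢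
    exact hx1
  have hfl2 : ⌊x⌋ ≤ (k : ℤ) := by
    rw [← Int.lt_add_one_iff, Int.floor_lt]
    push_cast
    exact hx2
  calc _ ≤ (randomCubeSubgraph n (p n)).real
        (({G | ¬ SmallComponents G k} ∪ {G | ∀ v, (nb G v).card < k - 1}) ∪
          {G | k ≤ 4 ∧ HasFourCycle G}) := by
        refine randomCubeSubgraph_real_mono _ fun G hG hbad => ?_
        by_contra hgood
        simp only [Set.mem_union, Set.mem_ofPred_eq, not_or, not_not, not_forall, not_lt,
          not_and] at hgood
        obtain ⟨⟨hs, v, hv⟩, h4⟩ := hgood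
        have g1 := sq_lambdaMax_le_of_smallComponents hG hs
        have g2 := sqrt_maxDeg_le_lambdaMax G
        have g3 : k - 1 ≤ maxDeg G := hv.trans (card_nb_le_maxDeg G v)
        have g4 : maxDeg G ≤ k := by
          have := Real.sqrt_le_iff.1 g2
          exact_mod_cast this.2.trans g1
        refine hbad ⟨g2, ?_, ?_⟩
        · refine Real.lt_sqrt_of_sq_lt ?_
          rcases sq_lambdaMax_lt_or_le_maxDeg hG hs h4 with g5 | g5
          · refine g5.trans_le ?_
            exact_mod_cast (by omega : k ≤ maxDeg G + 1)
          · linarith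
        · rw [abs_le]
          omega
    _ ≤ _ := by
        refine (measureReal_union_le _ _).trans ?_
        have := measureReal_union_le (μ := randomCubeSubgraph n (p n))
          {G | ¬ SmallComponents G k} {G | ∀ v, (nb G v).card < k - 1}
        linarith

end ExponentiallySmall

/-! ### Few edges: the Bernoulli limit and the empty graph -/

section FewEdges

variable {n : ℕ}

lemma lambdaMax_bot : lambdaMax (⊥ : SimpleGraph (Fin n → Bool)) = 0 := by
  obtain ⟨x, hx, h1⟩ := exists_lambdaMax_eigenvector (⊥ : SimpleGraph (Fin n → Bool))
  by_contra h0
  have : ∀ u, x u = 0 := fun u => by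
    have h := hx u
    rw [Finset.sum_eq_zero fun w hw => absurd (mem_nb.1 hw) (by simp)] at h
    exact (mul_eq_zero.1 h.symm).resolve_left h0
  simp [this] at h1

lemma exists_one_le_card_nb {G : SimpleGraph (Fin n → Bool)} (hG : G ≠ ⊥) :
    ∃ v, 1 ≤ (nb G v).card := by
  obtain ⟨v, w, h⟩ := SimpleGraph.ne_bot_iff_exists_adj.1 hG
  exact ⟨v, Finset.card_pos.2 ⟨w, mem_nb.2 h⟩⟩

/-- If every component has at most one edge, the largest eigenvalue detects whether there is an
edge. -/
lemma lambdaMax_eq_one {G : SimpleGraph (Fin n → Bool)} (hG : G ≤ hypercube n)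
    (h1 : SmallComponents G 1) (hne : G ≠ ⊥) : lambdaMax G = 1 := by
  obtain ⟨v, hv⟩ := exists_one_le_card_nb hne
  have h2 := sq_lambdaMax_le_of_smallComponents hG h1
  have h3 := sqrt_card_nb_le_lambdaMax G v
  have h4 : (1 : ℝ) ≤ √((nb G v).card : ℝ) := Real.one_le_sqrt.2 (by exact_mod_cast hv)
  have h5 : (1 : ℝ) ≤ lambdaMax G := h4.trans h3
  rw [Nat.cast_one] at h2
  nlinarith

/-- The exponent is the number of edges of the cube: each edge has exactly one even end, and each of
the `2 ^ (n - 1)` even vertices has `n` edges. -/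
lemma randomCubeSubgraph_real_eq_bot (p : I) (hn : n ≠ 0) :
    (randomCubeSubgraph n p).real {G | G = ⊥} = (1 - (p : ℝ)) ^ (2 ^ (n - 1) * n) := by
  classical
  set F : Finset (Sym2 (Fin n → Bool)) :=
    ((Finset.univ.filter (IsEven (n := n))) ×ˢ Finset.univ).image fun q => cubeEdge q.1 q.2 with hF
  have hFsub : (F : Set (Sym2 (Fin n → Bool))) ⊆ (hypercube n).edgeSet := by
    intro e he
    obtain ⟨q, -, rfl⟩ := Finset.mem_image.1 (Finset.mem_coe.1 he)
    exact cubeEdge_mem _ _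
  have hFcard : F.card = 2 ^ (n - 1) * n := by
    rw [hF, Finset.card_image_of_injOn, Finset.card_product, Finset.card_univ, Fintype.card_fin]
    · congr 1
      have h := two_mul_card_even hn
      obtain ⟨m, rfl⟩ := Nat.exists_eq_succ_of_ne_zero hn
      rw [Nat.succ_eq_add_one, pow_succ] at h
      simp only [Nat.succ_eq_add_one, add_tsub_cancel_right]
      have h2 : (Finset.univ.filter (IsEven (n := m + 1))).card = 2 ^ m := by
        have : 2 * (Finset.univ.filter (IsEven (n := m + 1))).card = 2 ^ m * 2 := by
          convert h
        omega
      convert h2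
    · intro q hq r hr h
      simp only [Finset.coe_product, Set.mem_prod, Finset.mem_coe, Finset.mem_filter,
        Finset.mem_univ, true_and] at hq hr
      obtain ⟨h1, h2⟩ := cubeEdge_inj (iff_of_true hq.1 hr.1) h
      exact Prod.ext h1 h2
  have hcover : ∀ e ∈ (hypercube n).edgeSet, e ∈ F := by
    intro e he
    induction e with
    | _ v w =>
      have hvw : (hypercube n).Adj v w := he
      have key : ∀ v w, (hypercube n).Adj v w → IsEven v → s(v, w) ∈ F := by
        intro v w hvw hv
        obtain ⟨i, rfl⟩ := hypercube_adj_iff.1 hvw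
        exact Finset.mem_image.2 ⟨(v, i), by simp [hv], rfl⟩
      by_cases hv : IsEven v
      · exact key v w hvw hv
      · rw [Sym2.eq_swap]
        refine key w v hvw.symm ?_
        have := isEven_iff_of_adj hvw
        tauto
  rw [← hFcard, ← randomCubeSubgraph_real_disjoint p hFsub]
  refine le_antisymm (randomCubeSubgraph_real_mono p fun G _ hG e _ => ?_)
    (randomCubeSubgraph_real_mono p fun G hG h => ?_)
  · rw [Set.mem_ofPred_eq] at hG
    simp [hG]
  · refine SimpleGraph.edgeSet_eq_empty.1 (Set.eq_empty_of_forall_notMem fun e he => ?_)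
    exact h e (hcover e (SimpleGraph.edgeSet_subset_edgeSet.2 hG he)) he

variable {p : ℕ → I}

/-- Far below the first threshold no vertex has a neighbour. -/
theorem withHighProb_eq_bot (h : (fun n => (p n : ℝ)) =o[atTop] threshold 1) :
    WithHighProb p (fun _ G => G = ⊥ ∧ lambdaMax G = 0) := by
  refine withHighProb_of_forall_eventually_le fun ε hε => ?_
  filter_upwards [h.bound hε, eventually_ne_atTop 0] with n hn hn0
  rw [Real.norm_of_nonneg (threshold_nonneg _ _), Real.norm_of_nonneg (p n).2.1] at hn
  calc _ ≤ (randomCubeSubgraph n (p n)).real {G | ∃ v, 1 ≤ (nb G v).card} := by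
        refine measureReal_mono fun G hG => ?_
        refine exists_one_le_card_nb fun h0 => hG ⟨h0, ?_⟩
        rw [h0, lambdaMax_bot]
    _ ≤ 2 ^ n * (n * (p n : ℝ)) ^ 1 := by
        simpa using randomCubeSubgraph_real_exists_degree_ge_le (p n) 1
    _ ≤ ε ^ 1 := two_pow_mul_pow_le one_ne_zero hn0 (p n).2.1 hn
    _ = ε := pow_one ε

lemma tendsto_one_sub_pow {q : ℕ → ℝ} {M : ℕ → ℕ} {t : ℝ} (hq : Tendsto q atTop (𝓝 0))
    (hM : Tendsto (fun n => (M n : ℝ) * q n) atTop (𝓝 t)) :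
    Tendsto (fun n => (1 - q n) ^ M n) atTop (𝓝 (Real.exp (-t))) := by
  have hlow : Tendsto (fun n => Real.exp (-((M n : ℝ) * q n * (1 - q n)⁻¹))) atTop
      (𝓝 (Real.exp (-t))) := by
    have h1 : Tendsto (fun n => (1 - q n)⁻¹) atTop (𝓝 1) := by
      have := (hq.const_sub 1).inv₀ (by norm_num)
      simpa using this
    have := (Real.continuous_exp.tendsto _).comp (hM.mul h1).neg
    rwa [mul_one] at this
  have hup : Tendsto (fun n => Real.exp (-((M n : ℝ) * q n))) atTop (𝓝 (Real.exp (-t))) :=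
    (Real.continuous_exp.tendsto _).comp hM.neg
  refine tendsto_of_tendsto_of_tendsto_of_le_of_le' hlow hup ?_ ?_
  · filter_upwards [hq.eventually (gt_mem_nhds (show (0 : ℝ) < 1 by norm_num))] with n hn
    have h0 : 0 < 1 - q n := by linarith
    have h1 := Real.one_sub_inv_le_log_of_pos h0
    calc _ ≤ Real.exp (M n * Real.log (1 - q n)) := by
          refine Real.exp_le_exp.2 ?_
          have h2 : -(q n * (1 - q n)⁻¹) = 1 - (1 - q n)⁻¹ := by field_simp; ring
          calc -((M n : ℝ) * q n * (1 - q n)⁻¹) = M n * -(q n * (1 - q n)⁻¹) := by ring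
            _ ≤ _ := by rw [h2]; gcongr
      _ = _ := by rw [mul_comm, Real.exp_mul, Real.exp_log h0, Real.rpow_natCast]
  · filter_upwards [hq.eventually (gt_mem_nhds (show (0 : ℝ) < 1 by norm_num))] with n hn
    calc (1 - q n) ^ M n ≤ Real.exp (-q n) ^ M n :=
          pow_le_pow_left₀ (by linarith) (Real.one_sub_le_exp_neg _) _
      _ = _ := by rw [← Real.exp_nat_mul]; ring_nf

/-- At the first threshold the largest eigenvalue is asymptotically the indicator of the event that
there is an edge. -/
theorem tendstoInDistribution_lambdaMax {ν : ℝ≥0}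
    (hν : Tendsto (fun n : ℕ => (p n : ℝ) * 2 ^ n * (n : ℝ)) atTop (𝓝 (ν : ℝ))) :
    TendstoInDistribution (fun (n : ℕ) (G : SimpleGraph (Fin n → Bool)) => lambdaMax G) atTop
        (id : ℝ → ℝ) (fun n => randomCubeSubgraph n (p n))
        (bernoulliMeasure (1 : ℝ) (0 : ℝ) (nonemptyProb ν)) := by
  have hinv : Tendsto (fun n : ℕ => ((2 : ℝ) ^ n)⁻¹) atTop (𝓝 0) :=
    (tendsto_pow_atTop_atTop_of_one_lt (by norm_num : (1 : ℝ) < 2)).inv_tendsto_atTop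
  have hnp : Tendsto (fun n : ℕ => (n : ℝ) * p n) atTop (𝓝 0) := by
    have := hν.mul hinv
    rw [mul_zero] at this
    refine this.congr fun n => ?_
    field_simp
  have hp0 : Tendsto (fun n : ℕ => (p n : ℝ)) atTop (𝓝 0) := by
    refine squeeze_zero' (Eventually.of_forall fun n => (p n).2.1) ?_ hnp
    filter_upwards [eventually_ge_atTop 1] with n hn
    exact le_mul_of_one_le_left (p n).2.1 (by exact_mod_cast hn)
  -- the probability of the empty graph
  have hbot : Tendsto (fun n => (randomCubeSubgraph n (p n)).real {G | G = ⊥}) atTop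
      (𝓝 (Real.exp (-(ν : ℝ) / 2))) := by
    have h1 : Tendsto (fun n : ℕ => ((2 ^ (n - 1) * n : ℕ) : ℝ) * p n) atTop (𝓝 ((ν : ℝ) / 2)) := by
      refine (hν.div_const 2).congr' ?_
      filter_upwards [eventually_ne_atTop 0] with n hn
      obtain ⟨m, rfl⟩ := Nat.exists_eq_succ_of_ne_zero hn
      simp only [Nat.succ_eq_add_one, add_tsub_cancel_right, pow_succ]
      push_cast
      ring
    have h2 := tendsto_one_sub_pow hp0 h1
    rw [neg_div]
    refine h2.congr' ?_
    filter_upwards [eventually_ne_atTop 0] with n hn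
    rw [randomCubeSubgraph_real_eq_bot (p n) hn]
  -- components with two edges are unlikely
  have hbad : Tendsto (fun n => (randomCubeSubgraph n (p n)).real {G | ¬ SmallComponents G 1}) atTop
      (𝓝 0) := by
    have h1 : Tendsto (fun n : ℕ => (2 : ℝ) * ((p n * 2 ^ n * n) * (n * p n))) atTop (𝓝 0) := by
      have := (hν.mul hnp).const_mul 2
      simpa using this
    refine squeeze_zero (fun n => measureReal_nonneg) (fun n => ?_) h1
    refine (randomCubeSubgraph_real_not_smallComponents_le (p n) 1).trans (le_of_eq ?_)
    norm_num [Nat.factorial]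
    ring
  refine ⟨fun n => Measurable.of_discrete.aemeasurable, aemeasurable_id, ?_⟩
  refine ProbabilityMeasure.tendsto_iff_forall_integral_tendsto.2 fun f => ?_
  simp only [ProbabilityMeasure.coe_mk, Measure.map_id]
  have hlim : ∫ x, f x ∂(bernoulliMeasure (1 : ℝ) (0 : ℝ) (nonemptyProb ν)) =
      Real.exp (-(ν : ℝ) / 2) * f 0 + (1 - Real.exp (-(ν : ℝ) / 2)) * f 1 := by
    rw [integral_bernoulliMeasure]
    simp [nonemptyProb]
    ring
  rw [hlim]
  set Q : ℕ → ℝ := fun n => (randomCubeSubgraph n (p n)).real {G | G = ⊥} with hQ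
  have hmain : Tendsto (fun n => Q n * f 0 + (1 - Q n) * f 1) atTop
      (𝓝 (Real.exp (-(ν : ℝ) / 2) * f 0 + (1 - Real.exp (-(ν : ℝ) / 2)) * f 1)) :=
    (hbot.mul_const _).add ((hbot.const_sub 1).mul_const _)
  refine tendsto_of_tendsto_of_dist hmain ?_
  have hb2 := hbad.mul_const (2 * ‖f‖)
  rw [zero_mul] at hb2
  refine squeeze_zero (fun n => dist_nonneg) (fun n => ?_) hb2
  classical
  -- up to the unlikely event the eigenvalue is `0` on the empty graph and `1` elsewhere
  have hg : ∫ G, (if G = ⊥ then f 0 else f 1) ∂(randomCubeSubgraph n (p n)) =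
      Q n * f 0 + (1 - Q n) * f 1 := by
    have h1 : ∀ G : SimpleGraph (Fin n → Bool), (if G = ⊥ then f 0 else f 1) =
        Set.indicator {G | G = ⊥} (fun _ => f 0 - f 1) G + f 1 := by
      intro G
      by_cases hG : G = ⊥ <;> simp [hG]
    simp_rw [h1]
    rw [integral_add .of_finite .of_finite, integral_indicator_const _ .of_discrete]
    simp [hQ]
    ring
  rw [integral_map Measurable.of_discrete.aemeasurable
    f.continuous.measurable.aestronglyMeasurable, ← hg, dist_comm, dist_eq_norm,
    ← integral_sub .of_finite .of_finite]
  calc _ ≤ ∫ G, ‖f (lambdaMax G) - (if G = ⊥ then f 0 else f 1)‖ ∂(randomCubeSubgraph n (p n)) :=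
        norm_integral_le_integral_norm _
    _ ≤ ∫ G, Set.indicator {G | ¬ SmallComponents G 1} (fun _ => 2 * ‖f‖) G
          ∂(randomCubeSubgraph n (p n)) := by
        refine integral_mono_ae .of_finite .of_finite ?_
        filter_upwards [randomCubeSubgraph_ae_le n (p n)] with G hG
        by_cases hs : SmallComponents G 1
        · rw [Set.indicator_of_notMem (by simpa using hs)]
          by_cases hb : G = ⊥
          · rw [if_pos hb, hb, lambdaMax_bot]; simp
          · rw [if_neg hb, lambdaMax_eq_one hG hs hb]; simp
        · rw [Set.indicator_of_mem (by simpa using hs)]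
          refine (norm_sub_le _ _).trans ?_
          have h1 := f.norm_coe_le_norm (lambdaMax G)
          have h2 : ‖if G = ⊥ then f 0 else f 1‖ ≤ ‖f‖ := by
            split_ifs <;> exact f.norm_coe_le_norm _
          linarith
    _ = _ := by
        rw [integral_indicator_const _ .of_discrete, smul_eq_mul]

end FewEdges

/-! ### The five regimes -/

theorem mainTheorem1 (p : ℕ → I)
    (hp : ∃ ε : ℕ → ℝ, Tendsto ε atTop (𝓝 0) ∧
      ∀ᶠ n : ℕ in atTop, (p n : ℝ) ≤ (n : ℝ) ^ (-1 + ε n)) :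
    -- (i): `p` is not exponentially small
    ((∀ γ : ℝ, 1 < γ → (fun n : ℕ => (γ ^ n)⁻¹) =o[atTop] (fun n => (p n : ℝ))) →
      (∀ᵐ G ∂(randomCubeSubgraphs p),
        ((fun n => lambdaMax (G n)) ~[atTop] (fun n => √(maxDeg (G n) : ℝ))) ∧
        ((fun n => √(maxDeg (G n) : ℝ)) ~[atTop]
          (fun n : ℕ => √((n : ℝ) * Real.log 2 / Real.log (p n : ℝ)⁻¹)))) ∧
      (∀ α : ℝ, 0 < α → α < 1 → ∀ᶠ n : ℕ in atTop,
        1 - (2 : ℝ) ^ (α * (n : ℝ)) *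
            Real.exp (-((2 * (p n : ℝ) * Real.log (p n : ℝ)⁻¹) ^ 2)⁻¹) ≤
          (randomCubeSubgraph n (p n)).real
            {G | (2 : ℝ) ^ ⌊α * (n : ℝ)⌋₊ / (2 * (n : ℝ) ^ 2) ≤
              (Nat.card {v // √((1 - α) * (n : ℝ) * Real.log 2 *
                    (1 - 1 / Real.log (Real.log (p n : ℝ)⁻¹)) / Real.log (p n : ℝ)⁻¹ - 2) ≤
                  adjEigenvalues G v} : ℝ)})) ∧
    -- (ii): `p` is exponentially small but not proportional to a threshold
    ((threshold 1 =o[atTop] (fun n => (p n : ℝ))) →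
      (∃ γ : ℝ, 1 < γ ∧ γ ≤ 2 ∧ ∀ᶠ n : ℕ in atTop, (p n : ℝ) ≤ (γ ^ n)⁻¹) →
      (∀ k : ℕ, 2 ≤ k → NowhereProportional (fun n => (p n : ℝ)) (threshold k)) →
      WithHighProb p (fun n G =>
        lambdaMax G = √(maxDeg G : ℝ) ∧
        √(maxDeg G : ℝ) =
          √(⌊(n : ℝ) * Real.log 2 / (Real.log (p n : ℝ)⁻¹ - Real.log (n : ℝ))⌋ : ℝ))) ∧
    -- (iii): `p` is proportional to a threshold
    (∀ k : ℕ, 2 ≤ k → ((fun n => (p n : ℝ)) =Θ[atTop] threshold k) →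
      WithHighProb p (fun n G =>
        √(maxDeg G : ℝ) ≤ lambdaMax G ∧ lambdaMax G < √((maxDeg G : ℝ) + 1) ∧
        |(maxDeg G : ℤ) -
          ⌊(n : ℝ) * Real.log 2 / (Real.log (p n : ℝ)⁻¹ - Real.log (n : ℝ))⌋| ≤ 1)) ∧
    -- (iv): Bernoulli limit
    (∀ ν : ℝ≥0, Tendsto (fun n : ℕ => (p n : ℝ) * 2 ^ n * (n : ℝ)) atTop (𝓝 (ν : ℝ)) →
      TendstoInDistribution (fun (n : ℕ) (G : SimpleGraph (Fin n → Bool)) => lambdaMax G) atTop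
        (id : ℝ → ℝ) (fun n => randomCubeSubgraph n (p n))
        (bernoulliMeasure (1 : ℝ) (0 : ℝ) (nonemptyProb ν))) ∧
    -- (v): empty graph
    (((fun n => (p n : ℝ)) =o[atTop] threshold 1) →
      WithHighProb p (fun _ G => G = ⊥ ∧ lambdaMax G = 0)) := by
  exact ⟨fun h => ⟨ae_isEquivalent_of_subexponential hp h,
      fun _ hα hα1 => eventually_many_eigenvalues hp h hα hα1⟩,
    fun h1 hγ hk => withHighProb_of_nowhereProportional h1 hγ hk,
    fun _ hk hθ => withHighProb_of_isTheta_threshold hk hθ,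
    fun _ hν => tendstoInDistribution_lambdaMax hν,
    fun h => withHighProb_eq_bot h⟩
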